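/- Let $q=p^f$ ($p$ prime, $f\ge 1$) and let $\Gamma$ be a connected $3$-spherical Lie diagram on a finite set $I$, all of whose rank-two subdiagrams are of type $A_1\times A_1$ (non-edges), $A_2$, $C_2$ or ${}^2\!A_3$ (the last two in either orientation); $3$-spherical means that in the Coxeter group of the underlying Coxeter diagram (labels $2,3,4,4$) every subgroup $W_J$ generated by the simple reflections $s_j$, $j\in J$, with $|J|=3$ is finite. Let $\mathscr G=\{\mathbf G_i,\mathbf G_{i,j},\mathbf g_{i,j}\}$ be a Curtis–Tits amalgam with diagram $\Gamma$ over $\mathbb F_q$, that is, an amalgam over the poset of subsets of $I$ of size $1$ or $2$, with injective connecting maps $\mathbf g_{i,j}\colon\mathbf G_i\to\mathbf G_{i,j}$ with images $\bar{\mathbf G}_i$, such that for all $i\ne j$ the triple $(\mathbf G_{i,j},\bar{\mathbf G}_i,\bar{\mathbf G}_j)$ is isomorphic to a standard pair of type $\Gamma_{i,j}(q^e)$ for some $e\ge1$, where $e=1$ occurs for some edge (in particular $|I|\ge 2$). With $Q=q^e$, the standard pairs $(\mathbf G,\mathbf G_1,\mathbf G_2)$ are: - $A_1\times A_1$: $\mathbf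 G=\mathbf G_1\times\mathbf G_2$, each $\mathbf G_k$ being isomorphic to $\mathrm{SL}_2$ over a finite extension of $\mathbb F_Q$; - $A_2(Q)$: $\mathbf G=\mathrm{SL}_3(Q)$, with $\mathbf G_1,\mathbf G_2$ the two diagonal block subgroups $\mathrm{SL}_2(Q)$ on $\langle e_1,e_2\rangle$ and $\langle e_2,e_3\rangle$; - $C_2(Q)$: $\mathbf G=\mathrm{Sp}_4(Q)$ with hyperbolic pairs $(e_1,e_3)$, $(e_2,e_4)$; $\mathbf G_1\cong\mathrm{SL}_2(Q)$ acts naturally on $\langle e_1,e_2\rangle$ and dually on $\langle e_3,e_4\rangle$, and $\mathbf G_2\cong \mathrm{SL}_2(Q)$ is the stabilizer of $e_1$ and $e_3$; - ${}^2\!A_3(Q)$: $\mathbf G=\mathrm{SU}_4(Q)$ over $\mathbb F_{Q^2}$ with hyperbolic pairs $(e_1,e_3)$, $(e_2,e_4)$; $\mathbf G_1\cong\mathrm{SL}_2(Q^2)$ acts naturally on $\langle e_1,e_2\rangle$ and conjugate-dually on $\langle e_3,e_4\rangle$, and $\mathbf G_2\cong\mathrm{SU}_2(Q)\cong\mathrm{SL}_2(Q)$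 is the group that fixes $e_1$ and $e_3$ and acts as $\mathrm{SU}_2(Q)$ on $\langle e_2,e_4\rangle$. In $\mathbf G_{i,j}$, $\{i,j\}$ an edge, a Borel subgroup is the normalizer of a Sylow $p$-subgroup, a parabolic subgroup is a proper subgroup containing a Borel subgroup, and two Borel subgroups are opposite if their Sylow $p$-subgroups intersect trivially. A *weak system of fundamental root groups* of $\mathscr G$ is a family $(\{\mathbf X_i^+,\mathbf X_i^-\})_{i\in I}$ of unordered pairs of opposite root groups of $\mathbf G_i$ (distinct Sylow $p$-subgroups with trivial intersection) such that for every edge $\{i,j\}$ there are opposite Borel subgroups $\mathbf B_{i,j}^+$, $\mathbf B_{i,j}^-$ of $\mathbf G_{i,j}$, each of the form $\mathbf P\cap\mathbf P'$ with parabolic subgroups $\mathbf P\ge\bar{\mathbf G}_i$ and $\mathbf P'\ge\bar{\mathbf G}_j$, and each containing the image of exactly one of $\mathbf X_i^+,\mathbf X_i^-$ and of exactly one of $\mathbf X_j^+,\mathbf X_j^-$. If $\mathscr G$ has a non-trivial completion (a non-trivial group $G$ with homomorphisms from all groups of $\mathscr G$ that are compatible with the connecting maps and whose images generate $G$), then $\mathscr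 G$ has a unique weak system of fundamental root groups. -/

import Mathlib

open scoped Matrix

universe u v

/-! ### Amalgams and completions -/

/-- An amalgam of groups over a poset `P`. -/
structure Amalgam (P : Type v) [PartialOrder P] where
  grp : P → Type u
  [group : ∀ x, Group (grp x)]
  incl : ∀ {x y : P}, x < y → (grp x →* grp y)
  incl_injective : ∀ {x y : P} (h : x < y), Function.Injective (incl h)
  incl_comp : ∀ {x y z : P} (h : x < y) (k : y < z),
    (incl k).comp (incl h) = incl (h.trans k)

attribute [instance] Amalgam.group

/-- A completion of the amalgam `𝒢` with underlying group `A`. -/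
structure Amalgam.Completion {P : Type v} [PartialOrder P] (𝒢 : Amalgam.{u, v} P)
    (A : Type*) [Group A] where
  hom : ∀ x, 𝒢.grp x →* A
  hom_comp : ∀ {x y : P} (h : x < y), (hom y).comp (𝒢.incl h) = hom x
  generates : ⨆ x, (hom x).range = ⊤

/-! ### Diagrams -/

/-- The types of rank-two Lie diagrams on an ordered pair of nodes. `C2op` (that is `B₂`) and
`twA3op` (that is `²D₃`) are `C2` and `twA3` with the two nodes interchanged. -/
inductive RankTwoType
  | A1A1 | A2 | C2 | C2op | twA3 | twA3op

namespace RankTwoType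

/-- The type obtained by interchanging the two nodes. -/
def swap : RankTwoType → RankTwoType
  | A1A1 => A1A1
  | A2 => A2
  | C2 => C2op
  | C2op => C2
  | twA3 => twA3op
  | twA3op => twA3

/-- The label of the underlying Coxeter diagram. -/
def coxeterLabel : RankTwoType → ℕ
  | A1A1 => 2
  | A2 => 3
  | C2 => 4
  | C2op => 4
  | twA3 => 4
  | twA3op => 4

theorem coxeterLabel_swap (t : RankTwoType) : t.swap.coxeterLabel = t.coxeterLabel := by
  cases t <;> rfl

theorem coxeterLabel_ne_one (t : RankTwoType) : t.coxeterLabel ≠ 1 := by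
  cases t <;> decide

end RankTwoType

/-- A Lie diagram on the node set `I` all of whose rank-two subdiagrams are of type
`A₁ × A₁`, `A₂`, `C₂` or `²A₃` (values of `label` on the diagonal are irrelevant). -/
structure LieDiagram (I : Type*) where
  label : I → I → RankTwoType
  label_swap : ∀ i j, i ≠ j → label j i = (label i j).swap

namespace LieDiagram

variable {I : Type*}

/-- The underlying graph: two distinct nodes are joined unless their type is `A₁ × A₁`. -/
def graph (Γ : LieDiagram I) : SimpleGraph I where
  Adj i j := i ≠ j ∧ Γ.label i j ≠ RankTwoType.A1A1
  symm := ⟨by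
    rintro i j ⟨hij, h⟩
    refine ⟨hij.symm, ?_⟩
    rw [Γ.label_swap i j hij]
    cases hl : Γ.label i j <;> simp_all [RankTwoType.swap]⟩
  loopless := ⟨fun i h => h.1 rfl⟩

/-- The Coxeter matrix of the underlying Coxeter diagram. -/
def coxeterMatrix [DecidableEq I] (Γ : LieDiagram I) : CoxeterMatrix I where
  M := Matrix.of fun i j => if i = j then 1 else (Γ.label i j).coxeterLabel
  isSymm := by
    ext i j
    by_cases h : i = j
    · subst h; simp
    · simp [h, Ne.symm h, Γ.label_swap i j h, RankTwoType.coxeterLabel_swap]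
  diagonal i := by simp
  off_diagonal i j h := by simpa [h] using RankTwoType.coxeterLabel_ne_one _

/-- Every subgroup `W_J` with `|J| = 3` of the Coxeter group is finite. -/
def ThreeSpherical [DecidableEq I] (Γ : LieDiagram I) : Prop :=
  ∀ J : Finset I, J.card = 3 →
    Finite (Subgroup.closure (Γ.coxeterMatrix.simple '' (J : Set I)))

end LieDiagram

/-! ### Curtis-Tits standard pairs -/

/-- The special unitary group `SU₄` over the field `K` with involution `σ`, for the hermitian
form with Gram matrix `M = (0, 1; 1, 0)` with respect to the basis `e₁, e₂ | e₃, e₄`. -/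
def hyperbolicSU {K : Type*} [Field K] (σ : K →+* K) :
    Subgroup (Matrix.SpecialLinearGroup (Fin 2 ⊕ Fin 2) K) where
  carrier := {A | (A.1)ᵀ * Matrix.fromBlocks 0 1 1 0 * A.1.map σ = Matrix.fromBlocks 0 1 1 0}
  one_mem' := by simp
  mul_mem' := by
    intro A B hA hB
    simp only [Set.mem_ofPred_eq] at *
    rw [Matrix.SpecialLinearGroup.coe_mul, Matrix.transpose_mul, Matrix.map_mul]
    calc _ = (B.1)ᵀ * ((A.1)ᵀ * Matrix.fromBlocks 0 1 1 0 * A.1.map σ) * B.1.map σ := by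
          simp only [Matrix.mul_assoc]
      _ = _ := by rw [hA, hB]
  inv_mem' := by
    intro A hA
    simp only [Set.mem_ofPred_eq] at *
    have h1 : (A.1)ᵀ * (A⁻¹).1ᵀ = 1 := by
      rw [← Matrix.transpose_mul, ← Matrix.SpecialLinearGroup.coe_mul]; simp
    have h1' : (A⁻¹).1ᵀ * (A.1)ᵀ = 1 := by
      rw [← Matrix.transpose_mul, ← Matrix.SpecialLinearGroup.coe_mul]; simp
    have h2 : A.1.map σ * (A⁻¹).1.map σ = 1 := by
      rw [← Matrix.map_mul, ← Matrix.SpecialLinearGroup.coe_mul]; simp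
    calc _ = (A⁻¹).1ᵀ * ((A.1)ᵀ * Matrix.fromBlocks 0 1 1 0 * A.1.map σ) *
            (A⁻¹).1.map σ := by rw [hA]
      _ = ((A⁻¹).1ᵀ * (A.1)ᵀ) * Matrix.fromBlocks 0 1 1 0 *
            (A.1.map σ * (A⁻¹).1.map σ) := by simp only [Matrix.mul_assoc]
      _ = _ := by rw [h1', h2]; simp

namespace StandardPair

variable (p : ℕ) [Fact p.Prime] (n : ℕ) {G : Type*} [Group G] (G₁ G₂ : Subgroup G)

/-- Type `A₁ × A₁` over `𝔽_Q`, `Q = pⁿ`: `G = G₁ × G₂`, each factor being an `SL₂` over a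
finite extension of `𝔽_Q` (in a diagram with edges of type `²A₃`, two non-adjacent nodes may
carry different extensions). -/
def IsA1A1 : Prop :=
  ∃ k l : ℕ, 0 < k ∧ 0 < l ∧
  ∃ φ : G ≃* Matrix.SpecialLinearGroup (Fin 2) (GaloisField p (n * k)) ×
      Matrix.SpecialLinearGroup (Fin 2) (GaloisField p (n * l)),
    (∀ x, x ∈ G₁ ↔ (φ x).2 = 1) ∧ (∀ x, x ∈ G₂ ↔ (φ x).1 = 1)

/-- Type `A₂(Q)`, `Q = pⁿ`: the two diagonal block `SL₂`'s in `SL₃(Q)`. -/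
def IsA2 : Prop :=
  ∃ φ : G ≃* Matrix.SpecialLinearGroup (Fin 3) (GaloisField p n),
    (∀ x, x ∈ G₁ ↔ ∃ a b c d : GaloisField p n, a * d - b * c = 1 ∧
      (φ x).1 = !![a, b, 0; c, d, 0; 0, 0, 1]) ∧
    (∀ x, x ∈ G₂ ↔ ∃ a b c d : GaloisField p n, a * d - b * c = 1 ∧
      (φ x).1 = !![1, 0, 0; 0, a, b; 0, c, d])

/-- Type `C₂(Q)`, `Q = pⁿ`: in `Sp₄(Q)`, with basis `e₁, e₂ | e₃, e₄`, the group `G₁` acts on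
`⟨e₁, e₂⟩` and dually on `⟨e₃, e₄⟩`, and `G₂` fixes `e₁` and `e₃`. -/
def IsC2 : Prop :=
  ∃ φ : G ≃* Matrix.symplecticGroup (Fin 2) (GaloisField p n),
    (∀ x, x ∈ G₁ ↔ ∃ a b c d : GaloisField p n, a * d - b * c = 1 ∧
      (φ x).1 = Matrix.fromBlocks !![a, b; c, d] 0 0 !![d, -c; -b, a]) ∧
    (∀ x, x ∈ G₂ ↔ ∃ a b c d : GaloisField p n, a * d - b * c = 1 ∧
      (φ x).1 = Matrix.fromBlocks !![1, 0; 0, a] !![0, 0; 0, b] !![0, 0; 0, c] !![1, 0; 0, d])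

/-- Type `²A₃(Q)`, `Q = pⁿ`: in `SU₄(Q)` over `𝔽_{Q²}` with `σ : x ↦ x ^ Q`. Here
`G₁ ≅ SL₂(Q²)`, and `G₂ ≅ SL₂(Q)`, where the elements of `𝔽_Q` are those with `x ^ Q = x`. -/
def IsTwA3 : Prop :=
  ∃ φ : G ≃* hyperbolicSU (iterateFrobenius (GaloisField p (2 * n)) p n),
    (∀ x, x ∈ G₁ ↔ ∃ a b c d : GaloisField p (2 * n), a * d - b * c = 1 ∧
      (φ x).1.1 = Matrix.fromBlocks !![a, b; c, d] 0 0
        !![d ^ p ^ n, -c ^ p ^ n; -b ^ p ^ n, a ^ p ^ n]) ∧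
    ∃ η : GaloisField p (2 * n), η ≠ 0 ∧ η + η ^ p ^ n = 0 ∧
    (∀ x, x ∈ G₂ ↔ ∃ a b c d : GaloisField p (2 * n),
      a ^ p ^ n = a ∧ b ^ p ^ n = b ∧ c ^ p ^ n = c ∧ d ^ p ^ n = d ∧ a * d - b * c = 1 ∧
      (φ x).1.1 = Matrix.fromBlocks !![1, 0; 0, a] !![0, 0; 0, b * η]
        !![0, 0; 0, c * η⁻¹] !![1, 0; 0, d])

end StandardPair

/-- `(G, G₁, G₂)` is (isomorphic to) a Curtis-Tits standard pair of type `t(pⁿ)`. -/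
def IsStandardPair (p : ℕ) [Fact p.Prime] (n : ℕ) (t : RankTwoType) {G : Type*} [Group G]
    (G₁ G₂ : Subgroup G) : Prop :=
  match t with
  | .A1A1 => StandardPair.IsA1A1 p n G₁ G₂
  | .A2 => StandardPair.IsA2 p n G₁ G₂
  | .C2 => StandardPair.IsC2 p n G₁ G₂
  | .C2op => StandardPair.IsC2 p n G₂ G₁
  | .twA3 => StandardPair.IsTwA3 p n G₁ G₂
  | .twA3op => StandardPair.IsTwA3 p n G₂ G₁

/-! ### Curtis-Tits amalgams -/

/-- The poset of subsets `J` of `I` with `1 ≤ |J| ≤ 2`, ordered by inclusion. -/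
abbrev AmalgamIndex (I : Type*) : Type _ :=
  {J : Finset I // J.Nonempty ∧ J.card ≤ 2}

namespace AmalgamIndex

variable {I : Type*} [DecidableEq I]

/-- The index `{i}`. -/
def vertex (i : I) : AmalgamIndex I := ⟨{i}, by simp⟩

/-- The index `{i, j}`. -/
def pair (i j : I) : AmalgamIndex I := ⟨{i, j}, by simp, Finset.card_le_two⟩

theorem vertex_lt_left {i j : I} (h : i ≠ j) : vertex i < pair i j := by
  change ({i} : Finset I) < {i, j}
  rw [Finset.ssubset_iff_of_subset (by simp)]
  exact ⟨j, by simp, by simpa using h.symm⟩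

theorem vertex_lt_right {i j : I} (h : i ≠ j) : vertex j < pair i j := by
  change ({j} : Finset I) < {i, j}
  rw [Finset.ssubset_iff_of_subset (by simp)]
  exact ⟨i, by simp, by simpa using h⟩

end AmalgamIndex

namespace Amalgam

variable {I : Type v} [DecidableEq I] (𝒢 : Amalgam.{u, v} (AmalgamIndex I))

/-- The vertex group `G_i`. -/
abbrev vertexGroup (i : I) : Type u := 𝒢.grp (AmalgamIndex.vertex i)

/-- The group `G_{i,j}`, attached to the unordered pair `{i, j}`. -/
abbrev pairGroup (i j : I) : Type u := 𝒢.grp (AmalgamIndex.pair i j)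

/-- The inclusion `G_i → G_{i,j}`. -/
abbrev inclLeft {i j : I} (h : i ≠ j) : 𝒢.vertexGroup i →* 𝒢.pairGroup i j :=
  𝒢.incl (AmalgamIndex.vertex_lt_left h)

/-- The inclusion `G_j → G_{i,j}`. -/
abbrev inclRight {i j : I} (h : i ≠ j) : 𝒢.vertexGroup j →* 𝒢.pairGroup i j :=
  𝒢.incl (AmalgamIndex.vertex_lt_right h)

/-- `𝒢` is a Curtis-Tits amalgam with Lie diagram `Γ` over the field with `q = p ^ f` elements:
every `(G_{i,j}, G_i, G_j)` is a standard pair of type `Γ_{i,j}(q ^ e)` for some `e ≥ 1`, and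
`e = 1` occurs for some edge. -/
structure IsCurtisTits (p : ℕ) [Fact p.Prime] (f : ℕ) (Γ : LieDiagram I) : Prop where
  standard : ∀ (i j : I) (h : i ≠ j), ∃ e : ℕ, 0 < e ∧
    IsStandardPair p (f * e) (Γ.label i j) (𝒢.inclLeft h).range (𝒢.inclRight h).range
  base_field : ∃ (i j : I) (h : Γ.graph.Adj i j),
    IsStandardPair p f (Γ.label i j) (𝒢.inclLeft h.1).range (𝒢.inclRight h.1).range

end Amalgam

/-! ### Borel subgroups and weak systems of fundamental root groups

The notions in the first part are for a finite group `G` of Lie type in characteristic `p`. -/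

section Borel

variable (p : ℕ) {G : Type*} [Group G]

/-- A Borel subgroup: the normalizer of a Sylow `p`-subgroup. -/
def IsBorel (B : Subgroup G) : Prop :=
  ∃ U : Sylow p G, B = Subgroup.normalizer ((U : Subgroup G) : Set G)

/-- A (proper) parabolic subgroup: a proper subgroup containing a Borel subgroup. -/
def IsParabolic (P : Subgroup G) : Prop :=
  P ≠ ⊤ ∧ ∃ B : Subgroup G, IsBorel p B ∧ B ≤ P

/-- Opposite Borel subgroups: those whose Sylow `p`-subgroups intersect trivially. -/
def AreOppositeBorels (B C : Subgroup G) : Prop :=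
  ∃ U V : Sylow p G, B = Subgroup.normalizer ((U : Subgroup G) : Set G) ∧
    C = Subgroup.normalizer ((V : Subgroup G) : Set G) ∧ (U : Subgroup G) ⊓ (V : Subgroup G) = ⊥

/-- `B` is the intersection of a parabolic subgroup containing `G₁` and one containing `G₂`. -/
def IsAdapted (G₁ G₂ B : Subgroup G) : Prop :=
  ∃ P Q : Subgroup G, IsParabolic p P ∧ IsParabolic p Q ∧ G₁ ≤ P ∧ G₂ ≤ Q ∧ B = P ⊓ Q

end Borel

namespace Amalgam

variable {I : Type v} [DecidableEq I]

/-- `X` assigns to every node `i` the unordered pair `X i = {X_i⁺, X_i⁻}` of opposite root groups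
(Sylow `p`-subgroups with trivial intersection) of `G_i`, such that for every edge `{i, j}` there
are opposite Borel subgroups `B⁺`, `B⁻` of `G_{i,j}`, each of the form `P ⊓ Q` with parabolic
`P ≥ G_i` and `Q ≥ G_j`, and each containing the image of exactly one of `X_i⁺, X_i⁻` and the
image of exactly one of `X_j⁺, X_j⁻`. -/
structure IsWeakSystem (𝒢 : Amalgam.{u, v} (AmalgamIndex I)) (p : ℕ) (Γ : LieDiagram I)
    (X : ∀ i, Set (Sylow p (𝒢.vertexGroup i))) : Prop where
  opposite : ∀ i, ∃ P Q : Sylow p (𝒢.vertexGroup i), P ≠ Q ∧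
    (P : Subgroup (𝒢.vertexGroup i)) ⊓ (Q : Subgroup (𝒢.vertexGroup i)) = ⊥ ∧ X i = {P, Q}
  edge : ∀ (i j : I) (h : Γ.graph.Adj i j),
    ∃ Bp Bm : Subgroup (𝒢.pairGroup i j), AreOppositeBorels p Bp Bm ∧
      ∀ B : Subgroup (𝒢.pairGroup i j), (B = Bp ∨ B = Bm) →
        IsAdapted p (𝒢.inclLeft h.1).range (𝒢.inclRight h.1).range B ∧
        (∃! P : Sylow p (𝒢.vertexGroup i), P ∈ X i ∧
          (P : Subgroup (𝒢.vertexGroup i)).map (𝒢.inclLeft h.1) ≤ B) ∧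
        (∃! P : Sylow p (𝒢.vertexGroup j), P ∈ X j ∧
          (P : Subgroup (𝒢.vertexGroup j)).map (𝒢.inclRight h.1) ≤ B)

end Amalgam

/-!
A weak system of fundamental root groups is determined edge by edge. Let `(G, G₁, G₂)` be a
standard pair whose type is not `A₁ × A₁`. There are exactly two Borel subgroups of `G` that are
intersections of a parabolic subgroup containing `G₁` and one containing `G₂`; they are opposite,
and each contains exactly one Sylow `p`-subgroup of `G₁` and one of `G₂`. This is part of
`IsApartment`, which is proved in `MatrixRep.IsA2.isApartment` for `SL₃` and in
`MatrixRep.IsUnitary.isApartment` for `Sp₄` and `SU₄` at once, as groups of isometries of a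
skew-hermitian form whose involution may be trivial. So an edge `{i, j}` singles out
two opposite root groups of the vertex group `G_i`, and uniqueness is immediate. For existence it
has to be shown that the edges `{i, j}` and `{i, k}` at a node `i` single out the same two root
groups.

The numbers game, as a representation of the Coxeter group by integral matrices, shows that in a
3-spherical diagram `j` and `k` are not joined, and that one of the two edges, say `{i, j}`, is of
type `A₂` (`LieDiagram.ThreeSpherical.label_eq_A2`). Suppose that a root group `Q` of `G_i` belongs
to `{i, k}` but not to `{i, j}`. The root group `D` of `G_k` that is opposite to the one next to
`Q` commutes with `Q`, and its image in the completion commutes with that of `G_j`. In `SL₃`, the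
block `G_j` and a root group of `G_i` outside of the apartment generate everything, so the image
of `D` centralizes that of `G_i`. Hence the kernel of the completion on `G_{i,k}` contains the
commutators of `D` with `G_i`, and therefore a non-trivial element of `G_i`. As a non-trivial
element of a block normally generates `SL₃`, the group `G_i` is trivial in the completion, and
since the diagram is connected so is the whole completion
(`Amalgam.IsCurtisTits.edgeRoots_subset`).
-/

open scoped commutatorElement

/-! ### Sylow subgroups of groups of triangular matrices -/

/-- A criterion for a `p`-subgroup `U` to be a Sylow subgroup, by the normalizer condition in
a Sylow subgroup that contains `U`. -/
theorem IsPGroup.exists_sylow_eq_of_normalizer_le {p : ℕ} [Fact p.Prime] {G : Type*} [Group G]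
    [Finite G] {U B : Subgroup G} (hU : IsPGroup p U)
    (hN : Subgroup.normalizer (U : Set G) ≤ B)
    (hB : ∀ x ∈ B, ∀ k : ℕ, x ^ p ^ k = 1 → x ∈ U) : ∃ S : Sylow p G, (S : Subgroup G) = U := by
  obtain ⟨S, hS⟩ := hU.exists_le_sylow
  refine ⟨S, le_antisymm ?_ hS⟩
  by_contra hlt
  have hnil := S.isPGroup'.isNilpotent
  have h1 : U.subgroupOf (S : Subgroup G) < ⊤ := by
    rw [lt_top_iff_ne_top, Ne, Subgroup.subgroupOf_eq_top]
    exact hlt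
  have h2 := Group.normalizerCondition_of_isNilpotent _ h1
  obtain ⟨s, hs, hsU⟩ := SetLike.exists_of_lt h2
  apply hsU
  rw [Subgroup.mem_subgroupOf]
  obtain ⟨k, hk⟩ := S.isPGroup' s
  refine hB _ (hN ?_) k (by simpa using congrArg Subtype.val hk)
  rw [Subgroup.mem_normalizer_iff] at hs ⊢
  intro x
  constructor
  · intro hx
    have := (hs ⟨x, hS hx⟩).1 (by simpa [Subgroup.mem_subgroupOf] using hx)
    simpa [Subgroup.mem_subgroupOf] using this
  · intro hx
    have hxS : x ∈ (S : Subgroup G) := by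
      have h3 := S.mul_mem (S.mul_mem (S.inv_mem s.2) (hS hx)) s.2
      simpa [mul_assoc] using h3
    have := (hs ⟨x, hxS⟩).2 (by simpa [Subgroup.mem_subgroupOf] using hx)
    simpa [Subgroup.mem_subgroupOf] using this

theorem Sylow.exists_conj {p : ℕ} [Fact p.Prime] {G : Type*} [Group G] [Finite G]
    (S T : Sylow p G) : ∃ g : G, ∀ x, x ∈ (T : Subgroup G) ↔ ∃ y ∈ (S : Subgroup G),
      x = g * y * g⁻¹ := by
  obtain ⟨g, rfl⟩ := MulAction.exists_smul_eq G S T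
  refine ⟨g, fun x => ?_⟩
  rw [Sylow.coe_subgroup_smul]
  constructor
  · rintro ⟨y, hy, rfl⟩
    exact ⟨y, hy, rfl⟩
  · rintro ⟨y, hy, rfl⟩
    exact ⟨y, hy, rfl⟩

theorem Matrix.BlockTriangular.mul_apply_self {R : Type*} [Semiring R] {n : ℕ}
    {A B : Matrix (Fin n) (Fin n) R} (hA : A.BlockTriangular id) (hB : B.BlockTriangular id)
    (i : Fin n) : (A * B) i i = A i i * B i i := by
  rw [Matrix.mul_apply, Finset.sum_eq_single i]
  · intro j _ hj
    rcases lt_or_gt_of_ne hj with h | h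
    · rw [hA h, zero_mul]
    · rw [hB h, mul_zero]
  · simp

namespace MatrixRep

variable {G : Type*} [Group G] {K : Type*} [Field K] {n : ℕ}

/-- The elements of `G` that act as block triangular matrices for the partition of the indices
given by `b`, that is, the stabilizer of a flag of coordinate subspaces. -/
def blockTriangular {α : Type*} [LinearOrder α] (ρ : G →* Matrix (Fin n) (Fin n) K)
    (b : Fin n → α) : Subgroup G where
  carrier := {x | (ρ x).BlockTriangular b}
  one_mem' := by simpa using Matrix.blockTriangular_one
  mul_mem' := by
    intro x y hx hy
    simpa using Matrix.BlockTriangular.mul hx hy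
  inv_mem' := by
    intro x hx
    have h : ρ x⁻¹ * ρ x = 1 := by simp [← map_mul]
    let _ := invertibleOfLeftInverse _ _ h
    have h2 := Matrix.blockTriangular_inv_of_blockTriangular (M := ρ x) hx
    rwa [Matrix.inv_eq_left_inv h] at h2

/-- The elements of `G` that act as upper triangular matrices. -/
abbrev triangular (ρ : G →* Matrix (Fin n) (Fin n) K) : Subgroup G := blockTriangular ρ id

/-- The elements of `G` that act as upper unitriangular matrices. -/
def unitriangular (ρ : G →* Matrix (Fin n) (Fin n) K) : Subgroup G where
  carrier := {x | (ρ x).BlockTriangular id ∧ ∀ i, ρ x i i = 1}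
  one_mem' := ⟨(triangular ρ).one_mem, by simp⟩
  mul_mem' := by
    intro x y hx hy
    refine ⟨(triangular ρ).mul_mem hx.1 hy.1, fun i => ?_⟩
    rw [map_mul, Matrix.BlockTriangular.mul_apply_self hx.1 hy.1, hx.2, hy.2, one_mul]
  inv_mem' := by
    intro x hx
    refine ⟨(triangular ρ).inv_mem hx.1, fun i => ?_⟩
    have h := Matrix.BlockTriangular.mul_apply_self hx.1 ((triangular ρ).inv_mem hx.1) i
    rw [← map_mul] at h
    simpa [hx.2] using h.symm

variable {ρ : G →* Matrix (Fin n) (Fin n) K}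

theorem mem_blockTriangular {α : Type*} [LinearOrder α] {b : Fin n → α} {x : G} :
    x ∈ blockTriangular ρ b ↔ ∀ i j, b j < b i → ρ x i j = 0 :=
  ⟨fun h _ _ hij => h hij, fun h i j hij => h i j hij⟩

theorem mem_triangular {x : G} : x ∈ triangular ρ ↔ ∀ i j, j < i → ρ x i j = 0 :=
  ⟨fun h _ _ hij => h hij, fun h i j hij => h i j hij⟩

theorem triangular_le_normalizer :
    triangular ρ ≤ Subgroup.normalizer (unitriangular ρ : Set G) := by
  have key : ∀ x ∈ triangular ρ, ∀ u ∈ unitriangular ρ, x * u * x⁻¹ ∈ unitriangular ρ := by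
    intro x hx u hu
    have hxu := (triangular ρ).mul_mem hx hu.1
    refine ⟨(triangular ρ).mul_mem hxu ((triangular ρ).inv_mem hx), fun i => ?_⟩
    rw [map_mul, Matrix.BlockTriangular.mul_apply_self hxu ((triangular ρ).inv_mem hx), map_mul,
      Matrix.BlockTriangular.mul_apply_self hx hu.1, hu.2, mul_one,
      ← Matrix.BlockTriangular.mul_apply_self hx ((triangular ρ).inv_mem hx), ← map_mul]
    simp
  intro x hx
  rw [Subgroup.mem_normalizer_iff]
  intro u
  refine ⟨key x hx u, fun h => ?_⟩
  have := key x⁻¹ ((triangular ρ).inv_mem hx) _ h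
  simpa [mul_assoc] using this

section CharP

variable {p : ℕ}

theorem normalizer_eq_triangular {S : Sylow p G} (hS : (S : Subgroup G) = unitriangular ρ)
    (hN : Subgroup.normalizer (unitriangular ρ : Set G) ≤ triangular ρ) :
    Subgroup.normalizer ((S : Subgroup G) : Set G) = triangular ρ := by
  rw [hS]
  exact le_antisymm hN triangular_le_normalizer

variable [Fact p.Prime] [CharP K p]

/-- A unitriangular matrix is unipotent by the Cayley-Hamilton theorem, hence of `p`-power
order. -/
theorem isPGroup_unitriangular (hρ : Function.Injective ρ) : IsPGroup p (unitriangular ρ) := by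
  rintro ⟨x, hx⟩
  obtain ⟨k, hk⟩ : ∃ k : ℕ, n ≤ p ^ k :=
    ⟨n, (Nat.lt_pow_self (Fact.out : p.Prime).one_lt).le⟩
  refine ⟨k, Subtype.ext (hρ ?_)⟩
  have h1 : (ρ x - 1) ^ n = 0 := by
    have h := Matrix.aeval_self_charpoly (ρ x)
    rw [Matrix.charpoly_of_isUpperTriangular _ hx.1] at h
    simpa [hx.2] using h
  have h2 : (ρ x - 1) ^ p ^ k = 0 := by
    rw [← Nat.add_sub_cancel' hk, pow_add, h1, zero_mul]
  rcases Nat.eq_zero_or_pos n with rfl | hn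
  · exact Subsingleton.elim _ _
  have : Nonempty (Fin n) := ⟨⟨0, hn⟩⟩
  rw [sub_pow_char_pow_of_commute _ _ (Commute.one_right (ρ x)), one_pow, sub_eq_zero] at h2
  simpa using h2

theorem mem_unitriangular_of_pow_eq_one {x : G} (hx : x ∈ triangular ρ) {k : ℕ}
    (hk : x ^ p ^ k = 1) : x ∈ unitriangular ρ := by
  refine ⟨hx, fun i => ?_⟩
  have h : ∀ m : ℕ, ρ (x ^ m) i i = ρ x i i ^ m := by
    intro m
    induction m with
    | zero => simp
    | succ m ih =>
      rw [pow_succ, map_mul,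
        Matrix.BlockTriangular.mul_apply_self ((triangular ρ).pow_mem hx m) hx, ih, pow_succ]
  have h2 := h (p ^ k)
  rw [hk, map_one, Matrix.one_apply_eq] at h2
  have h3 : (ρ x i i - 1) ^ p ^ k = 0 := by rw [sub_pow_char_pow, ← h2, one_pow, sub_self]
  exact sub_eq_zero.1 (pow_eq_zero_iff (pow_ne_zero _ (Fact.out : p.Prime).ne_zero) |>.1 h3)

theorem le_unitriangular {H : Subgroup G} (hH : IsPGroup p H) (hle : H ≤ triangular ρ) :
    H ≤ unitriangular ρ := by
  intro x hx
  obtain ⟨k, hk⟩ := hH ⟨x, hx⟩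
  exact mem_unitriangular_of_pow_eq_one (hle hx) (by simpa using congrArg Subtype.val hk)

theorem exists_sylow_unitriangular [Finite G] (hρ : Function.Injective ρ)
    (hN : Subgroup.normalizer (unitriangular ρ : Set G) ≤ triangular ρ) :
    ∃ S : Sylow p G, (S : Subgroup G) = unitriangular ρ :=
  (isPGroup_unitriangular hρ).exists_sylow_eq_of_normalizer_le hN
    fun _ hx _ hk => mem_unitriangular_of_pow_eq_one hx hk

theorem sylow_eq_of_le_triangular {S T : Sylow p G} (hS : (S : Subgroup G) = unitriangular ρ)
    (hT : (T : Subgroup G) ≤ triangular ρ) : T = S := by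
  refine Sylow.ext (T.is_maximal' S.isPGroup' ?_).symm
  rw [hS]
  exact le_unitriangular T.isPGroup' hT

end CharP

/-- The contragredient representation `x ↦ (ρ x⁻¹)ᵀ`. Upper triangular matrices for it are lower
triangular matrices for `ρ`. -/
def contra (ρ : G →* Matrix (Fin n) (Fin n) K) : G →* Matrix (Fin n) (Fin n) K where
  toFun x := (ρ x⁻¹)ᵀ
  map_one' := by simp
  map_mul' x y := by simp [Matrix.transpose_mul]

theorem contra_apply (x : G) : contra ρ x = (ρ x⁻¹)ᵀ := rfl

theorem contra_injective (hρ : Function.Injective ρ) : Function.Injective (contra ρ) := by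
  intro x y h
  exact inv_injective (hρ (Matrix.transpose_injective h))

theorem mul_apply_inv (x : G) : ρ x * ρ x⁻¹ = 1 := by simp [← map_mul]

theorem inv_mul_apply (x : G) : ρ x⁻¹ * ρ x = 1 := by simp [← map_mul]

/-- Being unitriangular for both `ρ` and its contragredient means being trivial. -/
theorem unitriangular_inf_contra (hρ : Function.Injective ρ) :
    unitriangular ρ ⊓ unitriangular (contra ρ) = ⊥ := by
  rw [eq_bot_iff]
  rintro x ⟨hx, hx'⟩
  rw [Subgroup.mem_bot]
  refine hρ ?_
  have h2 := (unitriangular (contra ρ)).inv_mem hx'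
  ext i j
  rw [map_one]
  rcases lt_trichotomy i j with h | rfl | h
  · have := mem_triangular.1 h2.1 j i h
    rw [contra_apply, inv_inv, Matrix.transpose_apply] at this
    rw [this, Matrix.one_apply_ne h.ne]
  · simp [hx.2]
  · rw [mem_triangular.1 hx.1 i j h, Matrix.one_apply_ne h.ne']

end MatrixRep

/-! ### Chambers and apartments of a rank-two group -/

section Apartment

variable (p : ℕ) {G : Type*} [Group G]

/-- `X` is a Sylow `p`-subgroup of the subgroup `H`, stated inside the ambient group. -/
def IsSylowIn (H X : Subgroup G) : Prop :=
  IsPGroup p X ∧ X ≤ H ∧ ∀ Y : Subgroup G, Y ≤ H → IsPGroup p Y → X ≤ Y → Y = X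

/-- `B` is an adapted Borel subgroup, and `X₁`, `X₂` are the unique Sylow `p`-subgroups of `G₁`
and `G₂` that it contains. -/
structure IsChamber (G₁ G₂ B X₁ X₂ : Subgroup G) : Prop where
  borel : IsBorel p B
  adapted : IsAdapted p G₁ G₂ B
  sylow_left : IsSylowIn p G₁ X₁
  sylow_right : IsSylowIn p G₂ X₂
  le_left : X₁ ≤ B
  le_right : X₂ ≤ B
  unique_left : ∀ Y : Subgroup G, Y ≤ G₁ → IsPGroup p Y → Y ≤ B → Y ≤ X₁
  unique_right : ∀ Y : Subgroup G, Y ≤ G₂ → IsPGroup p Y → Y ≤ B → Y ≤ X₂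
  ne_bot_left : X₁ ≠ ⊥
  ne_bot_right : X₂ ≠ ⊥
  /-- A normal subgroup containing the commutators of `X₁` with `G₂` meets `G₂` non-trivially. -/
  exists_left : ∀ N : Subgroup G, N.Normal → (∀ x ∈ X₁, ∀ g ∈ G₂, ⁅x, g⁆ ∈ N) →
    ∃ g ∈ G₂, g ∈ N ∧ g ≠ 1
  /-- A normal subgroup containing the commutators of `X₂` with `G₁` meets `G₁` non-trivially. -/
  exists_right : ∀ N : Subgroup G, N.Normal → (∀ x ∈ X₂, ∀ g ∈ G₁, ⁅x, g⁆ ∈ N) →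
    ∃ g ∈ G₁, g ∈ N ∧ g ≠ 1

/-- The facts about a standard pair `(G, G₁, G₂)` on which the comparison of root groups rests:
there are exactly two adapted Borel subgroups `B` and `B'`, they are opposite, root groups of
opposite sign and different nodes commute, and `G` is generated by `G₁` and `G₂`, as well as
normally generated by either of them. -/
structure IsApartment (G₁ G₂ B X₁ X₂ B' X₁' X₂' : Subgroup G) : Prop where
  pos : IsChamber p G₁ G₂ B X₁ X₂
  neg : IsChamber p G₁ G₂ B' X₁' X₂'
  opposite : AreOppositeBorels p B B'
  unique : ∀ C : Subgroup G, IsBorel p C → IsAdapted p G₁ G₂ C → C = B ∨ C = B'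
  inf_left : X₁ ⊓ X₁' = ⊥
  inf_right : X₂ ⊓ X₂' = ⊥
  commute : ∀ x ∈ X₁, ∀ y ∈ X₂', Commute x y
  commute' : ∀ x ∈ X₁', ∀ y ∈ X₂, Commute x y
  sup_eq_top : G₁ ⊔ G₂ = ⊤
  normal_left : ∀ N : Subgroup G, N.Normal → G₁ ≤ N → N = ⊤
  normal_right : ∀ N : Subgroup G, N.Normal → G₂ ≤ N → N = ⊤

/-- The properties that distinguish type `A₂`: a root group of `G₁` outside of the apartment
generates `G` together with `G₂`, and every non-trivial element of `G₁` normally generates `G`. -/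
structure IsRigidLeft (G₁ G₂ X₁ X₁' : Subgroup G) : Prop where
  sup_eq_top : ∀ Y : Subgroup G, IsSylowIn p G₁ Y → Y ≠ X₁ → Y ≠ X₁' → Y ⊔ G₂ = ⊤
  normal_eq_top : ∀ N : Subgroup G, N.Normal → ∀ g ∈ G₁, g ∈ N → g ≠ 1 → N = ⊤

variable {p} {G₁ G₂ B X₁ X₂ B' X₁' X₂' : Subgroup G}

theorem IsSylowIn.eq_of_le {H X Y : Subgroup G} (hY : IsSylowIn p H Y)
    (hX : IsSylowIn p H X) (h : Y ≤ X) : Y = X :=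
  (hY.2.2 X hX.2.1 hX.1 h).symm

theorem Sylow.isSylowIn_map {H : Type*} [Group H] {ι : H →* G} (hι : Function.Injective ι)
    (S : Sylow p H) : IsSylowIn p ι.range ((S : Subgroup H).map ι) := by
  refine ⟨S.isPGroup'.map ι, by rintro _ ⟨y, -, rfl⟩; exact ⟨y, rfl⟩, fun Y hY hp hle => ?_⟩
  have h1 := S.is_maximal' (hp.comap_of_injective ι hι) (Subgroup.map_le_iff_le_comap.1 hle)
  rw [← h1]
  ext x
  constructor
  · intro hx
    obtain ⟨y, rfl⟩ := hY hx
    exact ⟨y, hx, rfl⟩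
  · rintro ⟨y, hy, rfl⟩
    exact hy

theorem IsAdapted.swap {B : Subgroup G} (h : IsAdapted p G₁ G₂ B) : IsAdapted p G₂ G₁ B := by
  obtain ⟨P, Q, hP, hQ, h1, h2, rfl⟩ := h
  exact ⟨Q, P, hQ, hP, h2, h1, inf_comm _ _⟩

theorem IsChamber.swap (h : IsChamber p G₁ G₂ B X₁ X₂) : IsChamber p G₂ G₁ B X₂ X₁ :=
  ⟨h.borel, h.adapted.swap, h.sylow_right, h.sylow_left, h.le_right, h.le_left, h.unique_right,
    h.unique_left, h.ne_bot_right, h.ne_bot_left, h.exists_right, h.exists_left⟩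

theorem IsApartment.swap (h : IsApartment p G₁ G₂ B X₁ X₂ B' X₁' X₂') :
    IsApartment p G₂ G₁ B X₂ X₁ B' X₂' X₁' :=
  ⟨h.pos.swap, h.neg.swap, h.opposite, fun C hC hA => h.unique C hC hA.swap, h.inf_right,
    h.inf_left, fun x hx y hy => (h.commute' y hy x hx).symm,
    fun x hx y hy => (h.commute y hy x hx).symm, sup_comm G₁ G₂ ▸ h.sup_eq_top, h.normal_right,
    h.normal_left⟩

end Apartment

/-! ### The group `SL₂` -/

namespace MatrixRep

/-- `ρ` identifies `G` with the special linear group. -/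
structure IsSpecialLinear {G : Type*} [Group G] {K : Type*} [Field K] {n : ℕ}
    (ρ : G →* Matrix (Fin n) (Fin n) K) : Prop where
  injective : Function.Injective ρ
  det_eq_one : ∀ x, (ρ x).det = 1
  exists_eq : ∀ A : Matrix (Fin n) (Fin n) K, A.det = 1 → ∃ x, ρ x = A

theorem IsSpecialLinear.contra {G : Type*} [Group G] {K : Type*} [Field K] {n : ℕ}
    {ρ : G →* Matrix (Fin n) (Fin n) K} (h : IsSpecialLinear ρ) :
    IsSpecialLinear (MatrixRep.contra ρ) where
  injective := contra_injective h.injective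
  det_eq_one x := by rw [contra_apply, Matrix.det_transpose, h.det_eq_one]
  exists_eq A hA := by
    obtain ⟨x, hx⟩ := h.exists_eq Aᵀ (by rwa [Matrix.det_transpose])
    exact ⟨x⁻¹, by rw [contra_apply, inv_inv, hx, Matrix.transpose_transpose]⟩

theorem exists_lift {G H M : Type*} [Group G] [Group H] [Monoid M] {ρ : G →* M}
    (hρ : Function.Injective ρ) (β : H →* M) (h : ∀ y, ∃ x, ρ x = β y) :
    ∃ ι : H →* G, ∀ y, ρ (ι y) = β y := by
  choose f hf using h
  exact ⟨MonoidHom.mk' f fun a b => hρ (by rw [map_mul, hf, hf, hf, map_mul]), hf⟩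

end MatrixRep

namespace SL2

open MatrixRep Matrix.SpecialLinearGroup

variable {K : Type*} [Field K]

/-- The group `SL₂(K)`. -/
abbrev _root_.SL2 (K : Type*) [Field K] : Type _ := Matrix.SpecialLinearGroup (Fin 2) K

/-- The matrix with rows `(a, b)` and `(c, d)`. -/
def mk (a b c d : K) (h : a * d - b * c = 1) : SL2 K := ⟨!![a, b; c, d], by simpa using h⟩

@[simp] theorem coe_mk (a b c d : K) (h : a * d - b * c = 1) :
    (mk a b c d h).1 = !![a, b; c, d] := rfl

/-- The elements of the positive root group. -/
def upper (t : K) : SL2 K := ⟨!![1, t; 0, 1], by simp⟩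

/-- The elements of the negative root group. -/
def lower (t : K) : SL2 K := ⟨!![1, 0; t, 1], by simp⟩

/-- A representative of the non-trivial element of the Weyl group. -/
def weyl : SL2 K := ⟨!![0, -1; 1, 0], by simp⟩

@[simp] theorem coe_upper (t : K) : (upper t).1 = !![1, t; 0, 1] := rfl
@[simp] theorem coe_lower (t : K) : (lower t).1 = !![1, 0; t, 1] := rfl
@[simp] theorem coe_weyl : (weyl : SL2 K).1 = !![0, -1; 1, 0] := rfl

@[simp] theorem upper_inv (t : K) : (upper t)⁻¹ = upper (-t) := by
  rw [inv_eq_iff_mul_eq_one]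
  ext i j; fin_cases i <;> fin_cases j <;> simp

theorem coe_weyl_inv : (weyl⁻¹ : SL2 K).1 = !![0, 1; -1, 0] := by
  rw [Matrix.SpecialLinearGroup.coe_inv, coe_weyl, Matrix.adjugate_fin_two_of]
  simp

theorem upper_ne_one {t : K} (ht : t ≠ 0) : upper t ≠ 1 := fun h =>
  ht (by simpa using congrFun (congrFun (congrArg Subtype.val h) 0) 1)

theorem coe_conj_upper (h : SL2 K) (t : K) : (h * upper t * h⁻¹).1 =
    !![1 - h.1 0 0 * h.1 1 0 * t, h.1 0 0 ^ 2 * t;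
      -h.1 1 0 ^ 2 * t, 1 + h.1 0 0 * h.1 1 0 * t] := by
  have hd : h.1 0 0 * h.1 1 1 - h.1 0 1 * h.1 1 0 = 1 := by rw [← Matrix.det_fin_two, h.2]
  rw [Matrix.SpecialLinearGroup.coe_mul, Matrix.SpecialLinearGroup.coe_mul,
    Matrix.SpecialLinearGroup.coe_inv, Matrix.adjugate_fin_two]
  ext i j
  fin_cases i <;> fin_cases j <;> simp [Matrix.mul_apply, Fin.sum_univ_two] <;> grind

theorem det_eq (y : SL2 K) : y.1 0 0 * y.1 1 1 - y.1 0 1 * y.1 1 0 = 1 := by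
  rw [← Matrix.det_fin_two, y.2]

theorem eq_top_of_root_mem {P : Subgroup (SL2 K)} (h1 : ∀ t, upper t ∈ P)
    (h2 : ∀ t, lower t ∈ P) : P = ⊤ := by
  rw [eq_top_iff]
  intro y _
  refine Matrix.SL2.transvection_induction (fun y => y ∈ P) ?_ (fun _ _ => P.mul_mem) y
  intro i j hij c
  have h3 : i = 0 ∧ j = 1 ∨ i = 1 ∧ j = 0 := by
    fin_cases i <;> fin_cases j <;> simp_all
  rcases h3 with ⟨rfl, rfl⟩ | ⟨rfl, rfl⟩
  · have : transvection hij c = upper c := by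
      ext k l; fin_cases k <;> fin_cases l <;> simp [transvection_coe]
    exact this ▸ h1 c
  · have : transvection hij c = lower c := by
      ext k l; fin_cases k <;> fin_cases l <;> simp [transvection_coe]
    exact this ▸ h2 c

theorem range_le_of_root_mem {G : Type*} [Group G] {ι : SL2 K →* G} {P : Subgroup G}
    (h1 : ∀ t, ι (upper t) ∈ P) (h2 : ∀ t, ι (lower t) ∈ P) : ι.range ≤ P := by
  have h : P.comap ι = ⊤ := eq_top_of_root_mem h1 h2
  rintro _ ⟨y, rfl⟩
  have : y ∈ P.comap ι := h ▸ Subgroup.mem_top y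
  exact this

theorem range_le_of_upper_mem {G : Type*} [Group G] {ι : SL2 K →* G} {N : Subgroup G}
    (hN : N.Normal) (h : ∀ t, ι (upper t) ∈ N) : ι.range ≤ N := by
  refine range_le_of_root_mem h fun t => ?_
  have h1 := hN.conj_mem _ (h (-t)) (ι weyl)
  rw [← map_inv, ← map_mul, ← map_mul] at h1
  convert! h1
  ext i j
  rw [Matrix.SpecialLinearGroup.coe_mul, Matrix.SpecialLinearGroup.coe_mul, coe_weyl_inv]
  fin_cases i <;> fin_cases j <;> simp

theorem isSpecialLinear_coe : IsSpecialLinear (coeMonoidHom (ι := Fin 2) (R := K)) where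
  injective := coeMonoidHom_injective
  det_eq_one x := x.2
  exists_eq A hA := ⟨⟨A, hA⟩, rfl⟩

theorem normalizer_unitriangular_le {G : Type*} [Group G] {ρ : G →* Matrix (Fin 2) (Fin 2) K}
    (h : IsSpecialLinear ρ) :
    Subgroup.normalizer (unitriangular ρ : Set G) ≤ triangular ρ := by
  intro x hx
  obtain ⟨u, hu⟩ := h.exists_eq !![1, 1; 0, 1] (by simp)
  have huU : u ∈ unitriangular ρ := by
    refine ⟨mem_triangular.2 fun i j hij => ?_, fun i => ?_⟩
    · fin_cases i <;> fin_cases j <;> simp_all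
    · fin_cases i <;> simp [hu]
  have hv := (Subgroup.mem_normalizer_iff.1 hx u).1 huU
  have h1 : ρ (x * u * x⁻¹) * ρ x = ρ x * ρ u := by simp [← map_mul]
  have h2 := congrFun (congrFun h1 1) 1
  have h3 := mem_triangular.1 hv.1 1 0 (by decide)
  have h4 := hv.2 1
  rw [hu] at h2
  simp only [Matrix.mul_apply, Fin.sum_univ_two, h3, h4] at h2
  rw [mem_triangular]
  intro i j hij
  fin_cases i <;> fin_cases j <;> simp_all

/-- The automorphism `x ↦ (x⁻¹)ᵀ`. -/
def contra : SL2 K →* SL2 K where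
  toFun y := y⁻¹.transpose
  map_one' := Subtype.ext (by rw [coe_transpose, inv_one, coe_one, Matrix.transpose_one])
  map_mul' x y := Subtype.ext (by
    rw [coe_transpose, mul_inv_rev, coe_mul, coe_mul, Matrix.transpose_mul]; rfl)

theorem coe_inv_contra (y : SL2 K) : ((contra y)⁻¹).1 = y.1ᵀ := by
  rw [← map_inv]
  change ((y⁻¹)⁻¹.1)ᵀ = _
  rw [inv_inv]

theorem coe_contra (y : SL2 K) :
    (contra y).1 = !![y.1 1 1, -y.1 1 0; -y.1 0 1, y.1 0 0] := by
  change (y⁻¹.1)ᵀ = _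
  rw [Matrix.SpecialLinearGroup.coe_inv, Matrix.adjugate_fin_two]
  ext i j; fin_cases i <;> fin_cases j <;> rfl

@[simp] theorem contra_contra (y : SL2 K) : contra (contra y) = y := by
  ext i j
  rw [coe_contra, coe_contra]
  fin_cases i <;> fin_cases j <;> simp

@[simp] theorem contra_upper (t : K) : contra (upper t) = lower (-t) := by
  ext i j; rw [coe_contra]; fin_cases i <;> fin_cases j <;> simp

@[simp] theorem contra_lower (t : K) : contra (lower t) = upper (-t) := by
  ext i j; rw [coe_contra]; fin_cases i <;> fin_cases j <;> simp

/-- Conjugation by the diagonal matrix `diag(1, -1)`. -/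
def twist : SL2 K →* SL2 K where
  toFun y := ⟨!![y.1 0 0, -y.1 0 1; -y.1 1 0, y.1 1 1], by simpa using det_eq y⟩
  map_one' := Subtype.ext (by ext i j; fin_cases i <;> fin_cases j <;> simp)
  map_mul' x y := Subtype.ext (by
    change !![(x.1 * y.1) 0 0, -(x.1 * y.1) 0 1; -(x.1 * y.1) 1 0, (x.1 * y.1) 1 1] =
      !![x.1 0 0, -x.1 0 1; -x.1 1 0, x.1 1 1] * !![y.1 0 0, -y.1 0 1; -y.1 1 0, y.1 1 1]
    ext i j
    fin_cases i <;> fin_cases j <;> simp [Matrix.mul_apply, Fin.sum_univ_two] <;> ring)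

theorem coe_twist (y : SL2 K) :
    (twist y).1 = !![y.1 0 0, -y.1 0 1; -y.1 1 0, y.1 1 1] := rfl

@[simp] theorem twist_twist (y : SL2 K) : twist (twist y) = y := by
  ext i j
  rw [coe_twist, coe_twist]
  fin_cases i <;> fin_cases j <;> simp

@[simp] theorem twist_upper (t : K) : twist (upper t) = upper (-t) := by
  ext i j; rw [coe_twist]; fin_cases i <;> fin_cases j <;> simp

theorem contra_twist (y : SL2 K) : contra (twist y) = twist (contra y) := by
  ext i j
  rw [coe_contra, coe_twist, coe_twist, coe_contra]
  fin_cases i <;> fin_cases j <;> simp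

variable {G : Type*} [Group G]

theorem range_comp_twist (ι : SL2 K →* G) : (ι.comp twist).range = ι.range := by
  ext x
  constructor
  · rintro ⟨y, rfl⟩; exact ⟨twist y, rfl⟩
  · rintro ⟨y, rfl⟩; exact ⟨twist y, by simp⟩

theorem range_comp_contra (ι : SL2 K →* G) : (ι.comp contra).range = ι.range := by
  ext x
  constructor
  · rintro ⟨y, rfl⟩; exact ⟨contra y, rfl⟩
  · rintro ⟨y, rfl⟩; exact ⟨contra y, by simp⟩

/-- The image of the positive root group under a homomorphism. -/
def root (ι : SL2 K →* G) : Subgroup G :=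
  (unitriangular (coeMonoidHom (ι := Fin 2) (R := K))).map ι

theorem mem_unitriangular_iff {y : SL2 K} :
    y ∈ unitriangular (coeMonoidHom (ι := Fin 2) (R := K)) ↔ ∃ t, y = upper t := by
  constructor
  · intro h
    refine ⟨y.1 0 1, ?_⟩
    have h1 := mem_triangular.1 h.1 1 0 (by decide)
    have h2 := h.2 0
    have h3 := h.2 1
    ext i j; fin_cases i <;> fin_cases j <;> simp_all
  · rintro ⟨t, rfl⟩
    refine ⟨mem_triangular.2 fun i j hij => ?_, fun i => ?_⟩
    · fin_cases i <;> fin_cases j <;> simp_all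
    · fin_cases i <;> simp

theorem mem_root {ι : SL2 K →* G} {x : G} : x ∈ root ι ↔ ∃ t, ι (upper t) = x := by
  constructor
  · rintro ⟨y, hy, rfl⟩
    obtain ⟨t, rfl⟩ := mem_unitriangular_iff.1 hy
    exact ⟨t, rfl⟩
  · rintro ⟨t, rfl⟩
    exact ⟨_, mem_unitriangular_iff.2 ⟨t, rfl⟩, rfl⟩

theorem root_comp_twist (ι : SL2 K →* G) : root (ι.comp twist) = root ι := by
  ext x
  rw [mem_root, mem_root]
  constructor
  · rintro ⟨t, rfl⟩; exact ⟨-t, by simp⟩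
  · rintro ⟨t, rfl⟩; exact ⟨-t, by simp⟩

theorem mem_root_contra {ι : SL2 K →* G} {x : G} :
    x ∈ root (ι.comp contra) ↔ ∃ t, ι (lower t) = x := by
  rw [mem_root]
  constructor
  · rintro ⟨t, rfl⟩; exact ⟨-t, by simp⟩
  · rintro ⟨t, rfl⟩; exact ⟨-t, by simp⟩

theorem root_ne_bot {ι : SL2 K →* G} (hι : Function.Injective ι) : root ι ≠ ⊥ := by
  intro h
  have h1 : ι (upper 1) ∈ root ι := mem_root.2 ⟨1, rfl⟩
  rw [h, Subgroup.mem_bot, ← map_one ι] at h1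
  have := congrFun (congrFun (congrArg Subtype.val (hι h1)) 0) 1
  simp at this

theorem root_inf_root_contra {ι : SL2 K →* G} (hι : Function.Injective ι) :
    root ι ⊓ root (ι.comp contra) = ⊥ := by
  rw [eq_bot_iff]
  rintro x ⟨h1, h2⟩
  obtain ⟨t, rfl⟩ := mem_root.1 h1
  obtain ⟨s, hs⟩ := mem_root_contra.1 h2
  have := congrFun (congrFun (congrArg Subtype.val (hι hs)) 0) 1
  simp only [coe_lower, coe_upper] at this
  have ht : t = 0 := by simpa using this.symm
  rw [Subgroup.mem_bot, ht, ← map_one ι]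
  congr 1
  ext i j; fin_cases i <;> fin_cases j <;> simp

section Sylow

variable {p : ℕ}

theorem exists_sylow [Fact p.Prime] (K : Type*) [Field K] [CharP K p] [Finite K] :
    ∃ S : Sylow p (SL2 K), (S : Subgroup (SL2 K)) =
      unitriangular (coeMonoidHom (ι := Fin 2) (R := K)) :=
  exists_sylow_unitriangular isSpecialLinear_coe.injective
    (normalizer_unitriangular_le isSpecialLinear_coe)

variable [Fact p.Prime] [CharP K p] [Finite K]

theorem isSylowIn_root {ι : SL2 K →* G} (hι : Function.Injective ι) :
    IsSylowIn p ι.range (root ι) := by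
  obtain ⟨S, hS⟩ := exists_sylow (p := p) K
  have := S.isSylowIn_map hι
  rwa [hS] at this

/-- All Sylow `p`-subgroups of a copy of `SL₂` are conjugates of the root group. -/
theorem exists_conj_of_isSylowIn {ι : SL2 K →* G} (hι : Function.Injective ι) {Y : Subgroup G}
    (hY : IsSylowIn p ι.range Y) :
    ∃ h : SL2 K, ∀ x, x ∈ Y ↔ ∃ t, x = ι (h * upper t * h⁻¹) := by
  obtain ⟨S, hS⟩ := exists_sylow (p := p) K
  obtain ⟨T, hT⟩ := (hY.1.comap_of_injective ι hι).exists_le_sylow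
  obtain ⟨h, rfl⟩ := MulAction.exists_smul_eq (SL2 K) S T
  refine ⟨h, fun x => ?_⟩
  have h1 : ((h • S : Sylow p (SL2 K)) : Subgroup (SL2 K)).map ι = Y := by
    refine hY.2.2 _ (Sylow.isSylowIn_map hι _).2.1 (Sylow.isSylowIn_map hι _).1 ?_
    intro y hy
    obtain ⟨z, rfl⟩ := hY.2.1 hy
    exact ⟨z, hT hy, rfl⟩
  rw [← h1, Sylow.coe_subgroup_smul]
  constructor
  · rintro ⟨y, ⟨z, hz, rfl⟩, rfl⟩
    rw [SetLike.mem_coe, hS, mem_unitriangular_iff] at hz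
    obtain ⟨t, rfl⟩ := hz
    exact ⟨t, rfl⟩
  · rintro ⟨t, rfl⟩
    refine ⟨_, ⟨upper t, ?_, rfl⟩, rfl⟩
    rw [SetLike.mem_coe, hS]
    exact mem_unitriangular_iff.2 ⟨t, rfl⟩

end Sylow

end SL2

/-! ### The standard pair of type `A₂` -/

namespace MatrixRep

/-- `ρ` identifies `G` with `SL₃(K)` in such a way that `ι₁` and `ι₂` become the embeddings
of `SL₂(K)` as diagonal blocks. -/
structure IsA2 {G : Type*} [Group G] {K : Type*} [Field K]
    (ρ : G →* Matrix (Fin 3) (Fin 3) K) (ι₁ ι₂ : SL2 K →* G) : Prop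
    extends IsSpecialLinear ρ where
  left : ∀ y, ρ (ι₁ y) = !![y.1 0 0, y.1 0 1, 0; y.1 1 0, y.1 1 1, 0; 0, 0, 1]
  right : ∀ y, ρ (ι₂ y) = !![1, 0, 0; 0, y.1 0 0, y.1 0 1; 0, y.1 1 0, y.1 1 1]

section Flip

variable {G : Type*} [Group G] {K : Type*} [Field K] {n : ℕ}

/-- The contragredient representation with the order of the basis reversed. It has the same
upper triangular matrices, and it interchanges the two nodes of the diagram `A₂`. -/
def flip (ρ : G →* Matrix (Fin n) (Fin n) K) : G →* Matrix (Fin n) (Fin n) K where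
  toFun x := ((ρ x⁻¹)ᵀ).submatrix Fin.rev Fin.rev
  map_one' := by
    rw [inv_one, map_one, Matrix.transpose_one]
    exact Matrix.submatrix_one _ Fin.rev_injective
  map_mul' x y := by
    rw [mul_inv_rev, map_mul, Matrix.transpose_mul]
    exact (Matrix.submatrix_mul_equiv _ _ Fin.rev Fin.revPerm Fin.rev).symm

variable {ρ : G →* Matrix (Fin n) (Fin n) K}

theorem flip_apply (x : G) (i j : Fin n) : flip ρ x i j = ρ x⁻¹ j.rev i.rev := rfl

theorem triangular_flip : triangular (flip ρ) = triangular ρ := by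
  ext x
  rw [← (triangular ρ).inv_mem_iff, mem_triangular, mem_triangular]
  constructor
  · intro h i j hij
    have := h j.rev i.rev (by simpa using hij)
    simpa [flip_apply] using this
  · intro h i j hij
    exact h _ _ (by simpa using hij)

end Flip

namespace IsA2

variable {G : Type*} [Group G] {K : Type*} [Field K]
  {ρ : G →* Matrix (Fin 3) (Fin 3) K} {ι₁ ι₂ : SL2 K →* G} (h : IsA2 ρ ι₁ ι₂)

include h

theorem contra : IsA2 (MatrixRep.contra ρ) (ι₁.comp SL2.contra) (ι₂.comp SL2.contra) where
  toIsSpecialLinear := h.toIsSpecialLinear.contra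
  left y := by
    rw [contra_apply, MonoidHom.comp_apply, ← map_inv, h.left, SL2.coe_inv_contra]
    ext i j; fin_cases i <;> fin_cases j <;> simp
  right y := by
    rw [contra_apply, MonoidHom.comp_apply, ← map_inv, h.right, SL2.coe_inv_contra]
    ext i j; fin_cases i <;> fin_cases j <;> simp

theorem flip : IsA2 (MatrixRep.flip ρ) (ι₂.comp SL2.twist) (ι₁.comp SL2.twist) where
  injective x y hxy := by
    refine inv_injective (h.injective ?_)
    ext i j
    have := congrFun (congrFun hxy j.rev) i.rev
    simpa [flip_apply] using this
  det_eq_one x := by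
    change Matrix.det (((ρ x⁻¹)ᵀ).submatrix Fin.revPerm Fin.revPerm) = 1
    rw [Matrix.det_submatrix_equiv_self, Matrix.det_transpose, h.det_eq_one]
  exists_eq A hA := by
    obtain ⟨x, hx⟩ := h.exists_eq ((A.submatrix Fin.revPerm Fin.revPerm)ᵀ) (by
      rw [Matrix.det_transpose, Matrix.det_submatrix_equiv_self, hA])
    refine ⟨x⁻¹, ?_⟩
    ext i j
    rw [flip_apply, inv_inv, hx]
    simp
  left y := by
    ext i j
    rw [flip_apply, MonoidHom.comp_apply, ← map_inv, h.right, ← SL2.contra_contra (SL2.twist y),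
      SL2.coe_inv_contra, SL2.coe_contra, SL2.coe_twist]
    fin_cases i <;> fin_cases j <;> simp
  right y := by
    ext i j
    rw [flip_apply, MonoidHom.comp_apply, ← map_inv, h.left, ← SL2.contra_contra (SL2.twist y),
      SL2.coe_inv_contra, SL2.coe_contra, SL2.coe_twist]
    fin_cases i <;> fin_cases j <;> simp

theorem injective_left : Function.Injective ι₁ := by
  intro x y hxy
  have h1 : ρ (ι₁ x) = ρ (ι₁ y) := by rw [hxy]
  rw [h.left, h.left] at h1
  ext i j
  have h2 := congrFun (congrFun h1 (Fin.castSucc i)) (Fin.castSucc j)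
  fin_cases i <;> fin_cases j <;> simpa using h2

theorem injective_right : Function.Injective ι₂ := by
  intro x y hxy
  have h1 : ρ (ι₂ x) = ρ (ι₂ y) := by rw [hxy]
  rw [h.right, h.right] at h1
  ext i j
  have h2 := congrFun (congrFun h1 (Fin.succ i)) (Fin.succ j)
  fin_cases i <;> fin_cases j <;> simpa using h2

theorem sup_eq_top : ι₁.range ⊔ ι₂.range = ⊤ := by
  set H := ι₁.range ⊔ ι₂.range
  have h1 : ∀ y, ι₁ y ∈ H := fun y => Subgroup.mem_sup_left ⟨y, rfl⟩
  have h2 : ∀ y, ι₂ y ∈ H := fun y => Subgroup.mem_sup_right ⟨y, rfl⟩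
  let Q : Matrix (Fin 3) (Fin 3) K → Prop := fun A => ∃ x ∈ H, ρ x = A
  have hmul : ∀ A B, Q A → Q B → Q (A * B) := by
    rintro _ _ ⟨x, hx, rfl⟩ ⟨y, hy, rfl⟩
    exact ⟨x * y, H.mul_mem hx hy, map_mul _ _ _⟩
  have q01 : ∀ t, Q !![1, t, 0; 0, 1, 0; 0, 0, 1] := fun t =>
    ⟨_, h1 (SL2.upper t), by simp [h.left]⟩
  have q10 : ∀ t, Q !![1, 0, 0; t, 1, 0; 0, 0, 1] := fun t =>
    ⟨_, h1 (SL2.lower t), by simp [h.left]⟩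
  have q12 : ∀ t, Q !![1, 0, 0; 0, 1, t; 0, 0, 1] := fun t =>
    ⟨_, h2 (SL2.upper t), by simp [h.right]⟩
  have q21 : ∀ t, Q !![1, 0, 0; 0, 1, 0; 0, t, 1] := fun t =>
    ⟨_, h2 (SL2.lower t), by simp [h.right]⟩
  have q02 : ∀ t, Q !![1, 0, t; 0, 1, 0; 0, 0, 1] := by
    intro t
    have := hmul _ _ (hmul _ _ (hmul _ _ (q01 t) (q12 1)) (q01 (-t))) (q12 (-1))
    convert! this using 1
    ext i j
    fin_cases i <;> fin_cases j <;> simp [Matrix.mul_apply, Fin.sum_univ_three]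
  have q20 : ∀ t, Q !![1, 0, 0; 0, 1, 0; t, 0, 1] := by
    intro t
    have := hmul _ _ (hmul _ _ (hmul _ _ (q21 t) (q10 1)) (q21 (-t))) (q10 (-1))
    convert! this using 1
    ext i j
    fin_cases i <;> fin_cases j <;> simp [Matrix.mul_apply, Fin.sum_univ_three]
  have d01 : ∀ a b : K, a * b = 1 → Q !![a, 0, 0; 0, b, 0; 0, 0, 1] := fun a b hab =>
    ⟨_, h1 (SL2.mk a 0 0 b (by simpa using hab)), by simp [h.left]⟩
  have d12 : ∀ a b : K, a * b = 1 → Q !![1, 0, 0; 0, a, 0; 0, 0, b] := fun a b hab =>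
    ⟨_, h2 (SL2.mk a 0 0 b (by simpa using hab)), by simp [h.right]⟩
  have d02 : ∀ a b : K, a * b = 1 → Q !![a, 0, 0; 0, 1, 0; 0, 0, b] := by
    intro a b hab
    convert! hmul _ _ (d01 a b hab) (d12 a b hab) using 1
    ext i j
    fin_cases i <;> fin_cases j <;>
      simp [Matrix.mul_apply, Fin.sum_univ_three, mul_comm b a, hab]
  rw [eq_top_iff]
  intro x _
  obtain ⟨y, hy, hyx⟩ : Q (ρ x) := by
    refine Matrix.SpecialLinearGroup.diagonal_transvection_induction'
      (fun M : Matrix.SpecialLinearGroup (Fin 3) K => Q M.1) ⟨ρ x, h.det_eq_one x⟩ ?_ ?_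
      fun A B hA hB => hmul _ _ hA hB
    · intro i j hij c hc
      have hc1 := mul_inv_cancel₀ hc
      have hc2 := inv_mul_cancel₀ hc
      have key : ∀ A, Q A → A = (Matrix.SpecialLinearGroup.diag2n hij c hc).1 →
          Q (Matrix.SpecialLinearGroup.diag2n hij c hc).1 := fun A hA hAB => hAB ▸ hA
      fin_cases i <;> fin_cases j <;> try exact absurd rfl hij
      · refine key _ (d01 _ _ hc1) ?_
        ext k l
        fin_cases k <;> fin_cases l <;> simp [Matrix.SpecialLinearGroup.diag2n_coe]
      · refine key _ (d02 _ _ hc1) ?_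
        ext k l
        fin_cases k <;> fin_cases l <;> simp [Matrix.SpecialLinearGroup.diag2n_coe]
      · refine key _ (d01 _ _ hc2) ?_
        ext k l
        fin_cases k <;> fin_cases l <;> simp [Matrix.SpecialLinearGroup.diag2n_coe]
      · refine key _ (d12 _ _ hc1) ?_
        ext k l
        fin_cases k <;> fin_cases l <;> simp [Matrix.SpecialLinearGroup.diag2n_coe]
      · refine key _ (d02 _ _ hc2) ?_
        ext k l
        fin_cases k <;> fin_cases l <;> simp [Matrix.SpecialLinearGroup.diag2n_coe]
      · refine key _ (d12 _ _ hc2) ?_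
        ext k l
        fin_cases k <;> fin_cases l <;> simp [Matrix.SpecialLinearGroup.diag2n_coe]
    · intro i j hij c
      have key : ∀ A, Q A → A = (Matrix.SpecialLinearGroup.transvection hij c).1 →
          Q (Matrix.SpecialLinearGroup.transvection hij c).1 := fun A hA hAB => hAB ▸ hA
      fin_cases i <;> fin_cases j <;> try exact absurd rfl hij
      · refine key _ (q01 c) ?_
        ext k l
        fin_cases k <;> fin_cases l <;> simp [Matrix.SpecialLinearGroup.transvection_coe]
      · refine key _ (q02 c) ?_
        ext k l
        fin_cases k <;> fin_cases l <;> simp [Matrix.SpecialLinearGroup.transvection_coe]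
      · refine key _ (q10 c) ?_
        ext k l
        fin_cases k <;> fin_cases l <;> simp [Matrix.SpecialLinearGroup.transvection_coe]
      · refine key _ (q12 c) ?_
        ext k l
        fin_cases k <;> fin_cases l <;> simp [Matrix.SpecialLinearGroup.transvection_coe]
      · refine key _ (q20 c) ?_
        ext k l
        fin_cases k <;> fin_cases l <;> simp [Matrix.SpecialLinearGroup.transvection_coe]
      · refine key _ (q21 c) ?_
        ext k l
        fin_cases k <;> fin_cases l <;> simp [Matrix.SpecialLinearGroup.transvection_coe]
  exact h.injective hyx ▸ hy

end IsA2

section Transvection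

variable {G : Type*} [Group G] {K : Type*} [Field K] {n : ℕ}
  {ρ : G →* Matrix (Fin n) (Fin n) K}

/-- `v` is a center of `P` if `P` contains all transvections `1 + v φ` with center `v`. -/
def IsCenter (ρ : G →* Matrix (Fin n) (Fin n) K) (P : Subgroup G) (v : Fin n → K) : Prop :=
  ∀ φ : Fin n → K, φ ⬝ᵥ v = 0 → ∀ x, ρ x = 1 + Matrix.vecMulVec v φ → x ∈ P

theorem IsSpecialLinear.exists_transvection (h : IsSpecialLinear ρ) {v φ : Fin n → K}
    (hφ : φ ⬝ᵥ v = 0) : ∃ x, ρ x = 1 + Matrix.vecMulVec v φ := by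
  refine h.exists_eq _ ?_
  rw [Matrix.vecMulVec_eq Unit, Matrix.det_one_add_replicateCol_mul_replicateRow, hφ, add_zero]

theorem mulVec_apply_three (A : Matrix (Fin 3) (Fin 3) K) (v : Fin 3 → K) (i : Fin 3) :
    (A *ᵥ v) i = A i 0 * v 0 + A i 1 * v 1 + A i 2 * v 2 := by
  rw [Matrix.mulVec, dotProduct, Fin.sum_univ_three]

theorem IsCenter.smul {P : Subgroup G} {v : Fin n → K} (hv : IsCenter ρ P v) (c : K) :
    IsCenter ρ P (c • v) := by
  intro φ hφ x hx
  refine hv (c • φ) ?_ x ?_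
  · rwa [smul_dotProduct, ← dotProduct_smul]
  · rw [hx, Matrix.smul_vecMulVec, Matrix.vecMulVec_smul]

/-- The image of a center under an element that normalizes `P` is a center. -/
theorem IsCenter.mulVec {P : Subgroup G} {v : Fin n → K} (hv : IsCenter ρ P v) {x : G}
    (hx : ∀ z ∈ P, x * z * x⁻¹ ∈ P) : IsCenter ρ P (ρ x *ᵥ v) := by
  intro φ hφ z hz
  have h1 := hx _ (hv (φ ᵥ* ρ x) (by rwa [← Matrix.dotProduct_mulVec]) (x⁻¹ * z * x) ?_)
  · simpa [mul_assoc] using h1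
  · rw [map_mul, map_mul, hz, mul_add, add_mul, mul_one, inv_mul_apply, Matrix.mul_vecMulVec,
      Matrix.mulVec_mulVec, inv_mul_apply, Matrix.one_mulVec, Matrix.vecMulVec_mul]

theorem IsCenter.mulVec_of_mem {P : Subgroup G} {v : Fin n → K} (hv : IsCenter ρ P v) {x : G}
    (hx : x ∈ P) : IsCenter ρ P (ρ x *ᵥ v) :=
  hv.mulVec fun _ hz => P.mul_mem (P.mul_mem hx hz) (P.inv_mem hx)

theorem exists_dotProduct_eq {u v : Fin n → K} (huv : ¬∃ c : K, v = c • u) :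
    ∃ φ : Fin n → K, φ ⬝ᵥ u = 0 ∧ φ ⬝ᵥ v = 1 := by
  have hv : v ∉ Submodule.span K {u} := by
    rw [Submodule.mem_span_singleton]
    rintro ⟨c, rfl⟩
    exact huv ⟨c, rfl⟩
  obtain ⟨f, hf, hle⟩ := Submodule.exists_le_ker_of_notMem hv
  have key : ∀ w, (fun i => f (Pi.single i 1)) ⬝ᵥ w = f w := by
    intro w
    conv_rhs => rw [← Finset.univ_sum_single w, map_sum]
    refine Finset.sum_congr rfl fun i _ => ?_
    have : (Pi.single i (w i) : Fin n → K) = w i • Pi.single i 1 := by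
      rw [← Pi.single_smul, smul_eq_mul, mul_one]
    change f (Pi.single i 1) * w i = f (Pi.single i (w i))
    rw [this, map_smul, smul_eq_mul, mul_comm]
  refine ⟨(f v)⁻¹ • fun i => f (Pi.single i 1), ?_, ?_⟩
  · rw [smul_dotProduct, key, LinearMap.mem_ker.1 (hle (Submodule.mem_span_singleton_self u)),
      smul_zero]
  · rw [smul_dotProduct, key, smul_eq_mul, inv_mul_cancel₀ hf]

/-- The centers of `P` form a subspace: if `u` and `v` are linearly independent centers, then some
transvection with center `u` maps `v` to `u + v`. -/
def centers (h : IsSpecialLinear ρ) (P : Subgroup G) : Submodule K (Fin n → K) where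
  carrier := {v | IsCenter ρ P v}
  zero_mem' := by
    intro φ _ x hx
    have : x = 1 := h.injective (by rw [hx, Matrix.zero_vecMulVec, add_zero, map_one])
    exact this ▸ P.one_mem
  smul_mem' c v hv := hv.smul c
  add_mem' := by
    intro u v hu hv
    by_cases huv : ∃ c : K, v = c • u
    · obtain ⟨c, rfl⟩ := huv
      have : u + c • u = (1 + c) • u := by rw [add_smul, one_smul]
      exact this ▸ IsCenter.smul hu _
    · obtain ⟨φ, h1, h2⟩ := exists_dotProduct_eq huv
      obtain ⟨x, hx⟩ := h.exists_transvection h1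
      have h3 := hv.mulVec_of_mem (hu φ h1 x hx)
      rwa [hx, Matrix.add_mulVec, Matrix.one_mulVec, Matrix.vecMulVec_mulVec, h2,
        MulOpposite.op_one, one_smul, add_comm] at h3

end Transvection

namespace IsA2

variable {G : Type*} [Group G] {K : Type*} [Field K]
  {ρ : G →* Matrix (Fin 3) (Fin 3) K} {ι₁ ι₂ : SL2 K →* G} (h : IsA2 ρ ι₁ ι₂)

include h

theorem rho_upper_left (t : K) : ρ (ι₁ (SL2.upper t)) = !![1, t, 0; 0, 1, 0; 0, 0, 1] := by
  simp [h.left]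

theorem rho_lower_left (t : K) : ρ (ι₁ (SL2.lower t)) = !![1, 0, 0; t, 1, 0; 0, 0, 1] := by
  simp [h.left]

theorem rho_upper_right (t : K) : ρ (ι₂ (SL2.upper t)) = !![1, 0, 0; 0, 1, t; 0, 0, 1] := by
  simp [h.right]

theorem rho_lower_right (t : K) : ρ (ι₂ (SL2.lower t)) = !![1, 0, 0; 0, 1, 0; 0, t, 1] := by
  simp [h.right]

theorem upper_left_mem (t : K) : ι₁ (SL2.upper t) ∈ unitriangular ρ := by
  refine ⟨mem_triangular.2 fun i j hij => ?_, fun i => ?_⟩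
  · rw [h.rho_upper_left]; fin_cases i <;> fin_cases j <;> simp_all
  · rw [h.rho_upper_left]; fin_cases i <;> simp

theorem upper_right_mem (t : K) : ι₂ (SL2.upper t) ∈ unitriangular ρ := by
  refine ⟨mem_triangular.2 fun i j hij => ?_, fun i => ?_⟩
  · rw [h.rho_upper_right]; fin_cases i <;> fin_cases j <;> simp_all
  · rw [h.rho_upper_right]; fin_cases i <;> simp

theorem eq_top_of_range_le {P : Subgroup G} (h1 : ι₁.range ≤ P) (h2 : ι₂.range ≤ P) : P = ⊤ :=
  top_le_iff.1 (h.sup_eq_top ▸ sup_le h1 h2)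

/-- A subgroup that contains all transvections with centers in a basis is the whole group. -/
theorem eq_top_of_isCenter {P : Subgroup G} (h0 : IsCenter ρ P ![1, 0, 0])
    (h1 : IsCenter ρ P ![0, 1, 0]) (h2 : IsCenter ρ P ![0, 0, 1]) : P = ⊤ := by
  refine h.eq_top_of_range_le (SL2.range_le_of_root_mem (fun t => ?_) fun t => ?_)
    (SL2.range_le_of_root_mem (fun t => ?_) fun t => ?_)
  · refine h0 ![0, t, 0] (by simp) _ ?_
    rw [h.rho_upper_left]
    ext i j; fin_cases i <;> fin_cases j <;> simp
  · refine h1 ![t, 0, 0] (by simp) _ ?_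
    rw [h.rho_lower_left]
    ext i j; fin_cases i <;> fin_cases j <;> simp
  · refine h1 ![0, 0, t] (by simp) _ ?_
    rw [h.rho_upper_right]
    ext i j; fin_cases i <;> fin_cases j <;> simp
  · refine h2 ![0, t, 0] (by simp) _ ?_
    rw [h.rho_lower_right]
    ext i j; fin_cases i <;> fin_cases j <;> simp

/-- A proper subgroup that contains the unitriangular matrices stabilizes the point or the line
of the standard flag. -/
theorem stabilizes_of_unitriangular_le {P : Subgroup G} (hP : unitriangular ρ ≤ P)
    (hne : P ≠ ⊤) :
    (∀ x ∈ P, ρ x 1 0 = 0 ∧ ρ x 2 0 = 0) ∨ ∀ x ∈ P, ρ x 2 0 = 0 ∧ ρ x 2 1 = 0 := by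
  by_contra! hcon
  obtain ⟨⟨x, hx, hx0⟩, ⟨y, hy, hy0⟩⟩ := hcon
  refine hne ?_
  let M := centers h.toIsSpecialLinear P
  have inv : ∀ z ∈ P, ∀ v ∈ M, ρ z *ᵥ v ∈ M := fun z hz v hv => IsCenter.mulVec_of_mem hv hz
  have m0 : ![1, 0, 0] ∈ M := by
    intro φ hφ z hz
    have hφ0 : φ 0 = 0 := by simpa [dotProduct, Fin.sum_univ_three] using hφ
    refine hP ⟨mem_triangular.2 fun i j hij => ?_, fun i => ?_⟩
    · rw [hz, Matrix.add_apply, Matrix.vecMulVec_apply]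
      fin_cases i <;> fin_cases j <;> simp_all
    · rw [hz, Matrix.add_apply, Matrix.vecMulVec_apply]
      fin_cases i <;> simp [hφ0]
  have key : ∀ v ∈ M, ∀ w ∈ M, ∀ c d : K, c ≠ 0 → ∀ u, v - d • w = c • u → u ∈ M := by
    intro v hv w hw c d hc u hu
    have := M.smul_mem c⁻¹ (M.sub_mem hv (M.smul_mem d hw))
    rwa [hu, smul_smul, inv_mul_cancel₀ hc, one_smul] at this
  have m1 : ![0, 1, 0] ∈ M := by
    have hv := inv x hx _ m0
    by_cases h2 : ρ x 2 0 = 0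
    · refine key _ hv _ m0 (ρ x 1 0) (ρ x 0 0) (fun h1 => hx0 h1 h2) _ ?_
      ext i; fin_cases i <;> simp [Matrix.mulVec, dotProduct, Fin.sum_univ_three, h2]
    · refine key _ (inv _ (hP (h.upper_right_mem 1)) _ hv) _ hv (ρ x 2 0) 1 h2 _ ?_
      rw [h.rho_upper_right]
      ext i
      simp only [Pi.sub_apply, Pi.smul_apply, mulVec_apply_three]
      fin_cases i <;> simp
  have m2 : ![0, 0, 1] ∈ M := by
    have key2 : ∀ v ∈ M, v 2 ≠ 0 → ![0, 0, 1] ∈ M := by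
      intro v hv hv2
      refine key _ (M.sub_mem hv (M.smul_mem (v 0) m0)) _ m1 (v 2) (v 1) hv2 _ ?_
      ext i; fin_cases i <;> simp [Matrix.vecHead, Matrix.vecTail]
    by_cases h2 : ρ y 2 0 = 0
    · refine key2 _ (inv y hy _ m1) ?_
      simpa [Matrix.mulVec, dotProduct, Fin.sum_univ_three] using hy0 h2
    · refine key2 _ (inv y hy _ m0) ?_
      simpa [Matrix.mulVec, dotProduct, Fin.sum_univ_three] using h2
  exact h.eq_top_of_isCenter m0 m1 m2

theorem normalizer_unitriangular_le :
    Subgroup.normalizer (unitriangular ρ : Set G) ≤ triangular ρ := by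
  intro x hx
  have hx1 : ∀ u ∈ unitriangular ρ, ∃ v ∈ unitriangular ρ, ρ v * ρ x = ρ x * ρ u :=
    fun u hu => ⟨x * u * x⁻¹, (Subgroup.mem_normalizer_iff.1 hx u).1 hu, by simp [← map_mul]⟩
  have hx2 : ∀ u ∈ unitriangular ρ, ∃ v ∈ unitriangular ρ, ρ u * ρ x = ρ x * ρ v :=
    fun u hu => ⟨x⁻¹ * u * x, (Subgroup.mem_normalizer_iff''.1 hx u).1 hu, by
      simp [← map_mul, mul_assoc]⟩
  have col : ∀ u ∈ unitriangular ρ, ∀ i, (ρ u * ρ x) i 0 = ρ x i 0 := by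
    intro u hu i
    obtain ⟨v, hv, e⟩ := hx2 u hu
    have h1 := mem_triangular.1 hv.1 1 0 (by decide)
    have h2 := mem_triangular.1 hv.1 2 0 (by decide)
    rw [e, Matrix.mul_apply, Fin.sum_univ_three, hv.2, h1, h2]
    simp
  have row : ∀ u ∈ unitriangular ρ, ∀ j, (ρ x * ρ u) 2 j = ρ x 2 j := by
    intro u hu j
    obtain ⟨v, hv, e⟩ := hx1 u hu
    have h1 := mem_triangular.1 hv.1 2 0 (by decide)
    have h2 := mem_triangular.1 hv.1 2 1 (by decide)
    rw [← e, Matrix.mul_apply, Fin.sum_univ_three, hv.2, h1, h2]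
    simp
  have h10 := col _ (h.upper_left_mem 1) 0
  have h20 := col _ (h.upper_right_mem 1) 1
  have h21 := row _ (h.upper_right_mem 1) 2
  rw [h.rho_upper_left] at h10
  rw [h.rho_upper_right] at h20 h21
  simp only [Matrix.mul_apply, Fin.sum_univ_three] at h10 h20 h21
  rw [mem_triangular]
  intro i j hij
  fin_cases i <;> fin_cases j <;> simp_all

end IsA2

theorem mem_triangular_three {G K : Type*} [Group G] [Field K]
    {ρ : G →* Matrix (Fin 3) (Fin 3) K} {x : G} :
    x ∈ triangular ρ ↔ ρ x 1 0 = 0 ∧ ρ x 2 0 = 0 ∧ ρ x 2 1 = 0 := by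
  rw [mem_triangular]
  refine ⟨fun h => ⟨h 1 0 (by decide), h 2 0 (by decide), h 2 1 (by decide)⟩, ?_⟩
  rintro ⟨h1, h2, h3⟩ i j hij
  fin_cases i <;> fin_cases j <;> first | exact absurd hij (by decide) | assumption

namespace IsA2

section Basic

variable {G : Type*} [Group G] {K : Type*} [Field K]
  {ρ : G →* Matrix (Fin 3) (Fin 3) K} {ι₁ ι₂ : SL2 K →* G} (h : IsA2 ρ ι₁ ι₂)

include h

theorem commute_upper_lower (s t : K) : Commute (ι₁ (SL2.upper s)) (ι₂ (SL2.lower t)) := by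
  refine h.injective ?_
  rw [map_mul, map_mul, h.rho_upper_left, h.rho_lower_right]
  ext i j
  fin_cases i <;> fin_cases j <;> simp [Matrix.mul_apply, Fin.sum_univ_three]

/-- The commutator of the two positive simple root groups is the highest root group, which is
conjugate to a simple one. -/
theorem exists_of_commutator_mem {N : Subgroup G} (hN : N.Normal)
    (hmem : ∀ x ∈ SL2.root ι₁, ∀ g ∈ ι₂.range, ⁅x, g⁆ ∈ N) : ∃ g ∈ ι₂.range, g ∈ N ∧ g ≠ 1 := by
  have h1 := hmem _ (SL2.mem_root.2 ⟨1, rfl⟩) (ι₂ (SL2.upper 1)) ⟨_, rfl⟩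
  have h2 := hN.conj_mem _ h1 (ι₁ SL2.weyl)
  refine ⟨ι₂ (SL2.upper 1), ⟨_, rfl⟩, ?_, ?_⟩
  · convert! h2
    refine h.injective ?_
    rw [commutatorElement_def, ← map_inv, ← map_inv, ← map_inv, SL2.upper_inv]
    simp only [map_mul, h.rho_upper_left, h.rho_upper_right]
    rw [h.left, h.left, SL2.coe_weyl_inv, SL2.coe_weyl]
    ext i j
    fin_cases i <;> fin_cases j <;> simp [Matrix.mul_apply, Fin.sum_univ_three]
  · intro h3
    exact SL2.upper_ne_one one_ne_zero (h.injective_right (h3.trans (map_one _).symm))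

/-- A normal subgroup that contains a non-trivial element of a block `SL₂` is the whole group:
commutators with transvections that have the vector fixed by the block as center produce all such
transvections. -/
theorem eq_top_of_normal {N : Subgroup G} (hN : N.Normal) {g : G} (hg : g ∈ ι₁.range)
    (hgN : g ∈ N) (hg1 : g ≠ 1) : N = ⊤ := by
  obtain ⟨y, rfl⟩ := hg
  let E : K → K → Prop := fun a b => ∃ x ∈ N, ρ x = !![1, 0, 0; 0, 1, 0; a, b, 1]
  have hmul : ∀ a b c d, E a b → E c d → E (a + c) (b + d) := by
    rintro a b c d ⟨x, hx, hx'⟩ ⟨z, hz, hz'⟩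
    refine ⟨x * z, N.mul_mem hx hz, ?_⟩
    rw [map_mul, hx', hz']
    ext i j
    fin_cases i <;> fin_cases j <;> simp [Matrix.mul_apply, Fin.sum_univ_three]
  have hinv : ∀ a b, E a b → E (-a) (-b) := by
    rintro a b ⟨x, hx, hx'⟩
    refine ⟨x⁻¹, N.inv_mem hx, ?_⟩
    have e := inv_mul_apply (ρ := ρ) x
    rw [hx'] at e
    rw [← Matrix.inv_eq_left_inv e]
    refine Matrix.inv_eq_left_inv ?_
    ext i j
    fin_cases i <;> fin_cases j <;> simp [Matrix.mul_apply, Fin.sum_univ_three]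
  have hconj : ∀ a b, E a b → ∀ z : SL2 K,
      E (a * z.1 0 0 + b * z.1 1 0) (a * z.1 0 1 + b * z.1 1 1) := by
    rintro a b ⟨x, hx, hx'⟩ z
    refine ⟨ι₁ z⁻¹ * x * (ι₁ z⁻¹)⁻¹, hN.conj_mem _ hx _, ?_⟩
    have hd := SL2.det_eq z
    rw [← map_inv, inv_inv, map_mul, map_mul, hx', h.left, h.left,
      Matrix.SpecialLinearGroup.coe_inv, Matrix.adjugate_fin_two]
    ext i j
    fin_cases i <;> fin_cases j <;> simp [Matrix.mul_apply, Fin.sum_univ_three] <;> grind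
  have hcomm : ∀ a b, E (a * y.1 0 0 + b * y.1 1 0 - a) (a * y.1 0 1 + b * y.1 1 1 - b) := by
    intro a b
    obtain ⟨x, hx⟩ := h.exists_eq !![1, 0, 0; 0, 1, 0; a, b, 1] (by simp [Matrix.det_fin_three])
    refine ⟨x⁻¹ * ((ι₁ y)⁻¹ * x * ι₁ y), ?_, ?_⟩
    · have := N.mul_mem (hN.conj_mem _ (N.inv_mem hgN) x⁻¹) hgN
      simpa [mul_assoc] using this
    · have e := inv_mul_apply (ρ := ρ) x
      have hd := SL2.det_eq y
      have hxi : ρ x⁻¹ = !![1, 0, 0; 0, 1, 0; -a, -b, 1] := by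
        rw [hx] at e
        rw [← Matrix.inv_eq_left_inv e]
        refine Matrix.inv_eq_left_inv ?_
        ext i j
        fin_cases i <;> fin_cases j <;> simp [Matrix.mul_apply, Fin.sum_univ_three]
      rw [← map_inv, map_mul, map_mul, map_mul, hx, hxi, h.left, h.left,
        Matrix.SpecialLinearGroup.coe_inv, Matrix.adjugate_fin_two]
      ext i j
      fin_cases i <;> fin_cases j <;> simp [Matrix.mul_apply, Fin.sum_univ_three] <;> grind
  have hex : ∃ a b, E a b ∧ (a ≠ 0 ∨ b ≠ 0) := by
    by_contra! hcon
    refine hg1 ?_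
    have : y = 1 := by
      have h1 := hcon _ _ (hcomm 1 0)
      have h2 := hcon _ _ (hcomm 0 1)
      ext i j
      fin_cases i <;> fin_cases j <;> simp <;> grind
    rw [this, map_one]
  have hup : ∀ a b t, E a b → E 0 (t * a) := by
    intro a b t hE
    have := hmul _ _ _ _ (hconj a b hE (SL2.upper t)) (hinv _ _ hE)
    simpa [mul_comm] using this
  have hlo : ∀ a b t, E a b → E (t * b) 0 := by
    intro a b t hE
    have := hmul _ _ _ _ (hconj a b hE (SL2.lower t)) (hinv _ _ hE)
    simpa [mul_comm] using this
  have hall : ∀ a b, E a b := by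
    obtain ⟨a₀, b₀, hE, hne⟩ := hex
    have h1 : (∀ b, E 0 b) ∧ ∀ a, E a 0 := by
      rcases hne with ha | hb
      · have : ∀ b, E 0 b := fun b => by simpa [ha] using hup _ _ (b / a₀) hE
        exact ⟨this, fun a => by simpa using hlo 0 1 a (this 1)⟩
      · have : ∀ a, E a 0 := fun a => by simpa [hb] using hlo _ _ (a / b₀) hE
        exact ⟨fun b => by simpa using hup 1 0 b (this 1), this⟩
    intro a b
    simpa using hmul _ _ _ _ (h1.1 b) (h1.2 a)
  let M := centers h.toIsSpecialLinear N
  have inv : ∀ z, ∀ v ∈ M, ρ z *ᵥ v ∈ M := fun z v hv =>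
    IsCenter.mulVec hv fun x hx => hN.conj_mem x hx z
  have m2 : ![0, 0, 1] ∈ M := by
    intro φ hφ z hz
    have hφ2 : φ 2 = 0 := by simpa [dotProduct, Fin.sum_univ_three] using hφ
    obtain ⟨x, hx, hx'⟩ := hall (φ 0) (φ 1)
    have : z = x := h.injective (by
      rw [hz, hx']
      ext i j
      rw [Matrix.add_apply, Matrix.vecMulVec_apply]
      fin_cases i <;> fin_cases j <;> simp [hφ2])
    exact this ▸ hx
  have m1 : ![0, 1, 0] ∈ M := by
    convert! M.sub_mem (inv (ι₂ (SL2.upper 1)) _ m2) m2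
    ext i
    rw [Pi.sub_apply, mulVec_apply_three, h.rho_upper_right]
    fin_cases i <;> simp
  have m0 : ![1, 0, 0] ∈ M := by
    convert! M.sub_mem (inv (ι₁ (SL2.upper 1)) _ m1) m1
    ext i
    rw [Pi.sub_apply, mulVec_apply_three, h.rho_upper_left]
    fin_cases i <;> simp
  exact h.eq_top_of_isCenter m0 m1 m2

theorem eq_top_of_range_left_le {N : Subgroup G} (hN : N.Normal) (hle : ι₁.range ≤ N) :
    N = ⊤ :=
  h.eq_top_of_normal hN ⟨SL2.upper 1, rfl⟩ (hle ⟨_, rfl⟩) fun h3 =>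
    SL2.upper_ne_one one_ne_zero (h.injective_left (h3.trans (map_one _).symm))

end Basic

section Sylow

variable {p : ℕ} [Fact p.Prime] {G : Type*} [Group G] {K : Type*} [Field K] [CharP K p] [Finite K]
  {ρ : G →* Matrix (Fin 3) (Fin 3) K} {ι₁ ι₂ : SL2 K →* G} (h : IsA2 ρ ι₁ ι₂)

include h

omit [Fact p.Prime] [CharP K p] in
theorem finite : Finite G := Finite.of_injective ρ h.injective

theorem isRigidLeft :
    IsRigidLeft p ι₁.range ι₂.range (SL2.root ι₁) (SL2.root (ι₁.comp SL2.contra)) where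
  normal_eq_top N hN g hg hgN hg1 := h.eq_top_of_normal hN hg hgN hg1
  sup_eq_top Y hY hne hne' := by
    have hi := h.injective_left
    obtain ⟨y, hy⟩ := SL2.exists_conj_of_isSylowIn hi hY
    set a := y.1 0 0 with ha
    set c := y.1 1 0 with hc
    have hc0 : c ≠ 0 := by
      intro h0
      refine hne (IsSylowIn.eq_of_le hY (SL2.isSylowIn_root hi) fun x hx => ?_)
      obtain ⟨t, rfl⟩ := (hy x).1 hx
      refine SL2.mem_root.2 ⟨a ^ 2 * t, congrArg ι₁ (Subtype.ext ?_)⟩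
      rw [SL2.coe_conj_upper, ← ha, ← hc, h0]
      simp
    have ha0 : a ≠ 0 := by
      intro h0
      have h1 := SL2.isSylowIn_root (p := p) (h.contra.injective_left)
      rw [SL2.range_comp_contra] at h1
      refine hne' (IsSylowIn.eq_of_le hY h1 fun x hx => ?_)
      obtain ⟨t, rfl⟩ := (hy x).1 hx
      refine SL2.mem_root_contra.2 ⟨-c ^ 2 * t, congrArg ι₁ (Subtype.ext ?_)⟩
      rw [SL2.coe_conj_upper, ← ha, ← hc, h0]
      simp
    let P := Y ⊔ ι₂.range
    have hYP : ∀ t, ι₁ (y * SL2.upper t * y⁻¹) ∈ P := fun t =>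
      Subgroup.mem_sup_left ((hy _).2 ⟨t, rfl⟩)
    have h2P : ∀ z, ι₂ z ∈ P := fun z => Subgroup.mem_sup_right ⟨z, rfl⟩
    let M := centers h.toIsSpecialLinear P
    have inv : ∀ z, ∀ v ∈ M, ρ (ι₂ z) *ᵥ v ∈ M := fun z v hv => IsCenter.mulVec_of_mem hv (h2P z)
    have key : ∀ v ∈ M, ∀ c : K, c ≠ 0 → ∀ u, v = c • u → u ∈ M := by
      rintro _ hv c hc u rfl
      have := M.smul_mem c⁻¹ hv
      rwa [smul_smul, inv_mul_cancel₀ hc, one_smul] at this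
    have mv : ![a, c, 0] ∈ M := by
      intro φ hφ z hz
      have hφ' : φ 0 * a + φ 1 * c = 0 := by
        simpa [dotProduct, Fin.sum_univ_three] using hφ
      -- `φ` is the sum of a multiple of the functional `(-c, a, 0)` that belongs to `Y` and the
      -- conjugate of `(-c, a, 0)` by an element of `G₂` that fixes the center `(a, c, 0)`.
      have hz' : z = ι₁ (y * SL2.upper (-φ 0 / c - 1) * y⁻¹) *
          (ι₂ (SL2.upper (-φ 2 / a)) * ι₁ (y * SL2.upper 1 * y⁻¹) *
            ι₂ (SL2.upper (-φ 2 / a))⁻¹) := by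
        refine h.injective ?_
        rw [hz, SL2.upper_inv]
        simp only [map_mul ρ, h.left, h.rho_upper_right, SL2.coe_conj_upper, ← ha, ← hc]
        have hφ1 : φ 1 = -φ 0 * a / c := by field_simp; linear_combination hφ'
        ext i j
        rw [Matrix.add_apply, Matrix.vecMulVec_apply]
        fin_cases i <;> fin_cases j <;>
          simp [Matrix.mul_apply, Fin.sum_univ_three, hφ1] <;> field_simp <;> ring
      rw [hz']
      exact P.mul_mem (hYP _) (P.mul_mem (P.mul_mem (h2P _) (hYP _)) (h2P _))
    have m2 : ![0, 0, 1] ∈ M := by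
      refine key _ (M.sub_mem (inv (SL2.lower 1) _ mv) mv) c hc0 _ ?_
      ext i
      rw [Pi.sub_apply, mulVec_apply_three, h.rho_lower_right]
      fin_cases i <;> simp
    have m1 : ![0, 1, 0] ∈ M := by
      convert! M.sub_mem (inv (SL2.upper 1) _ m2) m2
      ext i
      rw [Pi.sub_apply, mulVec_apply_three, h.rho_upper_right]
      fin_cases i <;> simp
    have m0 : ![1, 0, 0] ∈ M := by
      refine key _ (M.sub_mem mv (M.smul_mem c m1)) a ha0 _ ?_
      ext i
      fin_cases i <;> simp
    exact h.eq_top_of_isCenter m0 m1 m2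

omit [Finite K] in
theorem unique_left {Y : Subgroup G} (hY : Y ≤ ι₁.range) (hp : IsPGroup p Y)
    (hle : Y ≤ triangular ρ) : Y ≤ SL2.root ι₁ := by
  intro x hx
  have hx2 := le_unitriangular hp hle hx
  obtain ⟨y, rfl⟩ := hY hx
  refine SL2.mem_root.2 ⟨y.1 0 1, congrArg ι₁ (Subtype.ext ?_)⟩
  have h1 := mem_triangular.1 hx2.1 1 0 (by decide)
  have h2 := hx2.2 0
  have h3 := hx2.2 1
  rw [h.left] at h1 h2 h3
  ext i j
  fin_cases i <;> fin_cases j <;> simp_all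

theorem isAdapted : IsAdapted p ι₁.range ι₂.range (triangular ρ) := by
  have := h.finite
  obtain ⟨S, hS⟩ := exists_sylow_unitriangular (p := p) h.injective h.normalizer_unitriangular_le
  have hB : IsBorel p (triangular ρ) :=
    ⟨S, (normalizer_eq_triangular hS h.normalizer_unitriangular_le).symm⟩
  refine ⟨blockTriangular ρ ![0, 0, 1], blockTriangular ρ ![0, 1, 1], ⟨?_, _, hB, ?_⟩,
    ⟨?_, _, hB, ?_⟩, ?_, ?_, ?_⟩
  · intro h1
    have h2 := mem_blockTriangular.1 (h1 ▸ Subgroup.mem_top (ι₂ (SL2.lower 1))) 2 1 (by simp)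
    rw [h.rho_lower_right] at h2
    simp at h2
  · intro x hx
    rw [mem_blockTriangular]
    intro i j hij
    refine mem_triangular.1 hx i j ?_
    fin_cases i <;> fin_cases j <;> simp_all
  · intro h1
    have h2 := mem_blockTriangular.1 (h1 ▸ Subgroup.mem_top (ι₁ (SL2.lower 1))) 1 0 (by simp)
    rw [h.rho_lower_left] at h2
    simp at h2
  · intro x hx
    rw [mem_blockTriangular]
    intro i j hij
    refine mem_triangular.1 hx i j ?_
    fin_cases i <;> fin_cases j <;> simp_all
  · rintro _ ⟨y, rfl⟩
    rw [mem_blockTriangular]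
    intro i j hij
    rw [h.left]
    fin_cases i <;> fin_cases j <;> simp_all
  · rintro _ ⟨y, rfl⟩
    rw [mem_blockTriangular]
    intro i j hij
    rw [h.right]
    fin_cases i <;> fin_cases j <;> simp_all
  · ext x
    rw [Subgroup.mem_inf, mem_triangular, mem_blockTriangular, mem_blockTriangular]
    constructor
    · intro hx
      refine ⟨fun i j hij => hx i j ?_, fun i j hij => hx i j ?_⟩ <;>
      · fin_cases i <;> fin_cases j <;> simp_all
    · rintro ⟨h1, h2⟩ i j hij
      by_cases h3 : (![0, 0, 1] : Fin 3 → ℕ) j < (![0, 0, 1] : Fin 3 → ℕ) i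
      · exact h1 i j h3
      · refine h2 i j ?_
        fin_cases i <;> fin_cases j <;> simp_all

theorem isChamber :
    IsChamber p ι₁.range ι₂.range (triangular ρ) (SL2.root ι₁) (SL2.root ι₂) where
  borel := by
    have := h.finite
    obtain ⟨S, hS⟩ :=
      exists_sylow_unitriangular (p := p) h.injective h.normalizer_unitriangular_le
    exact ⟨S, (normalizer_eq_triangular hS h.normalizer_unitriangular_le).symm⟩
  adapted := h.isAdapted
  sylow_left := SL2.isSylowIn_root h.injective_left
  sylow_right := SL2.isSylowIn_root h.injective_right
  le_left x hx := by
    obtain ⟨t, rfl⟩ := SL2.mem_root.1 hx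
    exact (h.upper_left_mem t).1
  le_right x hx := by
    obtain ⟨t, rfl⟩ := SL2.mem_root.1 hx
    exact (h.upper_right_mem t).1
  unique_left Y hY hp hle := h.unique_left hY hp hle
  unique_right Y hY hp hle := by
    have := h.flip.unique_left (p := p) (Y := Y)
    rw [SL2.range_comp_twist, SL2.root_comp_twist, triangular_flip] at this
    exact this hY hp hle
  ne_bot_left := SL2.root_ne_bot h.injective_left
  ne_bot_right := SL2.root_ne_bot h.injective_right
  exists_left N hN hmem := h.exists_of_commutator_mem hN hmem
  exists_right N hN hmem := by
    have := h.flip.exists_of_commutator_mem hN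
    rw [SL2.range_comp_twist, SL2.root_comp_twist] at this
    exact this hmem

/-- If a Borel subgroup belonging to a flag `(v, φ)` is the intersection of a proper subgroup
containing `G₁` and one containing `G₂`, then the flag is one of the two coordinate flags that
are compatible with both `G₁` and `G₂`. -/
theorem eq_or_eq_of_isAdapted {C : Subgroup G} (hC : IsBorel p C)
    (hA : IsAdapted p ι₁.range ι₂.range C) :
    C = triangular ρ ∨ C = triangular (MatrixRep.contra ρ) := by
  have := h.finite
  have hN := h.normalizer_unitriangular_le
  have hN' := h.contra.normalizer_unitriangular_le
  obtain ⟨S, hS⟩ := exists_sylow_unitriangular (p := p) h.injective hN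
  obtain ⟨S', hS'⟩ := exists_sylow_unitriangular (p := p) h.contra.injective hN'
  obtain ⟨T, rfl⟩ := hC
  obtain ⟨g, hg⟩ := Sylow.exists_conj S T
  obtain ⟨P, Q, hP, hQ, h1P, h2Q, hPQ⟩ := hA
  have hle : (T : Subgroup G) ≤ P ⊓ Q := hPQ ▸ Subgroup.le_normalizer
  have conj : ∀ R : Subgroup G, R ≠ ⊤ → (T : Subgroup G) ≤ R →
      (∀ x ∈ R, ∃ c, ∀ i, (ρ x * ρ g) i 0 = c * ρ g i 0) ∨
      ∀ x ∈ R, ∃ c, ∀ j, (ρ g⁻¹ * ρ x) 2 j = c * ρ g⁻¹ 2 j := by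
    intro R hR hTR
    have h1 := h.stabilizes_of_unitriangular_le (P := R.comap (MulAut.conj g).toMonoidHom)
      (fun x hx => hTR ((hg _).2 ⟨x, hS ▸ hx, rfl⟩)) ?_
    · refine h1.imp (fun h2 x hx => ?_) fun h2 x hx => ?_
      · have h3 := h2 (g⁻¹ * x * g) (by simpa [Subgroup.mem_comap, mul_assoc] using hx)
        refine ⟨ρ (g⁻¹ * x * g) 0 0, fun i => ?_⟩
        have e : ρ x * ρ g = ρ g * ρ (g⁻¹ * x * g) := by simp [← map_mul, mul_assoc]
        rw [e, Matrix.mul_apply, Fin.sum_univ_three, h3.1, h3.2]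
        ring
      · have h3 := h2 (g⁻¹ * x * g) (by simpa [Subgroup.mem_comap, mul_assoc] using hx)
        refine ⟨ρ (g⁻¹ * x * g) 2 2, fun j => ?_⟩
        have e : ρ g⁻¹ * ρ x = ρ (g⁻¹ * x * g) * ρ g⁻¹ := by simp [← map_mul, mul_assoc]
        rw [e, Matrix.mul_apply, Fin.sum_univ_three, h3.1, h3.2]
        ring
    · intro htop
      refine hR (top_le_iff.1 fun x _ => ?_)
      have := htop ▸ Subgroup.mem_top (g⁻¹ * x * g)
      simpa [Subgroup.mem_comap, mul_assoc] using this
  have hcol : ∃ i, ρ g i 0 ≠ 0 := by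
    by_contra! h0
    have := congrFun (congrFun (inv_mul_apply (ρ := ρ) g) 0) 0
    simp [Matrix.mul_apply, h0] at this
  have hrow : ∃ j, ρ g⁻¹ 2 j ≠ 0 := by
    by_contra! h0
    have := congrFun (congrFun (inv_mul_apply (ρ := ρ) g) 2) 2
    simp [Matrix.mul_apply, h0] at this
  have hTcol : ∀ x ∈ (T : Subgroup G), ∀ i, (ρ x * ρ g) i 0 = ρ g i 0 := by
    intro x hx i
    obtain ⟨u, hu, rfl⟩ := (hg x).1 hx
    rw [hS] at hu
    have e : ρ (g * u * g⁻¹) * ρ g = ρ g * ρ u := by simp [← map_mul, mul_assoc]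
    have h1 := mem_triangular.1 hu.1 1 0 (by decide)
    have h2 := mem_triangular.1 hu.1 2 0 (by decide)
    rw [e, Matrix.mul_apply, Fin.sum_univ_three, hu.2, h1, h2]
    ring
  have hTrow : ∀ x ∈ (T : Subgroup G), ∀ j, (ρ g⁻¹ * ρ x) 2 j = ρ g⁻¹ 2 j := by
    intro x hx j
    obtain ⟨u, hu, rfl⟩ := (hg x).1 hx
    rw [hS] at hu
    have e : ρ g⁻¹ * ρ (g * u * g⁻¹) = ρ u * ρ g⁻¹ := by simp [← map_mul, mul_assoc]
    have h1 := mem_triangular.1 hu.1 2 0 (by decide)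
    have h2 := mem_triangular.1 hu.1 2 1 (by decide)
    rw [e, Matrix.mul_apply, Fin.sum_univ_three, hu.2, h1, h2]
    ring
  have fixL : (∀ x ∈ P, ∃ c, ∀ i, (ρ x * ρ g) i 0 = c * ρ g i 0) →
      ρ g 0 0 = 0 ∧ ρ g 1 0 = 0 := by
    intro h1
    obtain ⟨c, hc⟩ := h1 _ (h1P ⟨SL2.upper 1, rfl⟩)
    obtain ⟨d, hd⟩ := h1 _ (h1P ⟨SL2.lower 1, rfl⟩)
    rw [h.rho_upper_left] at hc
    rw [h.rho_lower_left] at hd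
    simp only [Matrix.mul_apply, Fin.sum_univ_three] at hc hd
    have c0 := hc 0; have c1 := hc 1; have d0 := hd 0; have d1 := hd 1
    simp at c0 c1 d0 d1
    grind
  have fixR : (∀ x ∈ Q, ∃ c, ∀ i, (ρ x * ρ g) i 0 = c * ρ g i 0) →
      ρ g 1 0 = 0 ∧ ρ g 2 0 = 0 := by
    intro h1
    obtain ⟨c, hc⟩ := h1 _ (h2Q ⟨SL2.upper 1, rfl⟩)
    obtain ⟨d, hd⟩ := h1 _ (h2Q ⟨SL2.lower 1, rfl⟩)
    rw [h.rho_upper_right] at hc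
    rw [h.rho_lower_right] at hd
    simp only [Matrix.mul_apply, Fin.sum_univ_three] at hc hd
    have c0 := hc 1; have c1 := hc 2; have d0 := hd 1; have d1 := hd 2
    simp at c0 c1 d0 d1
    grind
  have fixL' : (∀ x ∈ P, ∃ c, ∀ j, (ρ g⁻¹ * ρ x) 2 j = c * ρ g⁻¹ 2 j) →
      ρ g⁻¹ 2 0 = 0 ∧ ρ g⁻¹ 2 1 = 0 := by
    intro h1
    obtain ⟨c, hc⟩ := h1 _ (h1P ⟨SL2.upper 1, rfl⟩)
    obtain ⟨d, hd⟩ := h1 _ (h1P ⟨SL2.lower 1, rfl⟩)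
    rw [h.rho_upper_left] at hc
    rw [h.rho_lower_left] at hd
    simp only [Matrix.mul_apply, Fin.sum_univ_three] at hc hd
    have c0 := hc 0; have c1 := hc 1; have d0 := hd 0; have d1 := hd 1
    simp at c0 c1 d0 d1
    grind
  have fixR' : (∀ x ∈ Q, ∃ c, ∀ j, (ρ g⁻¹ * ρ x) 2 j = c * ρ g⁻¹ 2 j) →
      ρ g⁻¹ 2 1 = 0 ∧ ρ g⁻¹ 2 2 = 0 := by
    intro h1
    obtain ⟨c, hc⟩ := h1 _ (h2Q ⟨SL2.upper 1, rfl⟩)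
    obtain ⟨d, hd⟩ := h1 _ (h2Q ⟨SL2.lower 1, rfl⟩)
    rw [h.rho_upper_right] at hc
    rw [h.rho_lower_right] at hd
    simp only [Matrix.mul_apply, Fin.sum_univ_three] at hc hd
    have c0 := hc 1; have c1 := hc 2; have d0 := hd 1; have d1 := hd 2
    simp at c0 c1 d0 d1
    grind
  rcases conj P hP.1 (hle.trans inf_le_left) with hp | hp <;>
  rcases conj Q hQ.1 (hle.trans inf_le_right) with hq | hq
  · obtain ⟨i, hi⟩ := hcol
    refine absurd ?_ hi
    obtain ⟨h0, h1⟩ := fixL hp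
    have h2 := (fixR hq).2
    fin_cases i <;> assumption
  · have h1 := fixL hp
    have h2 := fixR' hq
    right
    have : T = S' := by
      refine sylow_eq_of_le_triangular hS' fun x hx => ?_
      have hx' := (T : Subgroup G).inv_mem hx
      have e1 := hTcol _ hx' 0
      have e2 := hTcol _ hx' 1
      have e4 := hTrow _ hx' 1
      simp only [Matrix.mul_apply, Fin.sum_univ_three, h1, h2, mul_zero, zero_mul, add_zero,
        zero_add] at e1 e2 e4
      have hi : ρ g 2 0 ≠ 0 := by
        obtain ⟨i, hi⟩ := hcol
        fin_cases i
        exacts [absurd h1.1 hi, absurd h1.2 hi, hi]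
      have hj : ρ g⁻¹ 2 0 ≠ 0 := by
        obtain ⟨j, hj⟩ := hrow
        fin_cases j
        exacts [hj, absurd h2.1 hj, absurd h2.2 hj]
      exact mem_triangular_three.2 ⟨(mul_eq_zero.1 e4).resolve_left hj,
        (mul_eq_zero.1 e1).resolve_right hi, (mul_eq_zero.1 e2).resolve_right hi⟩
    rw [this, normalizer_eq_triangular hS' hN']
  · have h1 := fixL' hp
    have h2 := fixR hq
    left
    have : T = S := by
      refine sylow_eq_of_le_triangular hS fun x hx => ?_
      have e1 := hTcol _ hx 1
      have e2 := hTcol _ hx 2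
      have e4 := hTrow _ hx 1
      simp only [Matrix.mul_apply, Fin.sum_univ_three, h1, h2, mul_zero, zero_mul, add_zero,
        zero_add] at e1 e2 e4
      have hi : ρ g 0 0 ≠ 0 := by
        obtain ⟨i, hi⟩ := hcol
        fin_cases i
        exacts [hi, absurd h2.1 hi, absurd h2.2 hi]
      have hj : ρ g⁻¹ 2 2 ≠ 0 := by
        obtain ⟨j, hj⟩ := hrow
        fin_cases j
        exacts [absurd h1.1 hj, absurd h1.2 hj, hj]
      exact mem_triangular_three.2 ⟨(mul_eq_zero.1 e1).resolve_right hi,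
        (mul_eq_zero.1 e2).resolve_right hi, (mul_eq_zero.1 e4).resolve_left hj⟩
    rw [this, normalizer_eq_triangular hS hN]
  · obtain ⟨j, hj⟩ := hrow
    refine absurd ?_ hj
    obtain ⟨h0, h1⟩ := fixL' hp
    have h2 := (fixR' hq).2
    fin_cases j <;> assumption

theorem isApartment :
    IsApartment p ι₁.range ι₂.range (triangular ρ) (SL2.root ι₁) (SL2.root ι₂)
      (triangular (MatrixRep.contra ρ)) (SL2.root (ι₁.comp SL2.contra))
      (SL2.root (ι₂.comp SL2.contra)) where
  pos := h.isChamber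
  neg := by
    have := h.contra.isChamber (p := p)
    rwa [SL2.range_comp_contra, SL2.range_comp_contra] at this
  opposite := by
    have := h.finite
    have hN := h.normalizer_unitriangular_le
    have hN' := h.contra.normalizer_unitriangular_le
    obtain ⟨S, hS⟩ := exists_sylow_unitriangular (p := p) h.injective hN
    obtain ⟨S', hS'⟩ := exists_sylow_unitriangular (p := p) h.contra.injective hN'
    exact ⟨S, S', (normalizer_eq_triangular hS hN).symm, (normalizer_eq_triangular hS' hN').symm,
      by rw [hS, hS', unitriangular_inf_contra h.injective]⟩
  unique C hC hA := h.eq_or_eq_of_isAdapted hC hA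
  inf_left := SL2.root_inf_root_contra h.injective_left
  inf_right := SL2.root_inf_root_contra h.injective_right
  commute x hx y hy := by
    obtain ⟨s, rfl⟩ := SL2.mem_root.1 hx
    obtain ⟨t, rfl⟩ := SL2.mem_root_contra.1 hy
    exact h.commute_upper_lower s t
  commute' x hx y hy := by
    obtain ⟨s, rfl⟩ := SL2.mem_root.1 hx
    obtain ⟨t, rfl⟩ := SL2.mem_root.1 hy
    have := h.contra.commute_upper_lower s (-t)
    simpa using this
  sup_eq_top := h.sup_eq_top
  normal_left N hN hle := h.eq_top_of_range_left_le hN hle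
  normal_right N hN hle := by
    have := h.flip.eq_top_of_range_left_le hN
    rw [SL2.range_comp_twist] at this
    exact this hle

theorem isRigidRight :
    IsRigidLeft p ι₂.range ι₁.range (SL2.root ι₂) (SL2.root (ι₂.comp SL2.contra)) := by
  have := h.flip.isRigidLeft (p := p)
  have e : (ι₂.comp SL2.twist).comp SL2.contra = (ι₂.comp SL2.contra).comp SL2.twist := by
    ext y
    simp [SL2.contra_twist]
  rwa [e, SL2.range_comp_twist, SL2.range_comp_twist, SL2.root_comp_twist,
    SL2.root_comp_twist] at this

end Sylow
end IsA2
end MatrixRep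

/-! ### The standard pairs of types `C₂` and `²A₃` -/

namespace MatrixRep

section Form

variable {K : Type*} [Field K]

/-- The Gram matrix of the standard skew-hermitian form, in a basis ordered in such a way that
the stabilizer of the standard flag consists of the upper triangular matrices. -/
def gram (K : Type*) [Field K] : Matrix (Fin 4) (Fin 4) K :=
  !![0, 0, 0, 1; 0, 0, 1, 0; 0, -1, 0, 0; -1, 0, 0, 0]

/-- The skew-hermitian form with Gram matrix `gram K`. -/
def form (σ : K →+* K) (u v : Fin 4 → K) : K :=
  u 0 * σ (v 3) + u 1 * σ (v 2) - u 2 * σ (v 1) - u 3 * σ (v 0)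

theorem mulVec_apply_four (A : Matrix (Fin 4) (Fin 4) K) (v : Fin 4 → K) (i : Fin 4) :
    (A *ᵥ v) i = A i 0 * v 0 + A i 1 * v 1 + A i 2 * v 2 + A i 3 * v 3 := by
  rw [Matrix.mulVec, dotProduct, Fin.sum_univ_four]

theorem form_eq (σ : K →+* K) (u v : Fin 4 → K) :
    form σ u v = u ⬝ᵥ (gram K *ᵥ (σ ∘ v)) := by
  simp only [form, gram, dotProduct, Fin.sum_univ_four, mulVec_apply_four]
  simp
  ring

theorem gram_mul_gram : gram K * gram K = -1 := by
  ext i j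
  fin_cases i <;> fin_cases j <;> simp [gram, Matrix.mul_apply, Fin.sum_univ_four]

/-- The transpose of an isometry is an isometry. -/
theorem isometry_transpose {σ : K →+* K} (hσ : ∀ x, σ (σ x) = x) {A : Matrix (Fin 4) (Fin 4) K}
    (hA : Aᵀ * gram K * A.map σ = gram K) : A * gram K * Aᵀ.map σ = gram K := by
  have h1 : (-(gram K * Aᵀ * gram K)) * A.map σ = 1 := by
    rw [neg_mul, Matrix.mul_assoc (gram K), Matrix.mul_assoc (gram K), hA, gram_mul_gram, neg_neg]
  have h2 := mul_eq_one_comm.1 h1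
  have h3 : A.map σ * gram K * Aᵀ = gram K := by
    calc A.map σ * gram K * Aᵀ = A.map σ * (-(gram K * Aᵀ * gram K)) * gram K := by
          simp only [mul_neg, neg_mul, Matrix.mul_assoc, gram_mul_gram, mul_one, neg_neg]
      _ = gram K := by rw [h2, one_mul]
  have h4 := congrArg (fun M : Matrix (Fin 4) (Fin 4) K => M.map σ) h3
  simp only [Matrix.map_mul] at h4
  have e1 : (A.map σ).map σ = A := by
    ext i j; simp [hσ]
  have e2 : (gram K).map σ = gram K := by
    ext i j; fin_cases i <;> fin_cases j <;> simp [gram]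
  rwa [e1, e2] at h4

end Form

/-- `ρ` represents `G` by isometries of determinant one of the standard skew-hermitian form over
`(K, σ)`, and `ι₁`, `ι₂` are the standard subgroups: `SL₂(K)` acting on the maximal isotropic
subspace `⟨e₀, e₁⟩` and (conjugate-dually) on `⟨e₂, e₃⟩`, and `SL₂` over the fixed field `j(F)`
of `σ`, acting on `⟨e₁, e₂⟩`. For `σ = 1` this is `Sp₄`, otherwise `SU₄`. -/
structure IsUnitary {G : Type*} [Group G] {K F : Type*} [Field K] [Field F] (σ : K →+* K)
    (j : F →+* K) (ρ : G →* Matrix (Fin 4) (Fin 4) K) (ι₁ : SL2 K →* G) (ι₂ : SL2 F →* G) :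
    Prop where
  involutive : ∀ x, σ (σ x) = x
  fixed : ∀ x, σ x = x ↔ ∃ y, j y = x
  injective : Function.Injective ρ
  det_eq_one : ∀ x, (ρ x).det = 1
  isometry : ∀ x, (ρ x)ᵀ * gram K * (ρ x).map σ = gram K
  left : ∀ y, ρ (ι₁ y) = !![y.1 0 0, y.1 0 1, 0, 0; y.1 1 0, y.1 1 1, 0, 0;
    0, 0, σ (y.1 0 0), -σ (y.1 0 1); 0, 0, -σ (y.1 1 0), σ (y.1 1 1)]
  right : ∀ y, ρ (ι₂ y) = !![1, 0, 0, 0; 0, j (y.1 0 0), j (y.1 0 1), 0;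
    0, j (y.1 1 0), j (y.1 1 1), 0; 0, 0, 0, 1]

namespace IsUnitary

variable {G : Type*} [Group G] {K F : Type*} [Field K] [Field F] {σ : K →+* K} {j : F →+* K}
  {ρ : G →* Matrix (Fin 4) (Fin 4) K} {ι₁ : SL2 K →* G} {ι₂ : SL2 F →* G}
  (h : IsUnitary σ j ρ ι₁ ι₂)

include h

theorem contra :
    IsUnitary σ j (MatrixRep.contra ρ) (ι₁.comp SL2.contra) (ι₂.comp SL2.contra) where
  involutive := h.involutive
  fixed := h.fixed
  injective := contra_injective h.injective
  det_eq_one x := by rw [contra_apply, Matrix.det_transpose, h.det_eq_one]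
  isometry x := by
    rw [contra_apply, Matrix.transpose_transpose]
    exact isometry_transpose h.involutive (h.isometry x⁻¹)
  left y := by
    rw [contra_apply, MonoidHom.comp_apply, ← map_inv, h.left, SL2.coe_inv_contra]
    ext i j; fin_cases i <;> fin_cases j <;> simp
  right y := by
    rw [contra_apply, MonoidHom.comp_apply, ← map_inv, h.right, SL2.coe_inv_contra]
    ext i j; fin_cases i <;> fin_cases j <;> simp

theorem sigma_j (y : F) : σ (j y) = j y := (h.fixed _).2 ⟨y, rfl⟩

theorem form_mulVec (x : G) (u v : Fin 4 → K) :
    form σ (ρ x *ᵥ u) (ρ x *ᵥ v) = form σ u v := by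
  rw [form_eq, form_eq]
  have e : σ ∘ (ρ x *ᵥ v) = (ρ x).map σ *ᵥ (σ ∘ v) := by
    ext i
    simp [mulVec_apply_four]
  rw [e, Matrix.mulVec_mulVec, Matrix.dotProduct_mulVec, Matrix.vecMul_mulVec,
    ← Matrix.mul_assoc, h.isometry, Matrix.dotProduct_mulVec]

theorem form_col (x : G) (i k : Fin 4) :
    ρ x 0 i * σ (ρ x 3 k) + ρ x 1 i * σ (ρ x 2 k) - ρ x 2 i * σ (ρ x 1 k) -
      ρ x 3 i * σ (ρ x 0 k) = gram K i k := by
  have e := congrFun (congrFun (h.isometry x) i) k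
  rw [← e]
  simp only [Matrix.mul_apply, Fin.sum_univ_four, Matrix.transpose_apply, Matrix.map_apply, gram]
  simp
  ring

theorem rho_upper_left (t : K) : ρ (ι₁ (SL2.upper t)) =
    !![1, t, 0, 0; 0, 1, 0, 0; 0, 0, 1, -σ t; 0, 0, 0, 1] := by
  simp [h.left]

theorem rho_lower_left (t : K) : ρ (ι₁ (SL2.lower t)) =
    !![1, 0, 0, 0; t, 1, 0, 0; 0, 0, 1, 0; 0, 0, -σ t, 1] := by
  simp [h.left]

theorem rho_weyl_left : ρ (ι₁ SL2.weyl) =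
    !![0, -1, 0, 0; 1, 0, 0, 0; 0, 0, 0, 1; 0, 0, -1, 0] := by
  simp [h.left]

theorem rho_weyl_inv_left : ρ (ι₁ SL2.weyl⁻¹) =
    !![0, 1, 0, 0; -1, 0, 0, 0; 0, 0, 0, -1; 0, 0, 1, 0] := by
  simp [h.left, -map_inv]

theorem rho_upper_right (t : F) : ρ (ι₂ (SL2.upper t)) =
    !![1, 0, 0, 0; 0, 1, j t, 0; 0, 0, 1, 0; 0, 0, 0, 1] := by
  simp [h.right]

theorem rho_lower_right (t : F) : ρ (ι₂ (SL2.lower t)) =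
    !![1, 0, 0, 0; 0, 1, 0, 0; 0, j t, 1, 0; 0, 0, 0, 1] := by
  simp [h.right]

theorem rho_weyl_right : ρ (ι₂ SL2.weyl) =
    !![1, 0, 0, 0; 0, 0, -1, 0; 0, 1, 0, 0; 0, 0, 0, 1] := by
  simp [h.right]

theorem rho_weyl_inv_right : ρ (ι₂ SL2.weyl⁻¹) =
    !![1, 0, 0, 0; 0, 0, 1, 0; 0, -1, 0, 0; 0, 0, 0, 1] := by
  simp [h.right, -map_inv]

/-- The short root group that is not simple. -/
theorem rho_short (t : K) : ρ (ι₂ SL2.weyl * ι₁ (SL2.upper t) * ι₂ SL2.weyl⁻¹) =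
    !![1, 0, t, 0; 0, 1, 0, σ t; 0, 0, 1, 0; 0, 0, 0, 1] := by
  rw [map_mul, map_mul, h.rho_weyl_right, h.rho_weyl_inv_right, h.rho_upper_left]
  ext i k
  fin_cases i <;> fin_cases k <;> simp [Matrix.mul_apply, Fin.sum_univ_four]

/-- The long root group that is not simple. -/
theorem rho_long (t : F) : ρ (ι₁ SL2.weyl * ι₂ (SL2.upper t) * ι₁ SL2.weyl⁻¹) =
    !![1, 0, 0, j t; 0, 1, 0, 0; 0, 0, 1, 0; 0, 0, 0, 1] := by
  rw [map_mul, map_mul, h.rho_weyl_left, h.rho_weyl_inv_left, h.rho_upper_right]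
  ext i k
  fin_cases i <;> fin_cases k <;> simp [Matrix.mul_apply, Fin.sum_univ_four]

/-- `⟨G₁, G₂⟩` contains the unipotent radical of the stabilizer of `⟨e₀⟩`. -/
theorem exists_radical {α β γ : K} (hα : α - σ α + β * σ γ - γ * σ β = 0) :
    ∃ x ∈ ι₁.range ⊔ ι₂.range,
      ρ x = !![1, -σ γ, σ β, α; 0, 1, 0, β; 0, 0, 1, γ; 0, 0, 0, 1] := by
  obtain ⟨a, ha⟩ := (h.fixed (α + β * σ γ)).1 (by
    rw [map_add, map_mul, h.involutive]; linear_combination -hα)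
  have h1 : ∀ y, ι₁ y ∈ ι₁.range ⊔ ι₂.range := fun y => Subgroup.mem_sup_left ⟨y, rfl⟩
  have h2 : ∀ y, ι₂ y ∈ ι₁.range ⊔ ι₂.range := fun y => Subgroup.mem_sup_right ⟨y, rfl⟩
  refine ⟨ι₁ (SL2.upper (-σ γ)) * (ι₂ SL2.weyl * ι₁ (SL2.upper (σ β)) * ι₂ SL2.weyl⁻¹) *
    (ι₁ SL2.weyl * ι₂ (SL2.upper a) * ι₁ SL2.weyl⁻¹), ?_, ?_⟩
  · exact mul_mem (mul_mem (h1 _) (mul_mem (mul_mem (h2 _) (h1 _)) (h2 _)))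
      (mul_mem (mul_mem (h1 _) (h2 _)) (h1 _))
  · rw [map_mul, map_mul, h.rho_short, h.rho_long, h.rho_upper_left, ha]
    ext i k
    fin_cases i <;> fin_cases k <;>
      simp [Matrix.mul_apply, Fin.sum_univ_four, h.involutive]
    ring

/-- The group generated by `G₁` and `G₂` is transitive on isotropic vectors. -/
theorem exists_mulVec_eq {v : Fin 4 → K} (hv : v ≠ 0) (hiso : form σ v v = 0) :
    ∃ x ∈ ι₁.range ⊔ ι₂.range, ρ x *ᵥ v = ![1, 0, 0, 0] := by
  have h1 : ∀ y, ι₁ y ∈ ι₁.range ⊔ ι₂.range := fun y => Subgroup.mem_sup_left ⟨y, rfl⟩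
  have h2 : ∀ y, ι₂ y ∈ ι₁.range ⊔ ι₂.range := fun y => Subgroup.mem_sup_right ⟨y, rfl⟩
  have step : ∀ v : Fin 4 → K, ∀ y ∈ ι₁.range ⊔ ι₂.range,
      (∃ x ∈ ι₁.range ⊔ ι₂.range, ρ x *ᵥ (ρ y *ᵥ v) = ![1, 0, 0, 0]) →
      ∃ x ∈ ι₁.range ⊔ ι₂.range, ρ x *ᵥ v = ![1, 0, 0, 0] := by
    rintro v y hy ⟨x, hx, e⟩
    exact ⟨x * y, mul_mem hx hy, by rw [map_mul, ← Matrix.mulVec_mulVec, e]⟩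
  have c0 : ∀ v : Fin 4 → K, form σ v v = 0 → v 0 ≠ 0 →
      ∃ x ∈ ι₁.range ⊔ ι₂.range, ρ x *ᵥ v = ![1, 0, 0, 0] := by
    intro v hiso h0
    have h0' : σ (v 0) ≠ 0 := (map_ne_zero σ).2 h0
    obtain ⟨x, hx, e⟩ := h.contra.exists_radical (α := v 3 / v 0) (β := σ (v 2 / v 0))
      (γ := -σ (v 1 / v 0)) (by
        simp only [map_div₀, map_neg, h.involutive]
        rw [form] at hiso
        field_simp
        linear_combination -hiso)
    rw [SL2.range_comp_contra, SL2.range_comp_contra] at hx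
    have e' : ρ x⁻¹ *ᵥ ![1, 0, 0, 0] = (v 0)⁻¹ • v := by
      rw [contra_apply] at e
      rw [← Matrix.transpose_transpose (ρ x⁻¹), e]
      ext i
      rw [mulVec_apply_four]
      fin_cases i <;> simp [h.involutive] <;> field_simp
    have e2 : ρ x *ᵥ v = v 0 • ![1, 0, 0, 0] := by
      have : v = v 0 • (ρ x⁻¹ *ᵥ ![1, 0, 0, 0]) := by
        rw [e', smul_smul, mul_inv_cancel₀ h0, one_smul]
      conv_lhs => rw [this]
      rw [Matrix.mulVec_smul, Matrix.mulVec_mulVec, mul_apply_inv, Matrix.one_mulVec]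
    refine step v x hx ⟨_, h1 (SL2.mk (v 0)⁻¹ 0 0 (v 0) (by simp [h0])), ?_⟩
    rw [e2, h.left]
    ext i
    rw [mulVec_apply_four]
    fin_cases i <;> simp [h0]
  have c1 : ∀ v : Fin 4 → K, form σ v v = 0 → v 1 ≠ 0 →
      ∃ x ∈ ι₁.range ⊔ ι₂.range, ρ x *ᵥ v = ![1, 0, 0, 0] := fun v hiso h0 =>
    step v _ (h1 SL2.weyl) (c0 _ (by rwa [h.form_mulVec]) (by
      rw [mulVec_apply_four, h.rho_weyl_left]; simpa using h0))
  have c2 : ∀ v : Fin 4 → K, form σ v v = 0 → v 2 ≠ 0 →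
      ∃ x ∈ ι₁.range ⊔ ι₂.range, ρ x *ᵥ v = ![1, 0, 0, 0] := fun v hiso h0 =>
    step v _ (h2 SL2.weyl) (c1 _ (by rwa [h.form_mulVec]) (by
      rw [mulVec_apply_four, h.rho_weyl_right]; simpa using h0))
  have c3 : ∀ v : Fin 4 → K, form σ v v = 0 → v 3 ≠ 0 →
      ∃ x ∈ ι₁.range ⊔ ι₂.range, ρ x *ᵥ v = ![1, 0, 0, 0] := fun v hiso h0 =>
    step v _ (h1 SL2.weyl) (c2 _ (by rwa [h.form_mulVec]) (by
      rw [mulVec_apply_four, h.rho_weyl_left]; simpa using h0))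
  by_contra hcon
  refine hv ?_
  ext i
  by_contra hi
  fin_cases i
  exacts [hcon (c0 v hiso hi), hcon (c1 v hiso hi), hcon (c2 v hiso hi), hcon (c3 v hiso hi)]

/-- After correction by elements of `⟨G₁, G₂⟩`, an isometry fixes `e₀` and `e₃`, and then it acts
on `⟨e₁, e₂⟩` as an element of `G₂`. -/
theorem sup_eq_top : ι₁.range ⊔ ι₂.range = ⊤ := by
  rw [eq_top_iff]
  intro x _
  have reduce : ∀ y z : G, y ∈ ι₁.range ⊔ ι₂.range → y * z ∈ ι₁.range ⊔ ι₂.range →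
      z ∈ ι₁.range ⊔ ι₂.range := fun y z hy hyz => (Subgroup.mul_mem_cancel_left _ hy).1 hyz
  have hcol : ∀ (z : G) (k : Fin 4), ρ z *ᵥ Pi.single k 1 = fun i => ρ z i k := by
    intro z k
    ext i
    simp
  obtain ⟨y, hy, e⟩ := h.exists_mulVec_eq (v := fun i => ρ x i 0) (by
      intro h0
      have := congrFun (congrFun (inv_mul_apply (ρ := ρ) x) 0) 0
      simp [Matrix.mul_apply, fun i => congrFun h0 i] at this) (h.form_col x 0 0)
  refine reduce y x hy ?_
  have z0 : ∀ i, ρ (y * x) i 0 = (![1, 0, 0, 0] : Fin 4 → K) i := by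
    intro i
    rw [map_mul, ← e]
    rfl
  generalize y * x = z at z0
  have z3 : ρ z 3 3 = 1 := by
    have := h.form_col z 0 3
    simp [z0, gram] at this
    exact σ.injective (by rw [this, map_one])
  obtain ⟨r, hr, er⟩ := h.exists_radical (α := ρ z 0 3) (β := ρ z 1 3) (γ := ρ z 2 3) (by
    have := h.form_col z 3 3
    simp [z3, gram] at this
    linear_combination this)
  refine reduce r⁻¹ z (inv_mem hr) ?_
  have e1 : ρ r * ρ (r⁻¹ * z) = ρ z := by simp [← map_mul]
  have hinv : ρ r⁻¹ * ρ r = 1 := inv_mul_apply r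
  have w0 : ∀ i, ρ (r⁻¹ * z) i 0 = (1 : Matrix (Fin 4) (Fin 4) K) i 0 := by
    intro i
    rw [← hinv, map_mul, Matrix.mul_apply, Matrix.mul_apply]
    refine Finset.sum_congr rfl fun k _ => ?_
    rw [z0, er]
    fin_cases k <;> rfl
  have w3 : ∀ i, ρ (r⁻¹ * z) i 3 = (1 : Matrix (Fin 4) (Fin 4) K) i 3 := by
    intro i
    rw [← hinv, map_mul, Matrix.mul_apply, Matrix.mul_apply]
    refine Finset.sum_congr rfl fun k _ => ?_
    rw [er]
    fin_cases k <;> simp [z3]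
  clear e1 hinv
  generalize r⁻¹ * z = w at w0 w3
  have hc : ∀ i k, _ := h.form_col w
  have w31 : ρ w 3 1 = 0 := by simpa [w0, gram] using hc 1 0
  have w32 : ρ w 3 2 = 0 := by simpa [w0, gram] using hc 2 0
  have w01 : ρ w 0 1 = 0 := by simpa [w3, gram] using hc 1 3
  have w02 : ρ w 0 2 = 0 := by simpa [w3, gram] using hc 2 3
  have f11 := hc 1 1
  have f12 := hc 1 2
  have f21 := hc 2 1
  have f22 := hc 2 2
  simp [w31, w32, w01, w02, gram] at f11 f12 f21 f22
  set a := ρ w 1 1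
  set b := ρ w 1 2
  set c := ρ w 2 1
  set d := ρ w 2 2
  have ew : ρ w = !![1, 0, 0, 0; 0, a, b, 0; 0, c, d, 0; 0, 0, 0, 1] := by
    ext i k
    fin_cases i <;> fin_cases k <;> simp [w0, w3, w31, w32, w01, w02, a, b, c, d]
  have hdet : a * d - b * c = 1 := by
    have := h.det_eq_one w
    rw [ew] at this
    simp [Matrix.det_succ_row_zero, Fin.sum_univ_succ] at this
    linear_combination this
  obtain ⟨a', ha⟩ := (h.fixed a).1 (by grind)
  obtain ⟨b', hb⟩ := (h.fixed b).1 (by grind)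
  obtain ⟨c', hc'⟩ := (h.fixed c).1 (by grind)
  obtain ⟨d', hd⟩ := (h.fixed d).1 (by grind)
  have hdet' : a' * d' - b' * c' = 1 := j.injective (by
    rw [map_sub, map_mul, map_mul, ha, hb, hc', hd, hdet, map_one])
  refine Subgroup.mem_sup_right ⟨SL2.mk a' b' c' d' hdet', h.injective ?_⟩
  rw [h.right, ew, ← ha, ← hb, ← hc', ← hd]
  rfl

end IsUnitary

theorem exists_col_ne_zero {G K : Type*} [Group G] [Field K] {n : ℕ}
    {ρ : G →* Matrix (Fin n) (Fin n) K} (x : G) (k : Fin n) : ∃ i, ρ x i k ≠ 0 := by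
  by_contra! h0
  have := congrFun (congrFun (inv_mul_apply (ρ := ρ) x) k) k
  simp [Matrix.mul_apply, h0] at this

theorem mem_triangular_four {G K : Type*} [Group G] [Field K]
    {ρ : G →* Matrix (Fin 4) (Fin 4) K} {x : G} (h10 : ρ x 1 0 = 0) (h20 : ρ x 2 0 = 0)
    (h30 : ρ x 3 0 = 0) (h21 : ρ x 2 1 = 0) (h31 : ρ x 3 1 = 0) (h32 : ρ x 3 2 = 0) :
    x ∈ triangular ρ := by
  rw [mem_triangular]
  intro i j hij
  fin_cases i <;> fin_cases j <;> first | exact absurd hij (by decide) | assumption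

namespace IsUnitary

section Basic

variable {G : Type*} [Group G] {K F : Type*} [Field K] [Field F] {σ : K →+* K} {j : F →+* K}
  {ρ : G →* Matrix (Fin 4) (Fin 4) K} {ι₁ : SL2 K →* G} {ι₂ : SL2 F →* G}
  (h : IsUnitary σ j ρ ι₁ ι₂)

include h

theorem injective_left : Function.Injective ι₁ := by
  intro x y hxy
  have h1 : ρ (ι₁ x) = ρ (ι₁ y) := by rw [hxy]
  rw [h.left, h.left] at h1
  ext i k
  have h00 := congrFun (congrFun h1 0) 0
  have h01 := congrFun (congrFun h1 0) 1
  have h10 := congrFun (congrFun h1 1) 0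
  have h11 := congrFun (congrFun h1 1) 1
  fin_cases i <;> fin_cases k <;> assumption

theorem injective_right : Function.Injective ι₂ := by
  intro x y hxy
  have h1 : ρ (ι₂ x) = ρ (ι₂ y) := by rw [hxy]
  rw [h.right, h.right] at h1
  ext i k
  refine j.injective ?_
  have h00 := congrFun (congrFun h1 1) 1
  have h01 := congrFun (congrFun h1 1) 2
  have h10 := congrFun (congrFun h1 2) 1
  have h11 := congrFun (congrFun h1 2) 2
  fin_cases i <;> fin_cases k <;> assumption

theorem upper_left_mem (t : K) : ι₁ (SL2.upper t) ∈ unitriangular ρ := by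
  refine ⟨mem_triangular_four ?_ ?_ ?_ ?_ ?_ ?_, fun i => ?_⟩ <;> rw [h.rho_upper_left]
  on_goal 7 => fin_cases i
  all_goals rfl

theorem upper_right_mem (t : F) : ι₂ (SL2.upper t) ∈ unitriangular ρ := by
  refine ⟨mem_triangular_four ?_ ?_ ?_ ?_ ?_ ?_, fun i => ?_⟩ <;> rw [h.rho_upper_right]
  on_goal 7 => fin_cases i
  all_goals rfl

theorem long_mem (t : F) :
    ι₁ SL2.weyl * ι₂ (SL2.upper t) * ι₁ SL2.weyl⁻¹ ∈ unitriangular ρ := by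
  refine ⟨mem_triangular_four ?_ ?_ ?_ ?_ ?_ ?_, fun i => ?_⟩ <;> rw [h.rho_long]
  on_goal 7 => fin_cases i
  all_goals rfl

theorem commute_upper_lower (s : K) (t : F) :
    Commute (ι₁ (SL2.upper s)) (ι₂ (SL2.lower t)) := by
  refine h.injective ?_
  rw [map_mul, map_mul, h.rho_upper_left, h.rho_lower_right]
  ext i k
  fin_cases i <;> fin_cases k <;> simp [Matrix.mul_apply, Fin.sum_univ_four]

/-- An isometry that stabilizes `⟨e₀⟩` and `⟨e₀, e₁⟩` stabilizes `⟨e₀⟩ᗮ` as well. -/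
theorem mem_triangular_of_apply_eq_zero {x : G} (h10 : ρ x 1 0 = 0) (h20 : ρ x 2 0 = 0)
    (h30 : ρ x 3 0 = 0) (h21 : ρ x 2 1 = 0) : x ∈ triangular ρ := by
  have h00 : σ (ρ x 0 0) ≠ 0 := by
    obtain ⟨i, hi⟩ := exists_col_ne_zero (ρ := ρ) x 0
    rw [map_ne_zero]
    fin_cases i
    exacts [hi, absurd h10 hi, absurd h20 hi, absurd h30 hi]
  have h1 := h.form_col x 1 0
  have h2 := h.form_col x 2 0
  simp [h10, h20, h30, h00, gram] at h1 h2
  exact mem_triangular_four h10 h20 h30 h21 h1 h2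

theorem mem_triangular_contra_of_apply_eq_zero {x : G} (h03 : ρ x 0 3 = 0) (h13 : ρ x 1 3 = 0)
    (h23 : ρ x 2 3 = 0) (h12 : ρ x 1 2 = 0) : x ∈ triangular (MatrixRep.contra ρ) := by
  have h33 : σ (ρ x 3 3) ≠ 0 := by
    obtain ⟨i, hi⟩ := exists_col_ne_zero (ρ := ρ) x 3
    rw [map_ne_zero]
    fin_cases i
    exacts [absurd h03 hi, absurd h13 hi, absurd h23 hi, hi]
  have h1 := h.form_col x 1 3
  have h2 := h.form_col x 2 3
  simp [h03, h13, h23, h33, gram] at h1 h2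
  rw [← (triangular (MatrixRep.contra ρ)).inv_mem_iff]
  refine mem_triangular_four ?_ ?_ ?_ ?_ ?_ ?_ <;>
    rwa [contra_apply, inv_inv, Matrix.transpose_apply]

theorem normalizer_unitriangular_le :
    Subgroup.normalizer (unitriangular ρ : Set G) ≤ triangular ρ := by
  intro x hx
  have key : ∀ u ∈ unitriangular ρ, ∃ u' ∈ unitriangular ρ, ρ u * ρ x = ρ x * ρ u' := by
    intro u hu
    refine ⟨x⁻¹ * u * x, ?_, by simp [← map_mul, mul_assoc]⟩
    have := (Subgroup.mem_normalizer_iff.1 (Subgroup.inv_mem _ hx) u).1 hu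
    simpa using this
  have col : ∀ u ∈ unitriangular ρ, ∀ i, (ρ u * ρ x) i 0 = ρ x i 0 := by
    intro u hu i
    obtain ⟨u', hu', e⟩ := key u hu
    have h1 := mem_triangular.1 hu'.1 1 0 (by decide)
    have h2 := mem_triangular.1 hu'.1 2 0 (by decide)
    have h3 := mem_triangular.1 hu'.1 3 0 (by decide)
    rw [e, Matrix.mul_apply, Fin.sum_univ_four, hu'.2, h1, h2, h3]
    ring
  have h30 := col _ (h.long_mem 1) 0
  have h20 := col _ (h.upper_right_mem 1) 1
  have h10 := col _ (h.upper_left_mem 1) 0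
  rw [Matrix.mul_apply, Fin.sum_univ_four, h.rho_long] at h30
  rw [Matrix.mul_apply, Fin.sum_univ_four, h.rho_upper_right] at h20
  rw [Matrix.mul_apply, Fin.sum_univ_four, h.rho_upper_left] at h10
  simp at h10 h20 h30
  obtain ⟨u', hu', e⟩ := key _ (h.upper_right_mem 1)
  have h21 := congrFun (congrFun e 1) 1
  rw [Matrix.mul_apply, Matrix.mul_apply, Fin.sum_univ_four, Fin.sum_univ_four,
    h.rho_upper_right, hu'.2, h10, mem_triangular.1 hu'.1 2 1 (by decide),
    mem_triangular.1 hu'.1 3 1 (by decide)] at h21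
  simp at h21
  exact h.mem_triangular_of_apply_eq_zero h10 h20 h30 h21

omit h in
/-- The elements of the unipotent radical of the stabilizer of the isotropic point `⟨v⟩`: those
acting trivially on `⟨v⟩` and on `⟨v⟩ᗮ / ⟨v⟩`. -/
def _root_.MatrixRep.IsRadical (σ : K →+* K) (ρ : G →* Matrix (Fin 4) (Fin 4) K) (v : Fin 4 → K)
    (x : G) : Prop :=
  ρ x *ᵥ v = v ∧ ∀ w, form σ w v = 0 → ∃ c : K, ρ x *ᵥ w = w + c • v

theorem isRadical_conj {v : Fin 4 → K} {x : G} (hx : IsRadical σ ρ v x) (y : G) :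
    IsRadical σ ρ (ρ y *ᵥ v) (y * x * y⁻¹) := by
  have e : ∀ w, ρ (y * x * y⁻¹) *ᵥ w = ρ y *ᵥ (ρ x *ᵥ (ρ y⁻¹ *ᵥ w)) := fun w => by
    rw [Matrix.mulVec_mulVec, Matrix.mulVec_mulVec, ← map_mul, ← map_mul]
  refine ⟨?_, fun w hw => ?_⟩
  · rw [e, Matrix.mulVec_mulVec (M := ρ y⁻¹), inv_mul_apply, Matrix.one_mulVec, hx.1]
  · obtain ⟨c, hc⟩ := hx.2 (ρ y⁻¹ *ᵥ w) (by
      rwa [← h.form_mulVec y, Matrix.mulVec_mulVec, mul_apply_inv, Matrix.one_mulVec])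
    exact ⟨c, by rw [e, hc, Matrix.mulVec_add, Matrix.mulVec_mulVec, mul_apply_inv,
      Matrix.one_mulVec, Matrix.mulVec_smul]⟩

omit h in
theorem _root_.MatrixRep.IsRadical.of_smul {v : Fin 4 → K} {x : G} {k : K} (hk : k ≠ 0)
    (hx : IsRadical σ ρ (k • v) x) : IsRadical σ ρ v x := by
  refine ⟨?_, fun w hw => ?_⟩
  · have h1 := hx.1
    rw [Matrix.mulVec_smul] at h1
    simpa [hk] using congrArg (k⁻¹ • ·) h1
  · obtain ⟨c, hc⟩ := hx.2 w (by
      have : form σ w (k • v) = form σ w v * σ k := by simp [form]; ring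
      rw [this, hw, zero_mul])
    exact ⟨c * k, by rw [hc, smul_smul]⟩

theorem isRadical_mem {x : G} (hx : IsRadical σ ρ ![1, 0, 0, 0] x) : x ∈ unitriangular ρ := by
  have c0 : ∀ i, ρ x i 0 = (![1, 0, 0, 0] : Fin 4 → K) i := fun i => by
    have := congrFun hx.1 i
    rw [mulVec_apply_four] at this
    simpa using this
  obtain ⟨a, ha⟩ := hx.2 ![0, 1, 0, 0] (by simp [form])
  have c1 : ∀ i, ρ x i 1 = (![a, 1, 0, 0] : Fin 4 → K) i := fun i => by
    have := congrFun ha i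
    rw [mulVec_apply_four] at this
    fin_cases i <;> simpa using this
  obtain ⟨b, hb⟩ := hx.2 ![0, 0, 1, 0] (by simp [form])
  have c2 : ∀ i, ρ x i 2 = (![b, 0, 1, 0] : Fin 4 → K) i := fun i => by
    have := congrFun hb i
    rw [mulVec_apply_four] at this
    fin_cases i <;> simpa using this
  refine ⟨mem_triangular_four (c0 1) (c0 2) (c0 3) (c1 2) (c1 3) (c2 3), fun i => ?_⟩
  fin_cases i
  · exact c0 0
  · exact c1 1
  · exact c2 2
  · have := h.form_col x 0 3
    simp [c0, gram] at this
    exact σ.injective (by rw [map_one]; exact this)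

/-- A proper subgroup that contains the unitriangular matrices moves the point `⟨e₀⟩` only to
points that are orthogonal to it. -/
theorem eq_top_of_unitriangular_le {P : Subgroup G} (hP : unitriangular ρ ≤ P) {x : G}
    (hx : x ∈ P) (hx0 : ρ x 3 0 ≠ 0) : P = ⊤ := by
  set k := ρ x 3 0 with hk
  have hk' : σ k ≠ 0 := (map_ne_zero σ).2 hx0
  obtain ⟨r, -, er⟩ := h.exists_radical (α := ρ x 0 0 / k) (β := ρ x 1 0 / k)
    (γ := ρ x 2 0 / k) (by
      have := h.form_col x 0 0
      simp [gram] at this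
      rw [← hk] at this
      simp only [map_div₀]
      field_simp
      linear_combination this)
  have hr : r ∈ unitriangular ρ := by
    refine ⟨mem_triangular_four ?_ ?_ ?_ ?_ ?_ ?_, fun i => ?_⟩ <;> rw [er]
    on_goal 7 => fin_cases i
    all_goals rfl
  -- `y` maps `e₀` to a multiple of `e₃`.
  set y := r⁻¹ * x with hy
  have hyP : y ∈ P := P.mul_mem (P.inv_mem (hP hr)) hx
  have ey : ρ y⁻¹ *ᵥ ![0, 0, 0, k] = ![1, 0, 0, 0] := by
    have e1 : ρ r *ᵥ ![0, 0, 0, k] = ρ x *ᵥ ![1, 0, 0, 0] := by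
      ext i
      rw [mulVec_apply_four, mulVec_apply_four, er]
      fin_cases i <;> simp
      exacts [div_mul_cancel₀ _ hx0, div_mul_cancel₀ _ hx0, div_mul_cancel₀ _ hx0, hk]
    have e2 : y⁻¹ = x⁻¹ * r := by rw [hy, mul_inv_rev, inv_inv]
    rw [e2, map_mul, ← Matrix.mulVec_mulVec, e1, Matrix.mulVec_mulVec, inv_mul_apply,
      Matrix.one_mulVec]
  have mem : ∀ z, IsRadical σ ρ ![0, 0, 0, 1] z → z ∈ P := by
    intro z hz
    have e3 : (![0, 0, 0, 1] : Fin 4 → K) = k⁻¹ • ![0, 0, 0, k] := by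
      ext i; fin_cases i <;> simp [hx0]
    rw [e3] at hz
    have h1 := h.isRadical_conj (hz.of_smul (inv_ne_zero hx0)) y⁻¹
    rw [ey] at h1
    have h2 := P.mul_mem (P.mul_mem hyP (hP (h.isRadical_mem h1))) (P.inv_mem hyP)
    simpa [mul_assoc] using h2
  have h1 : ι₁.range ≤ P := by
    refine SL2.range_le_of_root_mem (fun t => hP (h.upper_left_mem t)) fun t => mem _ ⟨?_, ?_⟩
    · rw [h.rho_lower_left]
      ext i
      rw [mulVec_apply_four]
      fin_cases i <;> simp
    · intro w hw
      have hw0 : w 0 = 0 := by simpa [form] using hw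
      refine ⟨-σ t * w 2, ?_⟩
      rw [h.rho_lower_left]
      ext i
      rw [mulVec_apply_four]
      fin_cases i <;> simp [hw0]
      ring
  have h2 : ι₂.range ≤ P := by
    refine SL2.range_le_of_root_mem (fun t => hP (h.upper_right_mem t)) fun t => ?_
    have h3 : ι₁ SL2.weyl⁻¹ * ι₂ (SL2.lower t) * ι₁ SL2.weyl ∈ P := by
      have e : ρ (ι₁ SL2.weyl⁻¹ * ι₂ (SL2.lower t) * ι₁ SL2.weyl) =
          !![1, 0, 0, 0; 0, 1, 0, 0; 0, 0, 1, 0; j t, 0, 0, 1] := by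
        rw [map_mul, map_mul, h.rho_weyl_left, h.rho_weyl_inv_left, h.rho_lower_right]
        ext i k
        fin_cases i <;> fin_cases k <;> simp [Matrix.mul_apply, Fin.sum_univ_four]
      refine mem _ ⟨?_, fun w hw => ⟨0, ?_⟩⟩
      · rw [e]
        ext i
        rw [mulVec_apply_four]
        fin_cases i <;> simp
      · have hw0 : w 0 = 0 := by simpa [form] using hw
        rw [e]
        ext i
        rw [mulVec_apply_four]
        fin_cases i <;> simp [hw0]
    have h4 := P.mul_mem (P.mul_mem (h1 ⟨SL2.weyl, rfl⟩) h3) (h1 ⟨SL2.weyl⁻¹, rfl⟩)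
    simpa [mul_assoc] using h4
  exact top_le_iff.1 (h.sup_eq_top ▸ sup_le h1 h2)

end Basic
end IsUnitary
namespace IsUnitary

section Commutator

variable {G : Type*} [Group G] {K F : Type*} [Field K] [Field F] {σ : K →+* K} {j : F →+* K}
  {ρ : G →* Matrix (Fin 4) (Fin 4) K} {ι₁ : SL2 K →* G} {ι₂ : SL2 F →* G}
  (h : IsUnitary σ j ρ ι₁ ι₂)

include h

/-- The commutator formula for the two positive simple root groups. -/
theorem commutator_eq (t : K) (u a : F) (ha : j a = t * σ t * j u) :
    ⁅ι₁ (SL2.upper t), ι₂ (SL2.upper u)⁆ =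
      (ι₂ SL2.weyl * ι₁ (SL2.upper (t * j u)) * ι₂ SL2.weyl⁻¹) *
      (ι₁ SL2.weyl * ι₂ (SL2.upper a) * ι₁ SL2.weyl⁻¹) := by
  rw [commutatorElement_def, mul_inv_eq_iff_eq_mul, mul_inv_eq_iff_eq_mul]
  refine h.injective ?_
  rw [map_mul ρ, map_mul ρ, map_mul ρ, map_mul ρ (_ * _ * _), h.rho_short, h.rho_long,
    h.rho_upper_left, h.rho_upper_right, ha]
  ext i k
  fin_cases i <;> fin_cases k <;>
    simp [Matrix.mul_apply, Fin.sum_univ_four, h.sigma_j] <;> ring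

/-- By the commutator formula, a normal subgroup containing the short root groups contains the
long ones. -/
theorem eq_top_of_range_left_le {N : Subgroup G} (hN : N.Normal) (hle : ι₁.range ≤ N) :
    N = ⊤ := by
  have h1 : ∀ y, ι₁ y ∈ N := fun y => hle ⟨y, rfl⟩
  have h2 : ι₂.range ≤ N := by
    refine SL2.range_le_of_upper_mem hN fun a => ?_
    suffices hl : ι₁ SL2.weyl * ι₂ (SL2.upper a) * ι₁ SL2.weyl⁻¹ ∈ N by
      have := N.mul_mem (N.mul_mem (h1 SL2.weyl⁻¹) hl) (h1 SL2.weyl)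
      simpa [mul_assoc] using this
    have e := h.commutator_eq 1 a a (by simp)
    have hc : ⁅ι₁ (SL2.upper 1), ι₂ (SL2.upper a)⁆ ∈ N := by
      have := N.mul_mem (h1 (SL2.upper 1)) (hN.conj_mem _ (N.inv_mem (h1 (SL2.upper 1)))
        (ι₂ (SL2.upper a)))
      simpa [commutatorElement_def, mul_assoc] using this
    rw [e] at hc
    refine (Subgroup.mul_mem_cancel_left N ?_).1 hc
    rw [map_inv]
    exact hN.conj_mem _ (h1 _) _
  exact top_le_iff.1 (h.sup_eq_top ▸ sup_le hle h2)

/-- By the commutator formula, a normal subgroup containing the long root groups contains the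
short ones. -/
theorem eq_top_of_range_right_le {N : Subgroup G} (hN : N.Normal) (hle : ι₂.range ≤ N) :
    N = ⊤ := by
  have h2 : ∀ y, ι₂ y ∈ N := fun y => hle ⟨y, rfl⟩
  have h1 : ι₁.range ≤ N := by
    refine SL2.range_le_of_upper_mem hN fun t => ?_
    obtain ⟨a, ha⟩ := (h.fixed (t * σ t)).1 (by rw [map_mul, h.involutive, mul_comm])
    have e := h.commutator_eq t 1 a (by rw [ha, map_one, mul_one])
    have hc : ⁅ι₁ (SL2.upper t), ι₂ (SL2.upper 1)⁆ ∈ N :=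
      N.mul_mem (hN.conj_mem _ (h2 _) _) (N.inv_mem (h2 _))
    rw [e] at hc
    have hs := (Subgroup.mul_mem_cancel_right N (by
      rw [map_inv]
      exact hN.conj_mem _ (h2 _) _)).1 hc
    rw [map_one, mul_one] at hs
    have := N.mul_mem (N.mul_mem (h2 SL2.weyl⁻¹) hs) (h2 SL2.weyl)
    simpa [mul_assoc] using this
  exact top_le_iff.1 (h.sup_eq_top ▸ sup_le h1 hle)

theorem rho_commutator : ρ ⁅ι₁ (SL2.upper 1), ι₂ (SL2.upper 1)⁆ =
    !![1, 0, 1, 1; 0, 1, 0, 1; 0, 0, 1, 0; 0, 0, 0, 1] := by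
  rw [h.commutator_eq 1 1 1 (by simp), map_mul, h.rho_short, h.rho_long]
  ext i k
  fin_cases i <;> fin_cases k <;> simp [Matrix.mul_apply, Fin.sum_univ_four]

/-- The commutator of the simple root groups and its conjugates by Weyl group elements generate
an element of the product of a positive and a negative root group of `G₂`. -/
theorem exists_right_of_commutator_mem {N : Subgroup G} (hN : N.Normal)
    (hmem : ∀ x ∈ SL2.root ι₁, ∀ g ∈ ι₂.range, ⁅x, g⁆ ∈ N) : ∃ g ∈ ι₂.range, g ∈ N ∧ g ≠ 1 := by
  have h1 := hmem _ (SL2.mem_root.2 ⟨1, rfl⟩) (ι₂ (SL2.upper 1)) ⟨_, rfl⟩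
  have e1 := h.rho_commutator
  generalize ⁅ι₁ (SL2.upper 1), ι₂ (SL2.upper 1)⁆ = n at h1 e1
  have h2 := N.mul_mem h1 (hN.conj_mem _ h1 (ι₁ SL2.weyl))
  have e2 : ρ (n * (ι₁ SL2.weyl * n * (ι₁ SL2.weyl)⁻¹)) =
      !![1, 0, 0, 1; 0, 1, 1, 0; 0, 0, 1, 0; 0, 0, 0, 1] := by
    rw [← map_inv, map_mul, map_mul, map_mul, h.rho_weyl_left, h.rho_weyl_inv_left, e1]
    ext i k
    fin_cases i <;> fin_cases k <;> simp [Matrix.mul_apply, Fin.sum_univ_four]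
  generalize n * (ι₁ SL2.weyl * n * (ι₁ SL2.weyl)⁻¹) = m at h2 e2
  have h3 := hN.conj_mem _ h2 (ι₂ SL2.weyl)
  have e3 : ρ m = ρ (ι₂ SL2.weyl * m * (ι₂ SL2.weyl)⁻¹ * ι₂ (SL2.lower 1 * SL2.upper 1)) := by
    rw [map_mul ι₂, ← map_inv, map_mul, map_mul, map_mul, map_mul, h.rho_weyl_right,
      h.rho_weyl_inv_right, h.rho_lower_right, h.rho_upper_right, e2]
    ext i k
    fin_cases i <;> fin_cases k <;> simp [Matrix.mul_apply, Fin.sum_univ_four]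
  have h4 : ι₂ (SL2.lower 1 * SL2.upper 1) ∈ N :=
    (Subgroup.mul_mem_cancel_left N h3).1 (h.injective e3 ▸ h2)
  refine ⟨_, ⟨_, rfl⟩, h4, fun h5 => ?_⟩
  have h6 := h.injective_right (h5.trans (map_one _).symm)
  simpa using congrFun (congrFun (congrArg Subtype.val h6) 1) 0

/-- As for `exists_right_of_commutator_mem`, with an additional commutator of the long root group
and a Weyl group element of `G₁`. -/
theorem exists_left_of_commutator_mem {N : Subgroup G} (hN : N.Normal)
    (hmem : ∀ x ∈ SL2.root ι₂, ∀ g ∈ ι₁.range, ⁅x, g⁆ ∈ N) : ∃ g ∈ ι₁.range, g ∈ N ∧ g ≠ 1 := by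
  have h1 : ⁅ι₁ (SL2.upper 1), ι₂ (SL2.upper 1)⁆ ∈ N := by
    rw [← commutatorElement_inv]
    exact N.inv_mem (hmem _ (SL2.mem_root.2 ⟨1, rfl⟩) _ ⟨_, rfl⟩)
  have e1 := h.rho_commutator
  generalize ⁅ι₁ (SL2.upper 1), ι₂ (SL2.upper 1)⁆ = n at h1 e1
  have h2 := hmem _ (SL2.mem_root.2 ⟨1, rfl⟩) (ι₁ SL2.weyl) ⟨_, rfl⟩
  have e2 : ρ ⁅ι₂ (SL2.upper 1), ι₁ SL2.weyl⁆ =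
      !![1, 0, 0, -1; 0, 1, 1, 0; 0, 0, 1, 0; 0, 0, 0, 1] := by
    rw [commutatorElement_def, ← map_inv, ← map_inv, map_mul, map_mul, map_mul, SL2.upper_inv,
      h.rho_weyl_left, h.rho_weyl_inv_left, h.rho_upper_right, h.rho_upper_right]
    ext i k
    fin_cases i <;> fin_cases k <;> simp [Matrix.mul_apply, Fin.sum_univ_four]
  generalize ⁅ι₂ (SL2.upper 1), ι₁ SL2.weyl⁆ = m at h2 e2
  have h3 := hN.conj_mem _ h1 (ι₂ SL2.weyl)
  have e3 : ρ (ι₂ SL2.weyl * n * (ι₂ SL2.weyl)⁻¹) =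
      !![1, -1, 0, 1; 0, 1, 0, 0; 0, 0, 1, 1; 0, 0, 0, 1] := by
    rw [← map_inv, map_mul, map_mul, h.rho_weyl_right, h.rho_weyl_inv_right, e1]
    ext i k
    fin_cases i <;> fin_cases k <;> simp [Matrix.mul_apply, Fin.sum_univ_four]
  generalize ι₂ SL2.weyl * n * (ι₂ SL2.weyl)⁻¹ = m₁ at h3 e3
  have h4 := hN.conj_mem _ h3 (ι₁ SL2.weyl)
  have e4 : ρ (ι₁ SL2.weyl * m₁ * (ι₁ SL2.weyl)⁻¹) =
      !![1, 0, 0, 0; 1, 1, 1, 0; 0, 0, 1, 0; 0, 0, -1, 1] := by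
    rw [← map_inv, map_mul, map_mul, h.rho_weyl_left, h.rho_weyl_inv_left, e3]
    ext i k
    fin_cases i <;> fin_cases k <;> simp [Matrix.mul_apply, Fin.sum_univ_four]
  generalize ι₁ SL2.weyl * m₁ * (ι₁ SL2.weyl)⁻¹ = m₂ at h4 e4
  have e5 : ρ (m₁ * m) = ρ (ι₁ (SL2.upper (-1) * SL2.lower (-1)) * m₂) := by
    rw [map_mul ι₁, map_mul, map_mul, map_mul, h.rho_lower_left, h.rho_upper_left, e2, e3, e4]
    ext i k
    fin_cases i <;> fin_cases k <;> simp [Matrix.mul_apply, Fin.sum_univ_four]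
  have h5 : ι₁ (SL2.upper (-1) * SL2.lower (-1)) ∈ N :=
    (Subgroup.mul_mem_cancel_right N h4).1 (h.injective e5 ▸ N.mul_mem h3 h2)
  refine ⟨_, ⟨_, rfl⟩, h5, fun h6 => ?_⟩
  have h7 := h.injective_left (h6.trans (map_one _).symm)
  simpa using congrFun (congrFun (congrArg Subtype.val h7) 1) 0

end Commutator

section Sylow

variable {p : ℕ} [Fact p.Prime] {G : Type*} [Group G] {K F : Type*} [Field K] [Field F]
  [CharP K p] [Finite K] {σ : K →+* K} {j : F →+* K}
  {ρ : G →* Matrix (Fin 4) (Fin 4) K} {ι₁ : SL2 K →* G} {ι₂ : SL2 F →* G}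
  (h : IsUnitary σ j ρ ι₁ ι₂)

include h

omit [Finite K] in
theorem unique_left {Y : Subgroup G} (hY : Y ≤ ι₁.range) (hp : IsPGroup p Y)
    (hle : Y ≤ triangular ρ) : Y ≤ SL2.root ι₁ := by
  intro x hx
  have hx2 := le_unitriangular hp hle hx
  obtain ⟨y, rfl⟩ := hY hx
  refine SL2.mem_root.2 ⟨y.1 0 1, congrArg ι₁ (Subtype.ext ?_)⟩
  have h1 := mem_triangular.1 hx2.1 1 0 (by decide)
  have h2 := hx2.2 0
  have h3 := hx2.2 1
  rw [h.left] at h1 h2 h3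
  ext i k
  fin_cases i <;> fin_cases k <;> simp_all

omit [Finite K] in
theorem unique_right {Y : Subgroup G} (hY : Y ≤ ι₂.range) (hp : IsPGroup p Y)
    (hle : Y ≤ triangular ρ) : Y ≤ SL2.root ι₂ := by
  intro x hx
  have hx2 := le_unitriangular hp hle hx
  obtain ⟨y, rfl⟩ := hY hx
  refine SL2.mem_root.2 ⟨y.1 0 1, congrArg ι₂ (Subtype.ext ?_)⟩
  have h1 := mem_triangular.1 hx2.1 2 1 (by decide)
  have h2 := hx2.2 1
  have h3 := hx2.2 2
  rw [h.right] at h1 h2 h3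
  have h2' : y.1 0 0 = 1 := j.injective (h2.trans (map_one j).symm)
  have h3' : y.1 1 1 = 1 := j.injective (h3.trans (map_one j).symm)
  have h1' : y.1 1 0 = 0 := j.injective (h1.trans (map_zero j).symm)
  ext i k
  fin_cases i <;> fin_cases k <;> simp_all

omit [Finite K] in
theorem exists_sylow [Finite G] :
    ∃ S : Sylow p G, (S : Subgroup G) = unitriangular ρ ∧
      Subgroup.normalizer ((S : Subgroup G) : Set G) = triangular ρ := by
  obtain ⟨S, hS⟩ := exists_sylow_unitriangular (p := p) h.injective h.normalizer_unitriangular_le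
  exact ⟨S, hS, normalizer_eq_triangular hS h.normalizer_unitriangular_le⟩

omit [Fact p.Prime] [CharP K p] in
theorem finite : Finite G := Finite.of_injective ρ h.injective

theorem isAdapted : IsAdapted p ι₁.range ι₂.range (triangular ρ) := by
  have := h.finite
  obtain ⟨S, -, hS⟩ := h.exists_sylow (p := p)
  have hB : IsBorel p (triangular ρ) := ⟨S, hS.symm⟩
  have hmono : ∀ b : Fin 4 → ℕ, (∀ i k, b k < b i → k < i) →
      triangular ρ ≤ blockTriangular ρ b := fun b hb x hx =>
    mem_blockTriangular.2 fun i k hik => mem_triangular.1 hx i k (hb i k hik)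
  refine ⟨blockTriangular ρ ![0, 0, 1, 1], blockTriangular ρ ![0, 1, 1, 2],
    ⟨?_, _, hB, hmono _ (by decide)⟩, ⟨?_, _, hB, hmono _ (by decide)⟩, ?_, ?_, ?_⟩
  · intro h1
    have h2 := mem_blockTriangular.1 (h1 ▸ Subgroup.mem_top (ι₂ (SL2.lower 1))) 2 1 (by simp)
    rw [h.rho_lower_right] at h2
    simp at h2
  · intro h1
    have h2 := mem_blockTriangular.1 (h1 ▸ Subgroup.mem_top (ι₁ (SL2.lower 1))) 1 0 (by simp)
    rw [h.rho_lower_left] at h2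
    simp at h2
  · rintro _ ⟨y, rfl⟩
    rw [mem_blockTriangular]
    intro i k hik
    rw [h.left]
    fin_cases i <;> fin_cases k <;> first | rfl | exact absurd hik (by decide)
  · rintro _ ⟨y, rfl⟩
    rw [mem_blockTriangular]
    intro i k hik
    rw [h.right]
    fin_cases i <;> fin_cases k <;> first | rfl | exact absurd hik (by decide)
  · refine le_antisymm (le_inf (hmono _ (by decide)) (hmono _ (by decide))) ?_
    intro x hx
    have h1 := mem_blockTriangular.1 hx.1
    have h2 := mem_blockTriangular.1 hx.2
    exact mem_triangular_four (h2 1 0 (by decide)) (h2 2 0 (by decide)) (h2 3 0 (by decide))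
      (h1 2 1 (by decide)) (h1 3 1 (by decide)) (h2 3 2 (by decide))

theorem isChamber :
    IsChamber p ι₁.range ι₂.range (triangular ρ) (SL2.root ι₁) (SL2.root ι₂) where
  borel := by
    have := h.finite
    obtain ⟨S, -, hS⟩ := h.exists_sylow (p := p)
    exact ⟨S, hS.symm⟩
  adapted := h.isAdapted
  sylow_left := SL2.isSylowIn_root h.injective_left
  sylow_right := by
    have := j.charP j.injective p
    have := Finite.of_injective j j.injective
    exact SL2.isSylowIn_root h.injective_right
  le_left x hx := by
    obtain ⟨t, rfl⟩ := SL2.mem_root.1 hx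
    exact (h.upper_left_mem t).1
  le_right x hx := by
    obtain ⟨t, rfl⟩ := SL2.mem_root.1 hx
    exact (h.upper_right_mem t).1
  unique_left Y hY hp hle := h.unique_left hY hp hle
  unique_right Y hY hp hle := h.unique_right hY hp hle
  ne_bot_left := SL2.root_ne_bot h.injective_left
  ne_bot_right := SL2.root_ne_bot h.injective_right
  exists_left N hN hmem := h.exists_right_of_commutator_mem hN hmem
  exists_right N hN hmem := h.exists_left_of_commutator_mem hN hmem

/-- If the Borel subgroup of a flag with point `⟨v⟩` is the intersection of a proper subgroup
containing `G₁` and one containing `G₂`, then both move `⟨v⟩` within `⟨v⟩ᗮ`. This leaves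
`⟨e₀⟩` and `⟨e₃⟩` for `⟨v⟩`, and then determines the flag. -/
theorem eq_or_eq_of_isAdapted {C : Subgroup G} (hC : IsBorel p C)
    (hA : IsAdapted p ι₁.range ι₂.range C) :
    C = triangular ρ ∨ C = triangular (MatrixRep.contra ρ) := by
  have := h.finite
  obtain ⟨S, hS, hSN⟩ := h.exists_sylow (p := p)
  obtain ⟨S', hS', hSN'⟩ := h.contra.exists_sylow (p := p)
  obtain ⟨T, rfl⟩ := hC
  obtain ⟨g, hg⟩ := Sylow.exists_conj S T
  obtain ⟨P, Q, hP, hQ, h1P, h2Q, hPQ⟩ := hA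
  have hle : (T : Subgroup G) ≤ P ⊓ Q := hPQ ▸ Subgroup.le_normalizer
  obtain ⟨v, hv⟩ : ∃ v, v = ρ g *ᵥ ![1, 0, 0, 0] := ⟨_, rfl⟩
  have hv0 : ρ g⁻¹ *ᵥ v = ![1, 0, 0, 0] := by
    rw [hv, Matrix.mulVec_mulVec, inv_mul_apply, Matrix.one_mulVec]
  have orth : ∀ R : Subgroup G, R ≠ ⊤ → (T : Subgroup G) ≤ R → ∀ x ∈ R,
      form σ v (ρ x *ᵥ v) = 0 := by
    intro R hR hTR x hx
    by_contra hne
    refine hR ?_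
    have h1 := h.eq_top_of_unitriangular_le (P := R.comap (MulAut.conj g).toMonoidHom)
      (fun x hx => hTR ((hg _).2 ⟨x, hS ▸ hx, rfl⟩)) (x := g⁻¹ * x * g)
      (by simpa [Subgroup.mem_comap, mul_assoc] using hx) (fun h0 => hne ?_)
    · refine top_le_iff.1 fun x _ => ?_
      have := h1 ▸ Subgroup.mem_top (g⁻¹ * x * g)
      simpa [Subgroup.mem_comap, mul_assoc] using this
    · have e : ρ g⁻¹ *ᵥ (ρ x *ᵥ v) = ρ (g⁻¹ * x * g) *ᵥ ![1, 0, 0, 0] := by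
        rw [hv, map_mul, map_mul, Matrix.mulVec_mulVec, Matrix.mulVec_mulVec, Matrix.mul_assoc]
      rw [← h.form_mulVec g⁻¹, e, hv0, form, mulVec_apply_four (i := 3), h0]
      simp
  have hP' := orth P hP.1 (hle.trans inf_le_left)
  have hQ' := orth Q hQ.1 (hle.trans inf_le_right)
  have hTv : ∀ x ∈ (T : Subgroup G), ρ x *ᵥ v = v := by
    intro x hx
    obtain ⟨u, hu, rfl⟩ := (hg x).1 hx
    rw [hS] at hu
    have e : ρ u *ᵥ ![1, 0, 0, 0] = ![1, 0, 0, 0] := by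
      ext i
      rw [mulVec_apply_four]
      fin_cases i
      · simp [hu.2]
      · simp [mem_triangular.1 hu.1 1 0 (by decide)]
      · simp [mem_triangular.1 hu.1 2 0 (by decide)]
      · simp [mem_triangular.1 hu.1 3 0 (by decide)]
    rw [map_mul, map_mul, ← Matrix.mulVec_mulVec, hv0, ← Matrix.mulVec_mulVec, e, hv]
  have hvne : v ≠ 0 := by
    intro h0
    rw [h0, Matrix.mulVec_zero] at hv0
    simpa using congrFun hv0 0
  have hiso : form σ v v = 0 := by
    rw [hv, h.form_mulVec]
    simp [form]
  have v2 : v 2 = 0 := by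
    have h1 := hQ' _ (h2Q ⟨SL2.upper 1, rfl⟩)
    rw [form] at h1 hiso
    simp only [mulVec_apply_four, h.rho_upper_right] at h1
    simp at h1
    have : v 2 * σ (v 2) = 0 := by linear_combination hiso - h1
    simpa using this
  have v1 : v 1 = 0 := by
    have h1 := hQ' _ (h2Q ⟨SL2.lower 1, rfl⟩)
    rw [form] at h1 hiso
    simp only [mulVec_apply_four, h.rho_lower_right] at h1
    simp at h1
    have : v 1 * σ (v 1) = 0 := by linear_combination h1 - hiso
    simpa using this
  have v03 : v 0 = 0 ∨ v 3 = 0 := by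
    have h1 := hP' _ (h1P ⟨SL2.mk 0 (-1) 1 1 (by ring), rfl⟩)
    rw [form] at h1
    simp only [mulVec_apply_four, h.left] at h1
    simpa [v1, v2] using h1
  have hw : ∀ x ∈ (T : Subgroup G),
      form σ (ρ (ι₁ SL2.weyl) *ᵥ v) (ρ x *ᵥ (ρ (ι₁ SL2.weyl) *ᵥ v)) = 0 := by
    intro x hx
    have h1 := hP' _ (P.mul_mem (P.mul_mem (P.inv_mem (h1P ⟨SL2.weyl, rfl⟩))
      (hle hx).1) (h1P ⟨SL2.weyl, rfl⟩))
    rw [← h.form_mulVec (ι₁ SL2.weyl)] at h1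
    rw [← h1, Matrix.mulVec_mulVec, Matrix.mulVec_mulVec, ← map_mul, ← map_mul]
    simp [mul_assoc]
  rcases v03 with v0 | v3
  · right
    have v3 : v 3 ≠ 0 := fun v3 => hvne (by ext i; fin_cases i <;> assumption)
    have e : T = S' := by
      refine sylow_eq_of_le_triangular hS' fun x hx => ?_
      have hx1 := congrFun (hTv x hx)
      simp only [mulVec_apply_four, v0, v1, v2, mul_zero, zero_add] at hx1
      have hx2 := hw x hx
      rw [form] at hx2
      simp only [mulVec_apply_four, h.rho_weyl_left] at hx2
      simp [v0, v1, v2, v3] at hx2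
      have k0 := hx1 0
      have k1 := hx1 1
      have k2 := hx1 2
      simp [v0, v1, v2, v3] at k0 k1 k2
      exact h.mem_triangular_contra_of_apply_eq_zero k0 k1 k2 hx2
    rw [e, hSN']
  · left
    have v0 : v 0 ≠ 0 := fun v0 => hvne (by ext i; fin_cases i <;> assumption)
    have e : T = S := by
      refine sylow_eq_of_le_triangular hS fun x hx => ?_
      have hx1 := congrFun (hTv x hx)
      simp only [mulVec_apply_four, v3, v1, v2, mul_zero, add_zero] at hx1
      have hx2 := hw x hx
      rw [form] at hx2
      simp only [mulVec_apply_four, h.rho_weyl_left] at hx2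
      simp [v0, v1, v2, v3] at hx2
      have k1 := hx1 1
      have k2 := hx1 2
      have k3 := hx1 3
      simp [v0, v1, v2, v3] at k1 k2 k3
      exact h.mem_triangular_of_apply_eq_zero k1 k2 k3 hx2
    rw [e, hSN]

theorem isApartment :
    IsApartment p ι₁.range ι₂.range (triangular ρ) (SL2.root ι₁) (SL2.root ι₂)
      (triangular (MatrixRep.contra ρ)) (SL2.root (ι₁.comp SL2.contra))
      (SL2.root (ι₂.comp SL2.contra)) where
  pos := h.isChamber
  neg := by
    have := h.contra.isChamber (p := p)
    rwa [SL2.range_comp_contra, SL2.range_comp_contra] at this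
  opposite := by
    have := h.finite
    obtain ⟨S, hS, hSN⟩ := h.exists_sylow (p := p)
    obtain ⟨S', hS', hSN'⟩ := h.contra.exists_sylow (p := p)
    exact ⟨S, S', hSN.symm, hSN'.symm, by rw [hS, hS', unitriangular_inf_contra h.injective]⟩
  unique C hC hA := h.eq_or_eq_of_isAdapted hC hA
  inf_left := SL2.root_inf_root_contra h.injective_left
  inf_right := SL2.root_inf_root_contra h.injective_right
  commute x hx y hy := by
    obtain ⟨s, rfl⟩ := SL2.mem_root.1 hx
    obtain ⟨t, rfl⟩ := SL2.mem_root_contra.1 hy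
    exact h.commute_upper_lower s t
  commute' x hx y hy := by
    obtain ⟨s, rfl⟩ := SL2.mem_root_contra.1 hx
    obtain ⟨t, rfl⟩ := SL2.mem_root.1 hy
    have := h.contra.commute_upper_lower (-s) (-t)
    simpa using this
  sup_eq_top := h.sup_eq_top
  normal_left N hN hle := h.eq_top_of_range_left_le hN hle
  normal_right N hN hle := h.eq_top_of_range_right_le hN hle

end Sylow
end IsUnitary
end MatrixRep

/-! ### Apartments of the standard pairs -/

namespace MatrixRep

/-- The ordering `e₁, e₂, e₄, e₃` of the basis `e₁, e₂ | e₃, e₄`. -/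
def basisEquiv : Fin 4 ≃ Fin 2 ⊕ Fin 2 where
  toFun := ![.inl 0, .inl 1, .inr 1, .inr 0]
  invFun := Sum.elim ![0, 1] ![3, 2]
  left_inv := by decide
  right_inv := by decide

/-- The group `SL₂(K)` acting on `⟨e₀, e₁⟩` and conjugate-dually on `⟨e₂, e₃⟩`. -/
def leftBlock {K : Type*} [Field K] (σ : K →+* K) : SL2 K →* Matrix (Fin 4) (Fin 4) K where
  toFun y := !![y.1 0 0, y.1 0 1, 0, 0; y.1 1 0, y.1 1 1, 0, 0;
    0, 0, σ (y.1 0 0), -σ (y.1 0 1); 0, 0, -σ (y.1 1 0), σ (y.1 1 1)]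
  map_one' := by ext i k; fin_cases i <;> fin_cases k <;> simp
  map_mul' y z := by
    rw [Matrix.SpecialLinearGroup.coe_mul]
    ext i k
    fin_cases i <;> fin_cases k <;>
      simp [Matrix.mul_apply, Fin.sum_univ_four, Fin.sum_univ_two, add_comm]

/-- The group `SL₂(F)` acting on `⟨e₁, e₂⟩`. -/
def rightBlock {K F : Type*} [Field K] [Field F] (j : F →+* K) :
    SL2 F →* Matrix (Fin 4) (Fin 4) K where
  toFun y := !![1, 0, 0, 0; 0, j (y.1 0 0), j (y.1 0 1), 0;
    0, j (y.1 1 0), j (y.1 1 1), 0; 0, 0, 0, 1]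
  map_one' := by ext i k; fin_cases i <;> fin_cases k <;> simp
  map_mul' y z := by
    rw [Matrix.SpecialLinearGroup.coe_mul]
    ext i k
    fin_cases i <;> fin_cases k <;>
      simp [Matrix.mul_apply, Fin.sum_univ_four, Fin.sum_univ_two]

section Block

variable {K F : Type*} [Field K] [Field F] {σ : K →+* K} {j : F →+* K}

theorem leftBlock_apply (y : SL2 K) : leftBlock σ y =
    !![y.1 0 0, y.1 0 1, 0, 0; y.1 1 0, y.1 1 1, 0, 0;
      0, 0, σ (y.1 0 0), -σ (y.1 0 1); 0, 0, -σ (y.1 1 0), σ (y.1 1 1)] := rfl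

theorem rightBlock_apply (y : SL2 F) : rightBlock j y =
    !![1, 0, 0, 0; 0, j (y.1 0 0), j (y.1 0 1), 0;
      0, j (y.1 1 0), j (y.1 1 1), 0; 0, 0, 0, 1] := rfl

theorem det_leftBlock (y : SL2 K) : (leftBlock σ y).det = 1 := by
  have h1 := SL2.det_eq y
  have h2 := congrArg σ h1
  rw [map_sub, map_mul, map_mul, map_one] at h2
  have e : (1 : Fin 4).succAbove (2 : Fin 3) = 3 := rfl
  rw [leftBlock_apply]
  simp [Matrix.det_succ_row_zero, Fin.sum_univ_succ, e]
  linear_combination h2 + (σ (y.1 0 0) * σ (y.1 1 1) - σ (y.1 0 1) * σ (y.1 1 0)) * h1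

theorem det_rightBlock (y : SL2 F) : (rightBlock j y).det = 1 := by
  have h2 := congrArg j (SL2.det_eq y)
  rw [map_sub, map_mul, map_mul, map_one] at h2
  rw [rightBlock_apply]
  simp [Matrix.det_succ_row_zero, Fin.sum_univ_succ]
  linear_combination h2

theorem leftBlock_isometry (hσ : ∀ x, σ (σ x) = x) (y : SL2 K) :
    (leftBlock σ y)ᵀ * gram K * (leftBlock σ y).map σ = gram K := by
  have h1 := SL2.det_eq y
  have h2 := congrArg σ h1
  rw [map_sub, map_mul, map_mul, map_one] at h2
  rw [leftBlock_apply]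
  ext i k
  fin_cases i <;> fin_cases k <;>
    simp [Matrix.mul_apply, Fin.sum_univ_four, gram, hσ] <;> grind

theorem rightBlock_isometry (hj : ∀ y, σ (j y) = j y) (y : SL2 F) :
    (rightBlock j y)ᵀ * gram K * (rightBlock j y).map σ = gram K := by
  have h2 := congrArg j (SL2.det_eq y)
  rw [map_sub, map_mul, map_mul, map_one] at h2
  rw [rightBlock_apply]
  ext i k
  fin_cases i <;> fin_cases k <;>
    simp [Matrix.mul_apply, Fin.sum_univ_four, gram, hj] <;> grind

end Block

section Unitary

variable {p : ℕ} [Fact p.Prime] {G : Type*} [Group G] {K : Type*} [Field K] [CharP K p] [Finite K]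
  {σ : K →+* K} {m : G →* Matrix (Fin 2 ⊕ Fin 2) (Fin 2 ⊕ Fin 2) K} {G₁ G₂ : Subgroup G}

/-- Rescaling the basis by `η` turns the `ε`-hermitian form into a multiple of the standard
skew-hermitian one, and turns `G₂` into the standard `SL₂` over the fixed field of `σ`. -/
theorem exists_isApartment_of_isometry (hσ : ∀ x, σ (σ x) = x) {ε η : K} (hη : η ≠ 0)
    (hε : ε * σ η = -η) (hinj : Function.Injective m) (hdet : ∀ x, (m x).det = 1)
    (hiso : ∀ x, (m x)ᵀ * Matrix.fromBlocks 0 1 (Matrix.diagonal fun _ => ε) 0 * (m x).map σ =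
      Matrix.fromBlocks 0 1 (Matrix.diagonal fun _ => ε) 0)
    (hsurj : ∀ A : Matrix (Fin 2 ⊕ Fin 2) (Fin 2 ⊕ Fin 2) K, A.det = 1 →
      Aᵀ * Matrix.fromBlocks 0 1 (Matrix.diagonal fun _ => ε) 0 * A.map σ =
        Matrix.fromBlocks 0 1 (Matrix.diagonal fun _ => ε) 0 → ∃ x, m x = A)
    (h₁ : ∀ x, x ∈ G₁ ↔ ∃ a b c d : K, a * d - b * c = 1 ∧
      m x = Matrix.fromBlocks !![a, b; c, d] 0 0 !![σ d, -σ c; -σ b, σ a])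
    (h₂ : ∀ x, x ∈ G₂ ↔ ∃ a b c d : K, σ a = a ∧ σ b = b ∧ σ c = c ∧ σ d = d ∧
      a * d - b * c = 1 ∧ m x = Matrix.fromBlocks !![1, 0; 0, a] !![0, 0; 0, b * η]
        !![0, 0; 0, c * η⁻¹] !![1, 0; 0, d]) :
    ∃ B X₁ X₂ B' X₁' X₂', IsApartment p G₁ G₂ B X₁ X₂ B' X₁' X₂' := by
  set N : Matrix (Fin 2 ⊕ Fin 2) (Fin 2 ⊕ Fin 2) K :=
    Matrix.fromBlocks 0 1 (Matrix.diagonal fun _ => ε) 0 with hN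
  let r := Matrix.reindexAlgEquiv K K basisEquiv.symm
  have hr : ∀ A i k, r A i k = A (basisEquiv i) (basisEquiv k) := fun _ _ _ => rfl
  let D : Matrix (Fin 4) (Fin 4) K := Matrix.diagonal ![1, 1, η, η]
  let D' : Matrix (Fin 4) (Fin 4) K := Matrix.diagonal ![1, 1, η⁻¹, η⁻¹]
  have hDD' : D * D' = 1 := by
    rw [Matrix.diagonal_mul_diagonal, ← Matrix.diagonal_one]
    congr 1
    ext i; fin_cases i <;> simp [hη]
  have hD'D : D' * D = 1 := mul_eq_one_comm.1 hDD'
  have hση : σ η ≠ 0 := (map_ne_zero σ).2 hη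
  have hDσ : D'.map σ * D.map σ = 1 := by rw [← Matrix.map_mul, hD'D]; simp
  have hDσ' : D.map σ * D'.map σ = 1 := by rw [← Matrix.map_mul, hDD']; simp
  have hgram : D * gram K * D.map σ = σ η • r N := by
    ext i k
    rw [Matrix.diagonal_map (map_zero σ), Matrix.mul_diagonal, Matrix.diagonal_mul,
      Matrix.smul_apply, hr]
    fin_cases i <;> fin_cases k <;>
      simp [gram, basisEquiv, hN, mul_comm (σ η), hε]
  have hgram' : gram K = σ η • (D' * r N * D'.map σ) := by
    calc gram K = (D' * D) * gram K * (D.map σ * D'.map σ) := by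
          rw [hD'D, hDσ', one_mul, mul_one]
      _ = D' * (D * gram K * D.map σ) * D'.map σ := by simp only [Matrix.mul_assoc]
      _ = _ := by rw [hgram]; simp
  have hDT : Dᵀ = D := Matrix.diagonal_transpose _
  have hDT' : D'ᵀ = D' := Matrix.diagonal_transpose _
  have hrT : ∀ A, (r A)ᵀ = r Aᵀ := fun _ => rfl
  have hrσ : ∀ A, (r A).map σ = r (A.map σ) := fun _ => rfl
  -- A matrix is an isometry if and only if its transform is.
  have hconj : ∀ A, (D * r A * D')ᵀ * gram K * (D * r A * D').map σ =
      σ η • (D' * r (Aᵀ * N * A.map σ) * D'.map σ) := by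
    intro A
    rw [Matrix.transpose_mul, Matrix.transpose_mul, Matrix.map_mul, Matrix.map_mul, hDT, hDT',
      hrT, hrσ, map_mul, map_mul]
    calc _ = D' * r Aᵀ * (D * gram K * D.map σ) * r (A.map σ) * D'.map σ := by
          simp only [Matrix.mul_assoc]
      _ = _ := by rw [hgram]; simp [Matrix.mul_assoc]
  have hdetr : ∀ A, (D * r A * D').det = A.det := by
    intro A
    rw [Matrix.det_mul_right_comm, hDD', one_mul]
    exact Matrix.det_reindex_self _ _
  let ρ : G →* Matrix (Fin 4) (Fin 4) K :=
    { toFun x := D * r (m x) * D'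
      map_one' := by rw [map_one, map_one, mul_one, hDD']
      map_mul' x y := by
        rw [map_mul, map_mul]
        calc _ = D * r (m x) * 1 * r (m y) * D' := by simp only [Matrix.mul_assoc, one_mul]
          _ = _ := by rw [← hD'D]; simp only [Matrix.mul_assoc] }
  have hρ : ∀ x, ρ x = D * r (m x) * D' := fun _ => rfl
  have hback : ∀ A B, D * r A * D' = B ↔ A = r.symm (D' * B * D) := by
    intro A B
    rw [AlgEquiv.eq_symm_apply]
    constructor
    · rintro rfl
      calc r A = (D' * D) * r A * (D' * D) := by rw [hD'D, one_mul, mul_one]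
        _ = _ := by simp only [Matrix.mul_assoc]
    · intro h
      rw [h]
      calc _ = (D * D') * B * (D * D') := by simp only [Matrix.mul_assoc]
        _ = B := by rw [hDD', one_mul, mul_one]
  have hρinj : Function.Injective ρ := by
    intro x y hxy
    have h1 := (hback _ _).1 hxy
    rw [← (hback _ _).1 (hρ y).symm] at h1
    exact hinj h1
  have hρsurj : ∀ B : Matrix (Fin 4) (Fin 4) K, B.det = 1 → Bᵀ * gram K * B.map σ = gram K →
      ∃ x, ρ x = B := by
    intro B hB hBiso
    have e := (hback (r.symm (D' * B * D)) B).2 rfl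
    obtain ⟨x, hx⟩ := hsurj (r.symm (D' * B * D)) (by rw [← hdetr, e, hB]) (by
      have h1 := hconj (r.symm (D' * B * D))
      rw [e, hBiso] at h1
      conv_lhs at h1 => rw [hgram']
      have h2 := smul_right_injective _ hση h1
      have h3 := congrArg (fun M => D * M * D.map σ) h2
      have h4 : ∀ M, D * (D' * M * D'.map σ) * D.map σ = M := fun M => by
        calc _ = (D * D') * M * (D'.map σ * D.map σ) := by simp only [Matrix.mul_assoc]
          _ = M := by rw [hDD', hDσ, one_mul, mul_one]
      simp only [h4] at h3
      exact (r.injective h3).symm)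
    exact ⟨x, by rw [hρ, hx, e]⟩
  let F := RingHom.eqLocusField σ (RingHom.id K)
  have hF : ∀ x, σ x = x ↔ ∃ y : F, F.subtype y = x :=
    fun x => ⟨fun hx => ⟨⟨x, hx⟩, rfl⟩, by rintro ⟨y, rfl⟩; exact y.2⟩
  have hσF : ∀ y : F, σ y.1 = y.1 := fun y => y.2
  obtain ⟨ι₁, hι₁⟩ := exists_lift hρinj (leftBlock σ) fun y =>
    hρsurj _ (det_leftBlock y) (leftBlock_isometry hσ y)
  obtain ⟨ι₂, hι₂⟩ := exists_lift hρinj (rightBlock F.subtype) fun y =>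
    hρsurj _ (det_rightBlock y) (rightBlock_isometry hσF y)
  have hu : IsUnitary σ F.subtype ρ ι₁ ι₂ :=
    { involutive := hσ
      fixed := hF
      injective := hρinj
      det_eq_one x := by rw [hρ, hdetr, hdet]
      isometry x := by rw [hρ, hconj, hiso, ← hgram']
      left y := hι₁ y
      right y := hι₂ y }
  have hl : ∀ y : SL2 K, D * r (Matrix.fromBlocks !![y.1 0 0, y.1 0 1; y.1 1 0, y.1 1 1] 0 0
      !![σ (y.1 1 1), -σ (y.1 1 0); -σ (y.1 0 1), σ (y.1 0 0)]) * D' = leftBlock σ y := by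
    intro y
    rw [leftBlock_apply]
    ext i k
    rw [Matrix.mul_diagonal, Matrix.diagonal_mul, hr]
    fin_cases i <;> fin_cases k <;> simp [basisEquiv] <;> field_simp
  have hl' : ∀ y : SL2 F, D * r (Matrix.fromBlocks !![1, 0; 0, F.subtype (y.1 0 0)]
      !![0, 0; 0, F.subtype (y.1 0 1) * η] !![0, 0; 0, F.subtype (y.1 1 0) * η⁻¹]
      !![1, 0; 0, F.subtype (y.1 1 1)]) * D' = rightBlock F.subtype y := by
    intro y
    rw [rightBlock_apply]
    ext i k
    rw [Matrix.mul_diagonal, Matrix.diagonal_mul, hr]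
    fin_cases i <;> fin_cases k <;> simp [basisEquiv] <;> field_simp
  have e₁ : ι₁.range = G₁ := by
    ext x
    rw [h₁]
    constructor
    · rintro ⟨y, rfl⟩
      refine ⟨y.1 0 0, y.1 0 1, y.1 1 0, y.1 1 1, SL2.det_eq y, ?_⟩
      rw [(hback _ _).1 (hl y), (hback _ _).1 (hρ (ι₁ y)).symm, hι₁]
    · rintro ⟨a, b, c, d, hd, hx⟩
      refine ⟨SL2.mk a b c d hd, hρinj ?_⟩
      rw [hι₁, ← hl, hρ, hx]
      rfl
  have e₂ : ι₂.range = G₂ := by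
    ext x
    rw [h₂]
    constructor
    · rintro ⟨y, rfl⟩
      refine ⟨y.1 0 0, y.1 0 1, y.1 1 0, y.1 1 1, hσF _, hσF _, hσF _, hσF _,
        by exact_mod_cast SL2.det_eq y, ?_⟩
      have := (hback _ _).1 (hl' y)
      rw [← hι₂, ← (hback _ _).1 (hρ (ι₂ y)).symm] at this
      exact this.symm
    · rintro ⟨a, b, c, d, ha, hb, hc, hd, hdet, hx⟩
      refine ⟨SL2.mk (⟨a, ha⟩ : F) ⟨b, hb⟩ ⟨c, hc⟩ ⟨d, hd⟩ (Subtype.ext hdet), hρinj ?_⟩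
      rw [hι₂, ← hl', hρ, hx]
      rfl
  rw [← e₁, ← e₂]
  exact ⟨_, _, _, _, _, _, hu.isApartment (p := p)⟩

end Unitary
end MatrixRep

namespace StandardPair

open MatrixRep

variable {p : ℕ} [Fact p.Prime] {n : ℕ} {G : Type*} [Group G] {G₁ G₂ : Subgroup G}

theorem IsA1A1.commute (h : IsA1A1 p n G₁ G₂) {x y : G} (hx : x ∈ G₁) (hy : y ∈ G₂) :
    Commute x y := by
  obtain ⟨k, l, -, -, φ, h₁, h₂⟩ := h
  refine φ.injective ?_
  rw [map_mul, map_mul]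
  refine Prod.ext ?_ ?_
  · simp [(h₂ y).1 hy]
  · simp [(h₁ x).1 hx]

theorem IsA1A1.sup_eq_top (h : IsA1A1 p n G₁ G₂) : G₁ ⊔ G₂ = ⊤ := by
  obtain ⟨k, l, -, -, φ, h₁, h₂⟩ := h
  rw [eq_top_iff]
  intro x _
  have e : x = φ.symm ((φ x).1, 1) * φ.symm (1, (φ x).2) := by
    rw [← map_mul, MulEquiv.eq_symm_apply]
    simp
  rw [e]
  exact Subgroup.mul_mem_sup ((h₁ _).2 (by simp)) ((h₂ _).2 (by simp))

theorem IsA2.exists_isApartment (h : IsA2 p n G₁ G₂) :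
    ∃ B X₁ X₂ B' X₁' X₂', IsApartment p G₁ G₂ B X₁ X₂ B' X₁' X₂' ∧
      IsRigidLeft p G₁ G₂ X₁ X₁' ∧ IsRigidLeft p G₂ G₁ X₂ X₂' := by
  obtain ⟨φ, h₁, h₂⟩ := h
  let K := GaloisField p n
  let ρ : G →* Matrix (Fin 3) (Fin 3) K :=
    (Matrix.SpecialLinearGroup.coeMonoidHom (ι := Fin 3) (R := K)).comp φ.toMonoidHom
  have hρ : ∀ x, ρ x = (φ x).1 := fun _ => rfl
  have hsl : IsSpecialLinear ρ :=
    { injective := fun x y hxy => φ.injective (Subtype.ext hxy)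
      det_eq_one x := (φ x).2
      exists_eq A hA := ⟨φ.symm ⟨A, hA⟩, congrArg Subtype.val (φ.apply_symm_apply _)⟩ }
  let β₁ : SL2 K →* Matrix (Fin 3) (Fin 3) K :=
    { toFun y := !![y.1 0 0, y.1 0 1, 0; y.1 1 0, y.1 1 1, 0; 0, 0, 1]
      map_one' := by ext i k; fin_cases i <;> fin_cases k <;> simp
      map_mul' y z := by
        rw [Matrix.SpecialLinearGroup.coe_mul]
        ext i k
        fin_cases i <;> fin_cases k <;>
          simp [Matrix.mul_apply, Fin.sum_univ_three, Fin.sum_univ_two] }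
  let β₂ : SL2 K →* Matrix (Fin 3) (Fin 3) K :=
    { toFun y := !![1, 0, 0; 0, y.1 0 0, y.1 0 1; 0, y.1 1 0, y.1 1 1]
      map_one' := by ext i k; fin_cases i <;> fin_cases k <;> simp
      map_mul' y z := by
        rw [Matrix.SpecialLinearGroup.coe_mul]
        ext i k
        fin_cases i <;> fin_cases k <;>
          simp [Matrix.mul_apply, Fin.sum_univ_three, Fin.sum_univ_two] }
  have hβ₁ : ∀ y, β₁ y = !![y.1 0 0, y.1 0 1, 0; y.1 1 0, y.1 1 1, 0; 0, 0, 1] := fun _ => rfl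
  have hβ₂ : ∀ y, β₂ y = !![1, 0, 0; 0, y.1 0 0, y.1 0 1; 0, y.1 1 0, y.1 1 1] := fun _ => rfl
  obtain ⟨ι₁, hι₁⟩ := exists_lift hsl.injective β₁ fun y => hsl.exists_eq _ (by
    rw [hβ₁, Matrix.det_fin_three]
    simpa using SL2.det_eq y)
  obtain ⟨ι₂, hι₂⟩ := exists_lift hsl.injective β₂ fun y => hsl.exists_eq _ (by
    rw [hβ₂, Matrix.det_fin_three]
    simpa using SL2.det_eq y)
  have hA : MatrixRep.IsA2 ρ ι₁ ι₂ := { hsl with left := hι₁, right := hι₂ }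
  have e₁ : ι₁.range = G₁ := by
    ext x
    rw [h₁]
    constructor
    · rintro ⟨y, rfl⟩
      exact ⟨_, _, _, _, SL2.det_eq y, hι₁ y⟩
    · rintro ⟨a, b, c, d, hd, hx⟩
      exact ⟨SL2.mk a b c d hd, hsl.injective (by rw [hι₁, hρ, hx]; rfl)⟩
  have e₂ : ι₂.range = G₂ := by
    ext x
    rw [h₂]
    constructor
    · rintro ⟨y, rfl⟩
      exact ⟨_, _, _, _, SL2.det_eq y, hι₂ y⟩
    · rintro ⟨a, b, c, d, hd, hx⟩
      exact ⟨SL2.mk a b c d hd, hsl.injective (by rw [hι₂, hρ, hx]; rfl)⟩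
  rw [← e₁, ← e₂]
  exact ⟨_, _, _, _, _, _, hA.isApartment (p := p), hA.isRigidLeft, hA.isRigidRight⟩

theorem IsC2.exists_isApartment (h : IsC2 p n G₁ G₂) :
    ∃ B X₁ X₂ B' X₁' X₂', IsApartment p G₁ G₂ B X₁ X₂ B' X₁' X₂' := by
  obtain ⟨φ, h₁, h₂⟩ := h
  let K := GaloisField p n
  have hJ : Matrix.J (Fin 2) K =
      -Matrix.fromBlocks 0 1 (Matrix.diagonal fun _ => (-1 : K)) 0 := by
    rw [Matrix.J, Matrix.fromBlocks_neg]
    congr 1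
    · simp
    · ext i k
      rw [Matrix.neg_apply, Matrix.diagonal_apply, Matrix.one_apply]
      split_ifs
      exacts [(neg_neg _).symm, neg_zero.symm]
    · simp
  have key : ∀ A : Matrix (Fin 2 ⊕ Fin 2) (Fin 2 ⊕ Fin 2) K, A ∈ Matrix.symplecticGroup (Fin 2) K ↔
      Aᵀ * Matrix.fromBlocks 0 1 (Matrix.diagonal fun _ => (-1 : K)) 0 * A.map (RingHom.id K) =
        Matrix.fromBlocks 0 1 (Matrix.diagonal fun _ => (-1 : K)) 0 := by
    intro A
    rw [SymplecticGroup.mem_iff', hJ, mul_neg, neg_mul, neg_inj]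
    simp
  refine exists_isApartment_of_isometry (p := p) (σ := RingHom.id K) (ε := -1) (η := 1)
    (m := (Submonoid.subtype _).comp φ.toMonoidHom) (fun _ => rfl) one_ne_zero (by simp)
    (fun x y hxy => φ.injective (Subtype.ext hxy))
    (fun x => SymplecticGroup.det_eq_one (φ x).2) (fun x => (key _).1 (φ x).2)
    (fun A _ hA => ⟨φ.symm ⟨A, (key A).2 hA⟩, by simp⟩) h₁ fun x => ?_
  rw [h₂]
  simp only [RingHom.id_apply, true_and, inv_one, mul_one]
  rfl

theorem IsTwA3.exists_isApartment (hn : 0 < n) (h : IsTwA3 p n G₁ G₂) :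
    ∃ B X₁ X₂ B' X₁' X₂', IsApartment p G₁ G₂ B X₁ X₂ B' X₁' X₂' := by
  obtain ⟨φ, h₁, η, hη, hη', h₂⟩ := h
  let K := GaloisField p (2 * n)
  have hσ : ∀ x, iterateFrobenius K p n x = x ^ p ^ n := fun x => iterateFrobenius_def p n x
  have hinv : ∀ x, iterateFrobenius K p n (iterateFrobenius K p n x) = x := by
    intro x
    have := Fintype.ofFinite K
    have h3 := FiniteField.pow_card x
    rw [← Nat.card_eq_fintype_card, GaloisField.card p (2 * n) (by lia)] at h3
    rw [hσ, hσ, ← pow_mul, ← pow_add, ← two_mul, h3]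
  have key : ∀ A : Matrix.SpecialLinearGroup (Fin 2 ⊕ Fin 2) K,
      A ∈ hyperbolicSU (iterateFrobenius K p n) ↔
      A.1ᵀ * Matrix.fromBlocks 0 1 (Matrix.diagonal fun _ => (1 : K)) 0 *
        A.1.map (iterateFrobenius K p n) =
        Matrix.fromBlocks 0 1 (Matrix.diagonal fun _ => (1 : K)) 0 := fun A => Iff.rfl
  refine exists_isApartment_of_isometry (p := p) (σ := iterateFrobenius K p n) (ε := 1) (η := η)
    (m := (Matrix.SpecialLinearGroup.coeMonoidHom (ι := Fin 2 ⊕ Fin 2) (R := K)).comp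
      ((Subgroup.subtype _).comp φ.toMonoidHom)) hinv hη
    (by rw [hσ, one_mul]; exact eq_neg_of_add_eq_zero_right hη')
    (fun x y hxy => φ.injective (Subtype.ext (Subtype.ext hxy)))
    (fun x => (φ x).1.2) (fun x => (key _).1 (φ x).2)
    (fun A hA hA' => ⟨φ.symm ⟨⟨A, hA⟩, (key ⟨A, hA⟩).2 hA'⟩, by simp; rfl⟩) ?_ ?_
  · intro x
    rw [h₁]
    simp only [hσ]
    rfl
  · intro x
    rw [h₂]
    simp only [hσ]
    rfl

end StandardPair

theorem IsStandardPair.exists_isApartment {p : ℕ} [Fact p.Prime] {n : ℕ} (hn : 0 < n)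
    {t : RankTwoType} (ht : t ≠ .A1A1) {G : Type*} [Group G] {G₁ G₂ : Subgroup G}
    (h : IsStandardPair p n t G₁ G₂) :
    ∃ B X₁ X₂ B' X₁' X₂', IsApartment p G₁ G₂ B X₁ X₂ B' X₁' X₂' ∧
      (t = .A2 → IsRigidLeft p G₁ G₂ X₁ X₁' ∧ IsRigidLeft p G₂ G₁ X₂ X₂') := by
  have swap : (∃ B X₁ X₂ B' X₁' X₂', IsApartment p G₂ G₁ B X₁ X₂ B' X₁' X₂') →
      ∃ B X₁ X₂ B' X₁' X₂', IsApartment p G₁ G₂ B X₁ X₂ B' X₁' X₂' :=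
    fun ⟨_, _, _, _, _, _, h⟩ => ⟨_, _, _, _, _, _, h.swap⟩
  have key : t ≠ .A2 → (∃ B X₁ X₂ B' X₁' X₂', IsApartment p G₁ G₂ B X₁ X₂ B' X₁' X₂') →
      ∃ B X₁ X₂ B' X₁' X₂', IsApartment p G₁ G₂ B X₁ X₂ B' X₁' X₂' ∧
        (t = .A2 → IsRigidLeft p G₁ G₂ X₁ X₁' ∧ IsRigidLeft p G₂ G₁ X₂ X₂') :=
    fun ht ⟨_, _, _, _, _, _, h⟩ => ⟨_, _, _, _, _, _, h, fun h' => absurd h' ht⟩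
  cases t with
  | A1A1 => exact absurd rfl ht
  | A2 =>
    obtain ⟨_, _, _, _, _, _, h1, h2⟩ := StandardPair.IsA2.exists_isApartment h
    exact ⟨_, _, _, _, _, _, h1, fun _ => h2⟩
  | C2 => exact key nofun (StandardPair.IsC2.exists_isApartment h)
  | C2op => exact key nofun (swap (StandardPair.IsC2.exists_isApartment h))
  | twA3 => exact key nofun (StandardPair.IsTwA3.exists_isApartment hn h)
  | twA3op => exact key nofun (swap (StandardPair.IsTwA3.exists_isApartment hn h))

/-! ### Vertices of valency two in a 3-spherical diagram -/

namespace LieDiagram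

variable {I : Type*} (Γ : LieDiagram I)

/-- The off-diagonal entries of a generalized Cartan matrix of `Γ`, up to sign. -/
def weight (i j : I) : ℤ :=
  match Γ.label i j with
  | .A1A1 => 0
  | .A2 => 1
  | .C2 => 2
  | .C2op => 1
  | .twA3 => 2
  | .twA3op => 1

theorem weight_eq_zero {i j : I} (hij : i ≠ j) (h : ¬Γ.graph.Adj i j) : Γ.weight i j = 0 := by
  have : Γ.label i j = .A1A1 := by
    by_contra h'
    exact h ⟨hij, h'⟩
  rw [weight, this]

theorem one_le_weight {i j : I} (h : Γ.graph.Adj i j) : 1 ≤ Γ.weight i j := by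
  have := h.2
  rw [weight]
  cases hl : Γ.label i j <;> simp_all

theorem weight_mul_weight {i j : I} (h : Γ.graph.Adj i j) (h' : Γ.label i j ≠ .A2) :
    Γ.weight i j * Γ.weight j i = 2 := by
  have := h.2
  rw [weight, weight, Γ.label_swap i j h.1]
  cases hl : Γ.label i j <;> simp_all [RankTwoType.swap]

variable [DecidableEq I]

/-- A move at the node `i` of the numbers game on `Γ`: the number at `i` changes its sign, and
its multiples are added to the numbers at the other nodes. -/
def fire (i : I) (c : I → ℤ) : I → ℤ :=
  fun k => if k = i then -c i else c k + Γ.weight i k * c i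

theorem fire_self (i : I) (c : I → ℤ) : Γ.fire i c i = -c i := if_pos rfl

theorem fire_of_ne {i k : I} (h : k ≠ i) (c : I → ℤ) :
    Γ.fire i c k = c k + Γ.weight i k * c i := if_neg h

theorem fire_fire (i : I) (c : I → ℤ) : Γ.fire i (Γ.fire i c) = c := by
  ext k
  by_cases hk : k = i
  · subst hk
    rw [fire_self, fire_self, neg_neg]
  · rw [fire_of_ne _ hk, fire_of_ne _ hk, fire_self]
    ring

/-- The moves satisfy the relations of the Coxeter group. -/
theorem isLiftable_fire :
    Γ.coxeterMatrix.IsLiftable (G := Function.End (I → ℤ)) Γ.fire := by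
  intro i j
  by_cases hij : i = j
  · subst hij
    rw [CoxeterMatrix.diagonal, pow_one]
    exact funext fun c => Γ.fire_fire i c
  have hji := Ne.symm hij
  have hM : Γ.coxeterMatrix i j = (Γ.label i j).coxeterLabel := if_neg hij
  have hl := Γ.label_swap i j hij
  have hpow : ∀ (f : Function.End (I → ℤ)) (n : ℕ) (c : I → ℤ), (f ^ n) c = f^[n] c :=
    fun f n c => by
      induction n generalizing c with
      | zero => rfl
      | succ n ih => rw [pow_succ]; exact ih (f c)
  rw [hM]
  cases h : Γ.label i j
  all_goals
    rw [h] at hl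
    have w1 : Γ.weight i j = Γ.weight i j := rfl
    have w2 : Γ.weight j i = Γ.weight j i := rfl
    conv_rhs at w1 => simp only [weight, h]
    conv_rhs at w2 => simp only [weight, hl, RankTwoType.swap]
    refine funext fun c => ?_
    rw [hpow]
    change (fun c => Γ.fire i (Γ.fire j c))^[_] c = c
    simp only [RankTwoType.coxeterLabel, Function.iterate_succ, Function.iterate_zero,
      Function.comp_apply, id]
    ext k
    by_cases hki : k = i
    · subst hki
      simp only [fire_self, Γ.fire_of_ne hij, Γ.fire_of_ne hji, w1, w2]
      ring
    by_cases hkj : k = j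
    · subst hkj
      simp only [fire_self, Γ.fire_of_ne hij, Γ.fire_of_ne hji, w1, w2]
      ring
    · simp only [fire_self, Γ.fire_of_ne hij, Γ.fire_of_ne hji, Γ.fire_of_ne hki,
        Γ.fire_of_ne hkj, w1, w2]
      ring

variable {Γ}

/-- Only finitely many positions can be reached in a spherical diagram. -/
theorem ThreeSpherical.exists_finite (h3 : Γ.ThreeSpherical) {J : Finset I} (hJ : J.card = 3)
    (c₀ : I → ℤ) :
    ∃ O : Set (I → ℤ), O.Finite ∧ c₀ ∈ O ∧ ∀ c ∈ O, ∀ i ∈ J, Γ.fire i c ∈ O := by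
  have hfin := h3 J hJ
  let φ := Γ.coxeterMatrix.toCoxeterSystem.lift (G := Function.End (I → ℤ))
    ⟨Γ.fire, Γ.isLiftable_fire⟩
  have hφ : ∀ i, φ (Γ.coxeterMatrix.simple i) = Γ.fire i := fun i =>
    Γ.coxeterMatrix.toCoxeterSystem.lift_apply_simple Γ.isLiftable_fire i
  let H := Subgroup.closure (Γ.coxeterMatrix.simple '' (J : Set I))
  refine ⟨Set.range fun w : H => φ w c₀, Set.finite_range _, ⟨1, by simp; rfl⟩, ?_⟩
  rintro _ ⟨w, rfl⟩ i hi
  refine ⟨⟨Γ.coxeterMatrix.simple i, Subgroup.subset_closure ⟨i, hi, rfl⟩⟩ * w, ?_⟩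
  simp only [Subgroup.coe_mul, map_mul, hφ]
  rfl

/-- On a triangle, firing the nodes cyclically leads to arbitrarily large numbers. -/
theorem ThreeSpherical.not_adj (h3 : Γ.ThreeSpherical) {i j k : I} (hij : Γ.graph.Adj i j)
    (hik : Γ.graph.Adj i k) : ¬Γ.graph.Adj j k := by
  intro hjk
  obtain ⟨O, hO, h0, hmem⟩ := h3.exists_finite (J := {i, j, k})
    (Finset.card_eq_three.2 ⟨i, j, k, hij.1, hik.1, hjk.1, rfl⟩)
    (fun t => if t = k then 0 else 1)
  have step : ∀ n : ℕ, ∃ c ∈ O, ∃ x y z : I, x ∈ ({i, j, k} : Finset I) ∧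
      y ∈ ({i, j, k} : Finset I) ∧ z ∈ ({i, j, k} : Finset I) ∧ Γ.graph.Adj x y ∧
      Γ.graph.Adj y z ∧ Γ.graph.Adj x z ∧
      n ≤ c x ∧ 1 - c z ≤ c x ∧ 1 ≤ c y ∧ c z ≤ 0 := by
    intro n
    induction n with
    | zero =>
      refine ⟨_, h0, i, j, k, by simp, by simp, by simp, hij, hjk, hik, ?_⟩
      simp [hik.1, hjk.1]
    | succ n ih =>
      obtain ⟨c, hc, x, y, z, hx, hy, hz, hxy, hyz, hxz, h1, h2, h4, h5⟩ := ih
      refine ⟨_, hmem c hc x hx, y, z, x, hy, hz, hx, hyz, hxz.symm, hxy.symm, ?_⟩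
      rw [fire_self, fire_of_ne _ hxy.1.symm, fire_of_ne _ hxz.1.symm]
      have hw1 := Γ.one_le_weight hxy
      have hw2 := Γ.one_le_weight hxz
      push_cast
      refine ⟨?_, ?_, ?_, ?_⟩ <;> nlinarith
  obtain ⟨M, hM⟩ : ∃ M : ℕ, ∀ c ∈ O, ∀ x ∈ ({i, j, k} : Finset I), c x < M := by
    have : ((fun q : (I → ℤ) × I => q.1 q.2) '' (O ×ˢ (({i, j, k} : Finset I) : Set I))).Finite :=
      (hO.prod (Finset.finite_toSet _)).image _
    obtain ⟨b, hb⟩ := this.bddAbove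
    refine ⟨(b + 1).toNat, fun c hc x hx => ?_⟩
    have := hb ⟨(c, x), ⟨hc, hx⟩, rfl⟩
    simp only at this
    lia
  obtain ⟨c, hc, x, -, -, hx, -, -, -, -, -, h1, -⟩ := step M
  have := hM c hc x hx
  lia

/-- On a path with two edges of label four, firing the two ends and then the middle node leads to
arbitrarily small numbers at the middle node. -/
theorem ThreeSpherical.label_eq_A2 (h3 : Γ.ThreeSpherical) {i j k : I} (hij : Γ.graph.Adj i j)
    (hik : Γ.graph.Adj i k) (hjk : j ≠ k) : Γ.label i j = .A2 ∨ Γ.label i k = .A2 := by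
  by_contra! hcon
  have hj := Γ.weight_mul_weight hij hcon.1
  have hk := Γ.weight_mul_weight hik hcon.2
  have hn := h3.not_adj hij hik
  have wjk := Γ.weight_eq_zero hjk hn
  have wkj := Γ.weight_eq_zero hjk.symm fun h => hn h.symm
  obtain ⟨O, hO, h0, hmem⟩ := h3.exists_finite (J := {i, j, k})
    (Finset.card_eq_three.2 ⟨i, j, k, hij.1, hik.1, hjk, rfl⟩)
    (fun t => if t = j then 1 else 0)
  have hji := Γ.one_le_weight hij.symm
  have step : ∀ n : ℕ, ∃ c ∈ O, c i ≤ -n ∧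
      1 ≤ Γ.weight j i * c j + Γ.weight k i * c k + 2 * c i := by
    intro n
    induction n with
    | zero => exact ⟨_, h0, by simp [hij.1], by simp [hij.1, hjk.symm, hji]⟩
    | succ n ih =>
      obtain ⟨c, hc, h1, h2⟩ := ih
      refine ⟨_, hmem _ (hmem _ (hmem c hc j (by simp)) k (by simp)) i (by simp), ?_⟩
      simp only [fire_self, Γ.fire_of_ne hij.1, Γ.fire_of_ne hij.1.symm, Γ.fire_of_ne hik.1,
        Γ.fire_of_ne hik.1.symm, Γ.fire_of_ne hjk, Γ.fire_of_ne hjk.symm, wjk, wkj]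
      push_cast
      constructor
      · linarith
      · have e : ∀ m, Γ.weight j i * (Γ.weight i j * m) = 2 * m := fun m => by
          linear_combination m * hj
        have e' : ∀ m, Γ.weight k i * (Γ.weight i k * m) = 2 * m := fun m => by
          linear_combination m * hk
        simp only [mul_add (Γ.weight j i), mul_add (Γ.weight k i), e, e']
        linarith
  obtain ⟨b, hb⟩ := (hO.image fun c => c i).bddBelow
  obtain ⟨c, hc, h1, -⟩ := step (-b + 1).toNat
  have := hb ⟨c, hc, rfl⟩
  simp only at this
  lia

end LieDiagram

/-! ### The root groups of a vertex group that an edge singles out -/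

section RootGroups

variable {p : ℕ} {H G : Type*} [Group H] [Group G] {ι : H →* G}
  {G₂ B X₁ X₂ B' X₁' X₂' : Subgroup G}

/-- The Sylow `p`-subgroups of `H` whose images under `ι : H → G` are contained in a Borel
subgroup that is adapted to the pair `ι(H)`, `G₂`. -/
def rootGroups (p : ℕ) (ι : H →* G) (G₂ : Subgroup G) : Set (Sylow p H) :=
  {P | ∃ B : Subgroup G, IsBorel p B ∧ IsAdapted p ι.range G₂ B ∧ (P : Subgroup H).map ι ≤ B}

theorem IsChamber.exists_sylow (hι : Function.Injective ι) (h : IsChamber p ι.range G₂ B X₁ X₂) :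
    ∃ P : Sylow p H, (P : Subgroup H).map ι = X₁ ∧
      ∀ Q : Sylow p H, (Q : Subgroup H).map ι ≤ B ↔ Q = P := by
  obtain ⟨hp, hle, hmax⟩ := h.sylow_left
  have hX : (X₁.comap ι).map ι = X₁ := by
    rw [Subgroup.map_comap_eq, inf_eq_right.2 hle]
  obtain ⟨P, hP⟩ := (hp.comap_of_injective ι hι).exists_le_sylow
  have hPX : (P : Subgroup H).map ι = X₁ :=
    hmax _ (Subgroup.map_le_range _ _) (P.isPGroup'.map ι) (hX ▸ Subgroup.map_mono hP)
  refine ⟨P, hPX, fun Q => ⟨fun hQ => ?_, ?_⟩⟩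
  · have h1 := h.unique_left _ (Subgroup.map_le_range _ _) (Q.isPGroup'.map ι) hQ
    rw [← hPX, Subgroup.map_le_map_iff_of_injective hι] at h1
    exact (Sylow.ext (Q.is_maximal' P.isPGroup' h1)).symm
  · rintro rfl
    exact hPX ▸ h.le_left

theorem IsApartment.exists_rootGroups_eq (hι : Function.Injective ι)
    (h : IsApartment p ι.range G₂ B X₁ X₂ B' X₁' X₂') :
    ∃ P P' : Sylow p H, P ≠ P' ∧ (P : Subgroup H) ⊓ (P' : Subgroup H) = ⊥ ∧
      rootGroups p ι G₂ = {P, P'} ∧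
      (P : Subgroup H).map ι = X₁ ∧ (P' : Subgroup H).map ι = X₁' ∧
      (∀ Q : Sylow p H, (Q : Subgroup H).map ι ≤ B ↔ Q = P) ∧
      ∀ Q : Sylow p H, (Q : Subgroup H).map ι ≤ B' ↔ Q = P' := by
  obtain ⟨P, hP, hPB⟩ := h.pos.exists_sylow hι
  obtain ⟨P', hP', hPB'⟩ := h.neg.exists_sylow hι
  have hinf : (P : Subgroup H) ⊓ (P' : Subgroup H) = ⊥ := by
    rw [← (Subgroup.map_injective hι).eq_iff, Subgroup.map_inf _ _ _ hι, hP, hP', h.inf_left,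
      Subgroup.map_bot]
  refine ⟨P, P', ?_, hinf, ?_, hP, hP', hPB, hPB'⟩
  · rintro rfl
    rw [inf_idem] at hinf
    exact h.pos.ne_bot_left (by rw [← hP, hinf, Subgroup.map_bot])
  · ext Q
    constructor
    · rintro ⟨C, hC, hA, hQ⟩
      rcases h.unique C hC hA with rfl | rfl
      · exact Or.inl ((hPB Q).1 hQ)
      · exact Or.inr ((hPB' Q).1 hQ)
    · rintro (rfl | rfl)
      · exact ⟨B, h.pos.borel, h.pos.adapted, (hPB _).2 rfl⟩
      · exact ⟨B', h.neg.borel, h.neg.adapted, (hPB' _).2 rfl⟩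

/-- A Borel subgroup of an apartment is not opposite to itself. -/
theorem IsChamber.not_areOppositeBorels {G₁ : Subgroup G} (h : IsChamber p G₁ G₂ B X₁ X₂) :
    ¬AreOppositeBorels p B B := by
  rintro ⟨U, V, hU, hV, hUV⟩
  have key : ∀ W : Sylow p G, B = Subgroup.normalizer ((W : Subgroup G) : Set G) →
      X₁ ≤ W := by
    intro W hW
    have : X₁ ⊓ Subgroup.normalizer ((W : Subgroup G) : Set G) = X₁ ⊓ W :=
      h.sylow_left.1.inf_normalizer_sylow W
    rw [← hW, inf_eq_left.2 h.le_left] at this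
    exact inf_eq_left.1 this.symm
  exact h.ne_bot_left (le_bot_iff.1 (hUV ▸ le_inf (key U hU) (key V hV)))

end RootGroups

namespace Amalgam

theorem rootGroups_congr {P : Type v} [PartialOrder P] (𝒢 : Amalgam.{u, v} P) (p : ℕ)
    {a b x y : P} (hxy : x = y) (ha : a < x) (hb : b < x) (ha' : a < y) (hb' : b < y) :
    rootGroups p (𝒢.incl ha) (𝒢.incl hb).range =
      rootGroups p (𝒢.incl ha') (𝒢.incl hb').range := by
  subst hxy
  rfl

variable {I : Type v} [DecidableEq I] {𝒢 : Amalgam.{u, v} (AmalgamIndex I)}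

/-- The root groups of the vertex group at `i` that the edge from `i` to `j` singles out. -/
def edgeRoots (𝒢 : Amalgam.{u, v} (AmalgamIndex I)) (p : ℕ) {i j : I} (h : i ≠ j) :
    Set (Sylow p (𝒢.vertexGroup i)) :=
  rootGroups p (𝒢.inclLeft h) (𝒢.inclRight h).range

theorem rootGroups_inclRight (𝒢 : Amalgam.{u, v} (AmalgamIndex I)) (p : ℕ) {i j : I}
    (h : i ≠ j) (h' : j ≠ i) :
    rootGroups p (𝒢.inclRight h) (𝒢.inclLeft h).range = 𝒢.edgeRoots p h' :=
  𝒢.rootGroups_congr p (Subtype.ext (Finset.pair_comm i j)) _ _ _ _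

theorem Completion.hom_incl {P : Type v} [PartialOrder P] {𝒢 : Amalgam.{u, v} P} {A : Type*}
    [Group A] (γ : 𝒢.Completion A) {x y : P} (h : x < y) (g : 𝒢.grp x) :
    γ.hom y (𝒢.incl h g) = γ.hom x g := DFunLike.congr_fun (γ.hom_comp h) g

namespace IsCurtisTits

variable {p : ℕ} [Fact p.Prime] {f : ℕ} {Γ : LieDiagram I} (h𝒢 : 𝒢.IsCurtisTits p f Γ)
  (hf : 0 < f) {A : Type*} [Group A] (γ : 𝒢.Completion A)

include h𝒢

theorem isA1A1 {i j : I} (hij : i ≠ j) (h : ¬Γ.graph.Adj i j) :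
    ∃ n, StandardPair.IsA1A1 p n (𝒢.inclLeft hij).range (𝒢.inclRight hij).range := by
  obtain ⟨e, -, he⟩ := h𝒢.standard i j hij
  have hl : Γ.label i j = .A1A1 := by
    by_contra h'
    exact h ⟨hij, h'⟩
  rw [hl] at he
  exact ⟨_, he⟩

/-- The images of two vertex groups that are not joined commute in a completion. -/
theorem commute_hom {i j : I} (hij : i ≠ j) (h : ¬Γ.graph.Adj i j) (x : 𝒢.vertexGroup i)
    (y : 𝒢.vertexGroup j) : Commute (γ.hom _ x) (γ.hom _ y) := by
  obtain ⟨n, hn⟩ := h𝒢.isA1A1 hij h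
  have := (hn.commute (x := 𝒢.inclLeft hij x) (y := 𝒢.inclRight hij y) ⟨x, rfl⟩ ⟨y, rfl⟩).map
    (γ.hom _)
  rwa [γ.hom_incl, γ.hom_incl] at this

include hf

theorem exists_isApartment {i j : I} (h : Γ.graph.Adj i j) :
    ∃ B X₁ X₂ B' X₁' X₂',
      IsApartment p (𝒢.inclLeft h.1).range (𝒢.inclRight h.1).range B X₁ X₂ B' X₁' X₂' ∧
      (Γ.label i j = .A2 →
        IsRigidLeft p (𝒢.inclLeft h.1).range (𝒢.inclRight h.1).range X₁ X₁') := by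
  obtain ⟨e, he, hs⟩ := h𝒢.standard i j h.1
  obtain ⟨B, X₁, X₂, B', X₁', X₂', ha, hr⟩ := hs.exists_isApartment (Nat.mul_pos hf he) h.2
  exact ⟨B, X₁, X₂, B', X₁', X₂', ha, fun hl => (hr hl).1⟩

/-- If a vertex group is trivial in a completion then so are all groups of the amalgam. -/
theorem subsingleton_of_hom_eq_one (hconn : Γ.graph.Connected) {i : I}
    (hi : ∀ g, γ.hom (AmalgamIndex.vertex i) g = 1) : Subsingleton A := by
  have hvertex : ∀ j, ∀ g, γ.hom (AmalgamIndex.vertex j) g = 1 := by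
    intro j
    obtain ⟨w⟩ := hconn.preconnected i j
    induction w with
    | nil => exact hi
    | cons hadj _ ih =>
      refine ih fun g => ?_
      obtain ⟨_, _, _, _, _, _, ha, -⟩ := h𝒢.exists_isApartment hf hadj
      have htop := ha.normal_left (γ.hom _).ker inferInstance (by
        rintro _ ⟨g, rfl⟩
        rw [MonoidHom.mem_ker, γ.hom_incl, hi])
      rw [← γ.hom_incl (AmalgamIndex.vertex_lt_right hadj.1), ← MonoidHom.mem_ker, htop]
      trivial
  have hker : ∀ x, (γ.hom x).range = ⊥ := by
    rintro ⟨J, hJ, hJ2⟩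
    rw [MonoidHom.range_eq_bot_iff, ← MonoidHom.ker_eq_top_iff]
    rcases Nat.lt_or_ge 1 J.card with h1 | h1
    · obtain ⟨j, k, hjk, rfl⟩ := Finset.card_eq_two.1 (le_antisymm hJ2 h1)
      have hsup : (𝒢.inclLeft hjk).range ⊔ (𝒢.inclRight hjk).range = ⊤ := by
        by_cases h : Γ.graph.Adj j k
        · obtain ⟨_, _, _, _, _, _, ha, -⟩ := h𝒢.exists_isApartment hf h
          exact ha.sup_eq_top
        · obtain ⟨n, hn⟩ := h𝒢.isA1A1 hjk h
          exact hn.sup_eq_top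
      refine top_le_iff.1 ((hsup.symm.le.trans (sup_le ?_ ?_)) : _ ≤ (γ.hom (.pair j k)).ker)
      · rintro _ ⟨g, rfl⟩
        rw [MonoidHom.mem_ker, γ.hom_incl, hvertex]
      · rintro _ ⟨g, rfl⟩
        rw [MonoidHom.mem_ker, γ.hom_incl, hvertex]
    · obtain ⟨j, rfl⟩ := Finset.card_eq_one.1 (le_antisymm h1 hJ.card_pos)
      exact top_le_iff.1 fun g _ => hvertex j g
  rw [← Subgroup.subsingleton_iff, ← subsingleton_iff_bot_eq_top, ← γ.generates,
    iSup_congr hker, iSup_bot]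

end IsCurtisTits
end Amalgam

/-! ### Independence of the edge -/

namespace Amalgam

variable {I : Type v} [DecidableEq I] {𝒢 : Amalgam.{u, v} (AmalgamIndex I)}

namespace IsCurtisTits

variable {p : ℕ} [Fact p.Prime] {f : ℕ} {Γ : LieDiagram I} (h𝒢 : 𝒢.IsCurtisTits p f Γ)
  (hf : 0 < f) {A : Type*} [Group A] (γ : 𝒢.Completion A)

include h𝒢 hf γ

/-- Suppose that a root group `Q` of `G_i` singled out by the edge `{i, k}` is not singled out by
an edge `{i, j}` of type `A₂`. In the completion, the root group of `G_k` opposite to the one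
next to `Q` centralizes `Q` and `G_j`, hence `G_{i,j}` by rigidity. So the kernel of the completion
on `G_{i,k}` meets `G_i` non-trivially, and `G_i` is trivial in the completion by rigidity
again. -/
theorem edgeRoots_subset [Nontrivial A] (hconn : Γ.graph.Connected) {i j k : I}
    (hij : Γ.graph.Adj i j) (hik : Γ.graph.Adj i k) (hjk : j ≠ k) (hn : ¬Γ.graph.Adj j k)
    (hl : Γ.label i j = .A2) : 𝒢.edgeRoots p hik.1 ⊆ 𝒢.edgeRoots p hij.1 := by
  obtain ⟨_, X₁, X₂, _, X₁', X₂', ha, hr⟩ := h𝒢.exists_isApartment hf hij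
  replace hr := hr hl
  obtain ⟨P, P', -, -, hPP', hP, hP', -, -⟩ :=
    ha.exists_rootGroups_eq (𝒢.incl_injective _)
  obtain ⟨_, Z₁, Z₂, _, Z₁', Z₂', hb, -⟩ := h𝒢.exists_isApartment hf hik
  obtain ⟨R, R', -, -, hRR', hR, hR', -, -⟩ :=
    hb.exists_rootGroups_eq (𝒢.incl_injective _)
  intro Q hQ
  by_contra hQ'
  rw [edgeRoots, hPP'] at hQ'
  simp only [Set.mem_insert_iff, Set.mem_singleton_iff, not_or] at hQ'
  -- the opposite root group of `G_k`
  obtain ⟨B, Y₁, Y₂, hY, hcomm⟩ : ∃ B Y₁ Y₂, IsChamber p (𝒢.inclLeft hik.1).range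
      (𝒢.inclRight hik.1).range B Y₁ Y₂ ∧
      ∀ x ∈ (Q : Subgroup (𝒢.vertexGroup i)).map (𝒢.inclLeft hik.1), ∀ y ∈ Y₂,
        Commute x y := by
    rw [edgeRoots, hRR'] at hQ
    rcases hQ with rfl | rfl
    · exact ⟨_, _, _, hb.neg, hR ▸ hb.commute⟩
    · exact ⟨_, _, _, hb.pos, hR' ▸ hb.commute'⟩
  have hcent : ∀ y ∈ Y₂, ∀ g : 𝒢.vertexGroup i, Commute (γ.hom _ g) (γ.hom _ y) := by
    intro y hy g
    obtain ⟨y, rfl⟩ := hY.sylow_right.2.1 hy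
    rw [γ.hom_incl]
    let C := (Subgroup.centralizer {γ.hom _ y}).comap (γ.hom (AmalgamIndex.pair i j))
    have hC : ∀ z, z ∈ C ↔ Commute (γ.hom _ y) (γ.hom _ z) := fun z => by
      rw [Subgroup.mem_comap, Subgroup.mem_centralizer_singleton_iff]
      exact ⟨fun h => h.symm, fun h => Eq.symm h⟩
    have hQC : (Q : Subgroup (𝒢.vertexGroup i)).map (𝒢.inclLeft hij.1) ≤ C := by
      rintro _ ⟨x, hx, rfl⟩
      rw [hC, γ.hom_incl]
      have := (hcomm _ ⟨x, hx, rfl⟩ _ hy).map (γ.hom _)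
      rw [γ.hom_incl, γ.hom_incl] at this
      exact this.symm
    have hjC : (𝒢.inclRight hij.1).range ≤ C := by
      rintro _ ⟨x, rfl⟩
      rw [hC, γ.hom_incl]
      exact (h𝒢.commute_hom γ hjk hn x y).symm
    have hsylow : IsSylowIn p (𝒢.inclLeft hij.1).range
        ((Q : Subgroup (𝒢.vertexGroup i)).map (𝒢.inclLeft hij.1)) :=
      Q.isSylowIn_map (𝒢.incl_injective _)
    have htop := hr.sup_eq_top _ hsylow
      (fun h => hQ'.1 (Sylow.ext (Subgroup.map_injective (𝒢.incl_injective _) (h.trans hP.symm))))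
      (fun h => hQ'.2 (Sylow.ext (Subgroup.map_injective (𝒢.incl_injective _) (h.trans hP'.symm))))
    have hg : 𝒢.inclLeft hij.1 g ∈ C := sup_le hQC hjC (htop ▸ Subgroup.mem_top _)
    rw [hC, γ.hom_incl] at hg
    exact hg.symm
  obtain ⟨_, ⟨g, rfl⟩, hg, hg1⟩ := hY.exists_right (γ.hom _).ker inferInstance (by
    rintro y hy _ ⟨g, rfl⟩
    rw [MonoidHom.mem_ker, map_commutatorElement, commutatorElement_eq_one_iff_commute,
      γ.hom_incl]
    exact (hcent y hy g).symm)
  rw [MonoidHom.mem_ker, γ.hom_incl] at hg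
  have htop := hr.normal_eq_top (γ.hom _).ker inferInstance (𝒢.inclLeft hij.1 g) ⟨g, rfl⟩
    (by rw [MonoidHom.mem_ker, γ.hom_incl, hg])
    (fun h => hg1 (by
      rw [(𝒢.incl_injective _) (h.trans (map_one _).symm), map_one]))
  have := h𝒢.subsingleton_of_hom_eq_one hf γ hconn (i := i) fun g => by
    rw [← γ.hom_incl (AmalgamIndex.vertex_lt_left hij.1), ← MonoidHom.mem_ker, htop]
    trivial
  exact not_subsingleton A this

theorem edgeRoots_eq [Nontrivial A] (hconn : Γ.graph.Connected) (h3 : Γ.ThreeSpherical)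
    {i j k : I} (hij : Γ.graph.Adj i j) (hik : Γ.graph.Adj i k) :
    𝒢.edgeRoots p hij.1 = 𝒢.edgeRoots p hik.1 := by
  obtain rfl | hjk := eq_or_ne j k
  · rfl
  have pair : ∀ {l} (hil : Γ.graph.Adj i l), ∃ P P', P ≠ P' ∧ 𝒢.edgeRoots p hil.1 = {P, P'} := by
    intro l hil
    obtain ⟨_, _, _, _, _, _, ha, -⟩ := h𝒢.exists_isApartment hf hil
    obtain ⟨P, P', hne, -, h, -⟩ := ha.exists_rootGroups_eq (𝒢.incl_injective _)
    exact ⟨P, P', hne, h⟩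
  obtain ⟨P, P', hP, e⟩ := pair hij
  obtain ⟨Q, Q', hQ, e'⟩ := pair hik
  have hn := h3.not_adj hij hik
  have hcard : (𝒢.edgeRoots p hij.1).ncard = (𝒢.edgeRoots p hik.1).ncard := by
    rw [e, e', Set.ncard_pair hP, Set.ncard_pair hQ]
  rcases h3.label_eq_A2 hij hik hjk with hl | hl
  · exact (Set.eq_of_subset_of_ncard_le (h𝒢.edgeRoots_subset hf γ hconn hij hik hjk hn hl)
      hcard.le (by rw [e]; exact Set.toFinite _)).symm
  · exact Set.eq_of_subset_of_ncard_le
      (h𝒢.edgeRoots_subset hf γ hconn hik hij hjk.symm (fun h => hn h.symm) hl)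
      hcard.ge (by rw [e']; exact Set.toFinite _)

end IsCurtisTits

/-- A weak system consists of the pairs of root groups that the edges single out. -/
theorem IsWeakSystem.eq_edgeRoots {p : ℕ} [Fact p.Prime] {f : ℕ} {Γ : LieDiagram I}
    {X : ∀ i, Set (Sylow p (𝒢.vertexGroup i))} (hX : 𝒢.IsWeakSystem p Γ X)
    (h𝒢 : 𝒢.IsCurtisTits p f Γ) (hf : 0 < f) {i j : I} (h : Γ.graph.Adj i j) :
    X i = 𝒢.edgeRoots p h.1 := by
  obtain ⟨B, X₁, X₂, B', X₁', X₂', ha, -⟩ := h𝒢.exists_isApartment hf h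
  obtain ⟨P, P', hne, -, hPP', -, -, hP, hP'⟩ := ha.exists_rootGroups_eq (𝒢.incl_injective _)
  obtain ⟨Q, Q', -, -, hQQ'⟩ := hX.opposite i
  obtain ⟨Bp, Bm, hop, hB⟩ := hX.edge i j h
  obtain ⟨hAp, ⟨Rp, ⟨hRp, hRp'⟩, -⟩, -⟩ := hB Bp (Or.inl rfl)
  obtain ⟨hAm, ⟨Rm, ⟨hRm, hRm'⟩, -⟩, -⟩ := hB Bm (Or.inr rfl)
  have hBp : IsBorel p Bp := let ⟨U, _, hU, _, _⟩ := hop; ⟨U, hU⟩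
  have hBm : IsBorel p Bm := let ⟨_, V, _, hV, _⟩ := hop; ⟨V, hV⟩
  have hmem : P ∈ X i ∧ P' ∈ X i := by
    rcases ha.unique Bp hBp hAp with rfl | rfl <;> rcases ha.unique Bm hBm hAm with rfl | rfl
    · exact absurd hop ha.pos.not_areOppositeBorels
    · exact ⟨(hP _).1 hRp' ▸ hRp, (hP' _).1 hRm' ▸ hRm⟩
    · exact ⟨(hP _).1 hRm' ▸ hRm, (hP' _).1 hRp' ▸ hRp⟩
    · exact absurd hop ha.neg.not_areOppositeBorels
  rw [edgeRoots, hPP']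
  refine (Set.eq_of_subset_of_ncard_le (Set.pair_subset hmem.1 hmem.2) ?_ ?_).symm
  · rw [Set.ncard_pair hne, hQQ']
    exact Set.ncard_insert_le _ _ |>.trans (by rw [Set.ncard_singleton])
  · rw [hQQ']
    exact Set.toFinite _

end Amalgam

theorem mainTheorem4 {I : Type v} [Fintype I] [DecidableEq I]
    (p : ℕ) [Fact p.Prime] (f : ℕ) (hf : 0 < f)
    (Γ : LieDiagram I) (hconn : Γ.graph.Connected) (h3 : Γ.ThreeSpherical)
    (𝒢 : Amalgam.{u, v} (AmalgamIndex I)) (h𝒢 : 𝒢.IsCurtisTits p f Γ)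
    {A : Type*} [Group A] [Nontrivial A] (γ : 𝒢.Completion A) :
    ∃! X : ∀ i, Set (Sylow p (𝒢.vertexGroup i)), 𝒢.IsWeakSystem p Γ X := by
  obtain ⟨i₀, j₀, h₀, -⟩ := h𝒢.base_field
  have : Nontrivial I := ⟨i₀, j₀, h₀.1⟩
  choose nb hnb using fun i => hconn.preconnected.exists_adj_of_nontrivial i
  have heq : ∀ {i j} (h : Γ.graph.Adj i j), 𝒢.edgeRoots p (hnb i).1 = 𝒢.edgeRoots p h.1 :=
    fun h => h𝒢.edgeRoots_eq hf γ hconn h3 (hnb _) h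
  have unique : ∀ {α : Type u} {S : Set α} {P P' R : α} {q : α → Prop}, S = {P, P'} →
      (R = P ∨ R = P') → (∀ Q, q Q ↔ Q = R) → ∃! Q, Q ∈ S ∧ q Q := by
    rintro α S P P' R q rfl hR hq
    exact ⟨R, ⟨hR, (hq R).2 rfl⟩, fun Q hQ => (hq Q).1 hQ.2⟩
  refine ⟨fun i => 𝒢.edgeRoots p (hnb i).1, ⟨fun i => ?_, fun i j h => ?_⟩, fun X hX => ?_⟩
  · obtain ⟨_, _, _, _, _, _, ha, -⟩ := h𝒢.exists_isApartment hf (hnb i)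
    obtain ⟨P, P', hne, hinf, hPP', -⟩ := ha.exists_rootGroups_eq (𝒢.incl_injective _)
    exact ⟨P, P', hne, hinf, hPP'⟩
  · obtain ⟨B, _, _, B', _, _, ha, -⟩ := h𝒢.exists_isApartment hf h
    obtain ⟨P, P', -, -, hPP', -, -, hP, hP'⟩ := ha.exists_rootGroups_eq (𝒢.incl_injective _)
    obtain ⟨Q, Q', -, -, hQQ', -, -, hQ, hQ'⟩ :=
      ha.swap.exists_rootGroups_eq (𝒢.incl_injective _)
    rw [𝒢.rootGroups_inclRight p h.1 h.1.symm, ← heq h.symm] at hQQ'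
    have hPP'' := (heq h).trans hPP'
    refine ⟨B, B', ha.opposite, ?_⟩
    rintro C (rfl | rfl)
    · exact ⟨ha.pos.adapted, unique hPP'' (Or.inl rfl) hP, unique hQQ' (Or.inl rfl) hQ⟩
    · exact ⟨ha.neg.adapted, unique hPP'' (Or.inr rfl) hP', unique hQQ' (Or.inr rfl) hQ'⟩
  · exact funext fun i => hX.eq_edgeRoots h𝒢 hf (hnb i)
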